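/- All graphs are finite, simple and undirected. A cut-vertex of a graph $G$ is a vertex whose removal increases the number of connected components; a block of $G$ is a maximal vertex set inducing a connected graph without cut-vertices; $G$ is a block graph if every block is a clique. Let $G$ be a connected block graph. **Notation.** Let $\mathcal P_G$ be the set of all pairs $(u,B)$ and $(B,u)$ with $u$ a cut-vertex of $G$ and $B$ a block of $G$ containing $u$ (the directed edges of the block-tree); $u$ is the base of both pairs. Let $G[u,B]$ (respectively $G[B,u]$) be the connected component containing $u$ of the graph obtained from $G$ by deleting the edges from $u$ to vertices in $B$ (respectively to vertices not in $B$). Let $\beta(u,B)$ be the set of blocks of $G[u,B]$ that contain $u$, and $\kappa(B,u)$ the set of cut-vertices of $G[B,u]$ that lie in $B$. For a vertex set $S$ and $p\in\mathcal P_G$ put $S[p]=S\cap V(G[p])$, and for a set $S\subseteq V(G[p])$ put $S^\circ=S\setminus\{u\}$, where $u$ is the base of $p$. Booleans $ua(p)$, $p\in\mathcal P_G$, are defined recursively: $ua(B,u)$ is true if $G[B,u]$ is complete, and otherwise $ua(B,u)=\neg\big(\bigwedge_{v\in\kappa(B,u)}ua(v,B)\wedge B=\kappa(B,u)\cup\{u\}\big)$;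 and $ua(u,B)=\bigvee_{B'\in\beta(u,B)}ua(B',u)$. In arithmetic expressions true is $1$ and false is $0$. For an independent set $Q\subseteq V(G[p])$ of $G$, the capacity $cap(Q)$ with respect to $p$ is defined recursively: for $p=(B,u)$, $$cap(Q)=\sum_{v\in\kappa(B,u)}cap(Q[v,B])+ua(B,u)-|B\cap Q^\circ|;$$ for $p=(u,B)$, $cap(Q)=0$ if some $B'\in\beta(u,B)$ has $cap(Q[B',u])=0$ and $ua(B',u)$ true, and otherwise $$cap(Q)=\sum_{B'\in\beta(u,B)}\big(cap(Q[B',u])-ua(B',u)\big)+ua(u,B).$$ An independent set $C'$ is reachable from an independent set $C$ if there are independent sets $C=C_0,C_1,\dots,C_k=C'$ ($k\ge 0$) such that for each $i<k$ either $C_{i+1}=C_i$, or $C_i\setminus C_{i+1}=\{v\}$ and $C_{i+1}\setminus C_i=\{w\}$ for some edge $vw$ of $G$. For an independent set $C$ and $p\in\mathcal P_G$ let $$pot_G(C,p)=\max\{cap(C'[p])+|C'[p]^\circ|-|C[p]^\circ| : C'\text{ an independent set reachable from }C\}.$$ **Procedure Compute-potentials$(G,C)$.** Compute the cut-vertices,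 the blocks and the values $ua(p)$, $p \in \mathcal P_G$. Set $y[p]\leftarrow 0$ for all $p\in\mathcal P_G$. Then repeat sweeps over $\mathcal P_G$ until a sweep changes nothing. In a sweep, for each $p\in\mathcal P_G$ in turn, compute a number $y'$: if $p=(B,u)$, then $y'=\sum_{v\in\kappa(B,u)}y[v,B]+ua(B,u)-|B\cap C[B,u]^\circ|$; if $p=(u,B)$ and there are no two distinct blocks $B',B''$ containing $u$ with $y[B',u]=y[B'',u]=0$ and $ua(B',u)$, $ua(B'',u)$ both true, then $y'=\sum_{B'\in\beta(u,B)}(y[B',u]-ua(B',u))+ua(u,B)$; otherwise $y'=y[p]$. If $y[p]<y'$, set $y[p]\leftarrow y'$ and end the sweep. Finally return $y$. **Theorem.** The procedure Compute-potentials, implemented on a unit-cost random access machine with input the adjacency matrix of $G$ and the indicator vector of $C$, has the following property. There is a constant $K$ such that for every connected block graph $G$ and every independent set $C$ of $G$ the procedure halts after at most $K\cdot\max(1,|E(G)|)^4$ steps, and then it has computed the list of the blocks of $G$ and, for each $p\in\mathcal P_G$, the value $y[p]=pot_G(C,p)$. -/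

import Mathlib

namespace TokenSliding

/-! ### Blocks, cut-vertices and block graphs

Induced subgraphs of `G` are given by their vertex sets `S`. -/

section Graph

variable {V : Type*} [DecidableEq V]

open Classical in
/-- The cut-vertices of `G[S]`: the `v ∈ S` such that `G[S] - v` has more connected components
than `G[S]`. -/
noncomputable def cutVerts (G : SimpleGraph V) (S : Finset V) : Finset V :=
  S.filter fun v =>
    Nat.card (G.induce (S : Set V)).ConnectedComponent <
      Nat.card (G.induce ((S.erase v : Finset V) : Set V)).ConnectedComponent

open Classical in
/-- The blocks of `G[S]`: the maximal sets `T ⊆ S` such that `G[T]` is connected and has no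
cut-vertex. -/
noncomputable def blocks (G : SimpleGraph V) (S : Finset V) : Finset (Finset V) :=
  S.powerset.filter fun B =>
    Maximal (fun T : Finset V =>
      T ⊆ S ∧ (G.induce (T : Set V)).Connected ∧ cutVerts G T = ∅) B

variable [Fintype V]

/-- A block graph: every block is a clique. -/
def IsBlockGraph (G : SimpleGraph V) : Prop :=
  ∀ B ∈ blocks G Finset.univ, G.IsClique (B : Set V)

/-! ### Reachability by token sliding -/

/-- `I₁ → I₂`: both sets are independent, and they are equal or differ by sliding one token along
an edge. -/
def Slide (G : SimpleGraph V) (I₁ I₂ : Finset V) : Prop :=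
  G.IsIndepSet (I₁ : Set V) ∧ G.IsIndepSet (I₂ : Set V) ∧
    (I₁ = I₂ ∨ ∃ v₁ v₂, I₁ \ I₂ = {v₁} ∧ I₂ \ I₁ = {v₂} ∧ G.Adj v₁ v₂)

/-- `I'` is reachable from the independent set `I`. -/
def Reachable (G : SimpleGraph V) (I I' : Finset V) : Prop :=
  Relation.ReflTransGen (Slide G) I I'

/-! ### Directed edges of the block-tree -/

/-- Ordered pairs `(u, B)` and `(B, u)` of a vertex and a set of vertices. -/
inductive Arc (V : Type*) where
  /-- the pair `(u, B)` -/
  | toBlock (u : V) (B : Finset V)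
  /-- the pair `(B, u)` -/
  | toCut (B : Finset V) (u : V)

/-- The base of `(u, B)` and of `(B, u)` is `u`. -/
def Arc.base : Arc V → V
  | .toBlock u _ => u
  | .toCut _ u => u

/-- The block occurring in `(u, B)` and in `(B, u)`. -/
def Arc.block : Arc V → Finset V
  | .toBlock _ B => B
  | .toCut B _ => B

/-- The set of directed edges of the block-tree: pairs `(u, B)` and `(B, u)` with `u` a cut-vertex
of `G` and `B` a block of `G` that contains `u`. -/
def treeArcs (G : SimpleGraph V) : Set (Arc V) :=
  {p | p.base ∈ cutVerts G Finset.univ ∧ p.block ∈ blocks G Finset.univ ∧ p.base ∈ p.block}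

open Classical in
/-- The vertex set of `G[p]`. For `p = (u, B)` (respectively `(B, u)`), `G[p]` is the connected
component of `u` after removing from `G` the edges from `u` to vertices in `B` (respectively not
in `B`). -/
noncomputable def Arc.verts (G : SimpleGraph V) : Arc V → Finset V
  | .toBlock u B =>
      Finset.univ.filter fun w => (G.deleteEdges {e | ∃ v ∈ B, e = s(u, v)}).Reachable u w
  | .toCut B u =>
      Finset.univ.filter fun w => (G.deleteEdges {e | ∃ v ∉ B, e = s(u, v)}).Reachable u w

/-- `κ(B, u)`: the vertices of `B` that are cut-vertices of `G[B, u]`. -/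
noncomputable def kappa (G : SimpleGraph V) (B : Finset V) (u : V) : Finset V :=
  B ∩ cutVerts G ((Arc.toCut B u).verts G)

/-- `β(u, B)`: the blocks of `G[u, B]` that contain `u`. -/
noncomputable def beta (G : SimpleGraph V) (u : V) (B : Finset V) : Finset (Finset V) :=
  (blocks G ((Arc.toBlock u B).verts G)).filter fun B' => u ∈ B'

/-- A measure along which the recursions below descend: `G[v, B]` misses the vertex `u` of
`G[B, u]` for `v ∈ κ(B, u)`, and `G[B', u]` is a subgraph of `G[u, B]` for `B' ∈ β(u, B)`. -/
noncomputable def Arc.size (G : SimpleGraph V) : Arc V → ℕ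
  | .toBlock u B => 2 * ((Arc.toBlock u B).verts G).card + 1
  | .toCut B u => 2 * ((Arc.toCut B u).verts G).card

/-- The Boolean `ua(p)`. It is true if `p = (B, u)` with `G[B, u]` complete (depth `0`); otherwise
`ua(B, u) = ¬ (⋀_{v ∈ κ(B, u)} ua(v, B) ∧ B = κ(B, u) ∪ {u})` and
`ua(u, B) = ⋁_{B' ∈ β(u, B)} ua(B', u)`. The comparisons of sizes hold for all directed edges of
the block-tree of a connected block graph; they only make the recursion well-founded for all
arguments. -/
noncomputable def ua (G : SimpleGraph V) : Arc V → Prop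
  | .toCut B u =>
      G.IsClique ((Arc.toCut B u).verts G : Set V) ∨
      ¬ ((∀ v ∈ kappa G B u, ∀ _h : (Arc.toBlock v B).size G < (Arc.toCut B u).size G,
            ua G (.toBlock v B)) ∧
          B = kappa G B u ∪ {u})
  | .toBlock u B =>
      ∃ B' ∈ beta G u B, ∃ _h : (Arc.toCut B' u).size G < (Arc.toBlock u B).size G,
        ua G (.toCut B' u)
termination_by p => p.size G

open Classical in
/-- `ua(p)` as a number: `1` for true and `0` for false. -/
noncomputable def uaNum (G : SimpleGraph V) (p : Arc V) : ℤ := if ua G p then 1 else 0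

open Classical in
/-- The capacity `cap(C)` of a `p`-independent set `C`. As for `ua`, the comparisons of sizes only
make the recursion well-founded for all arguments. -/
noncomputable def cap (G : SimpleGraph V) : Arc V → Finset V → ℤ
  | .toCut B u, C =>
      (∑ v ∈ kappa G B u,
        if _h : (Arc.toBlock v B).size G < (Arc.toCut B u).size G then
          cap G (.toBlock v B) ((Arc.toBlock v B).verts G ∩ C) else 0)
      + uaNum G (.toCut B u) - ((B ∩ C.erase u).card : ℤ)
  | .toBlock u B, C =>
      if ∃ B' ∈ beta G u B,
          (if _h : (Arc.toCut B' u).size G < (Arc.toBlock u B).size G then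
            cap G (.toCut B' u) ((Arc.toCut B' u).verts G ∩ C) else 0) = 0 ∧
          ua G (.toCut B' u) then 0
      else
        (∑ B' ∈ beta G u B,
          ((if _h : (Arc.toCut B' u).size G < (Arc.toBlock u B).size G then
            cap G (.toCut B' u) ((Arc.toCut B' u).verts G ∩ C) else 0)
            - uaNum G (.toCut B' u)))
        + uaNum G (.toBlock u B)
termination_by p => p.size G

/-- The numbers `cap(C'[p]) + |C'[p] \ {u}| - |C[p] \ {u}|`, where `u` is the base of `p` and `C'`
is reachable from `C`. -/
def potSet (G : SimpleGraph V) (C : Finset V) (p : Arc V) : Set ℤ :=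
  {k | ∃ C' : Finset V, Reachable G C C' ∧
    k = cap G p (p.verts G ∩ C') + (((p.verts G ∩ C').erase p.base).card : ℤ)
      - (((p.verts G ∩ C).erase p.base).card : ℤ)}

/-- `x` is the potential `pot(C, p)`, the maximum of `potSet G C p`. -/
def IsPot (G : SimpleGraph V) (C : Finset V) (p : Arc V) (x : ℤ) : Prop :=
  IsGreatest (potSet G C p) x

end Graph

/-! ### A random access machine with unit cost

A store has integer registers and two-dimensional integer arrays. Every operation in an expression
(reading a constant, a register or an array cell, adding, subtracting, comparing, connecting truth
values) takes one step, and so does every assignment, every test of a condition or of a loop, and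
every empty command. -/

/-- Names of the registers. -/
inductive Reg where
  | n | m | i | j | w | b | c | u | v | r | ok | cnt | all | some | updated | y' | sum
  deriving DecidableEq

/-- Names of the arrays. -/
inductive Arr where
  | adj | tok | inB | cut | uaBV | uaVB | yBV | yVB
  deriving DecidableEq

structure Store where
  reg : Reg → ℤ
  arr : Arr → ℤ → ℤ → ℤ

/-- Expressions. As conditions, nonzero values count as true. -/
inductive Expr where
  | lit (k : ℤ)
  | reg (x : Reg)
  | get (a : Arr) (e f : Expr)
  | add (e f : Expr)
  | sub (e f : Expr)
  | eq (e f : Expr)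
  | lt (e f : Expr)
  | and (e f : Expr)
  | or (e f : Expr)
  | not (e : Expr)

def Expr.eval (s : Store) : Expr → ℤ
  | lit k => k
  | reg x => s.reg x
  | get a e f => s.arr a (e.eval s) (f.eval s)
  | add e f => e.eval s + f.eval s
  | sub e f => e.eval s - f.eval s
  | eq e f => if e.eval s = f.eval s then 1 else 0
  | lt e f => if e.eval s < f.eval s then 1 else 0
  | and e f => if e.eval s ≠ 0 ∧ f.eval s ≠ 0 then 1 else 0
  | or e f => if e.eval s ≠ 0 ∨ f.eval s ≠ 0 then 1 else 0
  | not e => if e.eval s = 0 then 1 else 0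

/-- The number of steps needed to evaluate an expression. -/
def Expr.cost : Expr → ℕ
  | lit _ => 1
  | reg _ => 1
  | get _ e f => e.cost + f.cost + 1
  | add e f => e.cost + f.cost + 1
  | sub e f => e.cost + f.cost + 1
  | eq e f => e.cost + f.cost + 1
  | lt e f => e.cost + f.cost + 1
  | and e f => e.cost + f.cost + 1
  | or e f => e.cost + f.cost + 1
  | not e => e.cost + 1

inductive Cmd where
  | skip
  | set (x : Reg) (e : Expr)
  | put (a : Arr) (e f : Expr) (g : Expr)
  | seq (c d : Cmd)
  | cond (e : Expr) (c d : Cmd)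
  | loop (e : Expr) (c : Cmd)

def Store.setReg (s : Store) (x : Reg) (k : ℤ) : Store :=
  ⟨Function.update s.reg x k, s.arr⟩

def Store.setArr (s : Store) (a : Arr) (i j k : ℤ) : Store :=
  ⟨s.reg, Function.update s.arr a
    (Function.update (s.arr a) i (Function.update (s.arr a i) j k))⟩

/-- `Exec c s t s'`: started in the store `s`, the command `c` halts after exactly `t` steps in the
store `s'`. -/
inductive Exec : Cmd → Store → ℕ → Store → Prop where
  | skip (s : Store) : Exec .skip s 1 s
  | set (x : Reg) (e : Expr) (s : Store) :
      Exec (.set x e) s (e.cost + 1) (s.setReg x (e.eval s))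
  | put (a : Arr) (e f g : Expr) (s : Store) :
      Exec (.put a e f g) s (e.cost + f.cost + g.cost + 1)
        (s.setArr a (e.eval s) (f.eval s) (g.eval s))
  | seq {c d : Cmd} {s s' s'' : Store} {t t' : ℕ} :
      Exec c s t s' → Exec d s' t' s'' → Exec (.seq c d) s (t + t') s''
  | condTrue {e : Expr} {c d : Cmd} {s s' : Store} {t : ℕ} :
      e.eval s ≠ 0 → Exec c s t s' → Exec (.cond e c d) s (e.cost + 1 + t) s'
  | condFalse {e : Expr} {c d : Cmd} {s s' : Store} {t : ℕ} :
      e.eval s = 0 → Exec d s t s' → Exec (.cond e c d) s (e.cost + 1 + t) s'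
  | loopFalse {e : Expr} {c : Cmd} {s : Store} :
      e.eval s = 0 → Exec (.loop e c) s (e.cost + 1) s
  | loopTrue {e : Expr} {c : Cmd} {s s' s'' : Store} {t t' : ℕ} :
      e.eval s ≠ 0 → Exec c s t s' → Exec (.loop e c) s' t' s'' →
      Exec (.loop e c) s (e.cost + 1 + t + t') s''

/-- The machine is deterministic: a run has only one length and one result. -/
theorem Exec.deterministic {c : Cmd} {s s₁ s₂ : Store} {t₁ t₂ : ℕ}
    (h₁ : Exec c s t₁ s₁) (h₂ : Exec c s t₂ s₂) : t₁ = t₂ ∧ s₁ = s₂ := by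
  induction h₁ generalizing t₂ s₂ with
  | skip | set | put => cases h₂; exact ⟨rfl, rfl⟩
  | seq _ _ ih ih' =>
    cases h₂ with
    | seq a b =>
      obtain ⟨rfl, rfl⟩ := ih a
      obtain ⟨rfl, rfl⟩ := ih' b
      exact ⟨rfl, rfl⟩
  | condTrue h _ ih =>
    cases h₂ with
    | condTrue _ a => obtain ⟨rfl, rfl⟩ := ih a; exact ⟨rfl, rfl⟩
    | condFalse h' _ => exact absurd h' h
  | condFalse h _ ih =>
    cases h₂ with
    | condTrue h' _ => exact absurd h h'
    | condFalse _ a => obtain ⟨rfl, rfl⟩ := ih a; exact ⟨rfl, rfl⟩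
  | loopFalse h =>
    cases h₂ with
    | loopFalse => exact ⟨rfl, rfl⟩
    | loopTrue h' => exact absurd h h'
  | loopTrue h _ _ ih ih' =>
    cases h₂ with
    | loopFalse h' => exact absurd h' h
    | loopTrue _ a b =>
      obtain ⟨rfl, rfl⟩ := ih a
      obtain ⟨rfl, rfl⟩ := ih' b
      exact ⟨rfl, rfl⟩

/-! ### The procedure -/

section Program

instance : Coe Reg Expr := ⟨Expr.reg⟩
instance : Add Expr := ⟨Expr.add⟩
instance : Sub Expr := ⟨Expr.sub⟩
instance (k : ℕ) : OfNat Expr k := ⟨Expr.lit k⟩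

/-- Sequential composition of a list of commands. -/
def Cmd.list : List Cmd → Cmd
  | [] => .skip
  | [c] => c
  | c :: d :: l => .seq c (Cmd.list (d :: l))

/-- A conditional without an alternative. -/
def Cmd.when (e : Expr) (c : Cmd) : Cmd := .cond e c .skip

/-- `for x = 0, …, e - 1 do c`. -/
def Cmd.for (x : Reg) (e : Expr) (c : Cmd) : Cmd :=
  .list [.set x 0, .loop (.lt x e) (.list [c, .set x (x + 1)])]

open Reg Arr TokenSliding.Expr

/-- Lists the blocks of a connected block graph on `0, …, n - 1`: afterwards `m` is the number of
blocks, and `inB[b][w]` tells whether the `b`-th block contains `w`. The block of an edge `ij` with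
`i < j` consists of `i`, `j` and their common neighbours; it is listed when `i` and `j` are its two
smallest vertices. A graph with one vertex has that vertex as its only block. -/
def findBlocks : Cmd :=
  .list [
    .set m 0,
    .when (eq n 1) (.list [.put inB 0 0 1, .set m 1]),
    .for i n (.for j n (.when (and (lt i j) (get adj i j)) (.list [
      .set ok 1,
      .for w n (.when (and (lt w j) (and (get adj i w) (get adj w j))) (.set ok 0)),
      .when ok (.list [
        .for w n (.when (or (or (eq w i) (eq w j)) (and (get adj i w) (get adj w j)))
          (.put inB m w 1)),
        .set m (m + 1)])])))]

/-- Marks the cut-vertices of a connected block graph, the vertices in at least two blocks. -/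
def findCutVerts : Cmd :=
  .for u n (.list [
    .set cnt 0,
    .for b m (.when (get inB b u) (.set cnt (cnt + 1))),
    .when (lt 1 cnt) (.put cut u 0 1)])

/-- The body of a loop over the pairs of a cut-vertex `u` and a block `b` that contains it. -/
def forTreeEdges (body : Cmd) : Cmd :=
  .for b m (.for u n (.when (and (get inB b u) (get cut u 0)) body))

/-- Computes `ua` in the tables `uaBV[b][u]`, for pairs `(B, u)`, and `uaVB[u][b]`, for pairs
`(u, B)`, by iterating the recursion as often as the depth of the block-tree can require. -/
def computeUa : Cmd :=
  .for r (n + n + 2) (forTreeEdges (.list [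
    .set all 1,
    .for v n (.when (and (get inB b v) (not (eq v u)))
      (.when (not (and (get cut v 0) (get uaVB v b))) (.set all 0))),
    .put uaBV b u (not all),
    .set some 0,
    .for c m (.when (and (get inB c u) (not (eq c b)))
      (.when (get uaBV c u) (.set some 1))),
    .put uaVB u b some]))

/-- The update of `y[B, u]`: the new value is
`∑_{v ∈ κ(B, u)} y[v, B] + ua(B, u) - |B ∩ (C[B, u] \ {u})|`. -/
def updateBV : Cmd :=
  .list [
    .set y' (get uaBV b u),
    .for v n (.when (and (get inB b v) (not (eq v u))) (.list [
      .when (get cut v 0) (.set y' (y' + get yVB v b)),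
      .when (get tok v 0) (.set y' (y' - 1))])),
    .when (lt (get yBV b u) y') (.list [.put yBV b u y', .set updated 1])]

/-- The update of `y[u, B]`: unless two distinct blocks `B'` and `B''` containing `u` have
`y[B', u] = y[B'', u] = 0` and `ua(B', u) = ua(B'', u) = True`, the new value is
`∑_{B' ∈ β(u, B)} (y[B', u] - ua(B', u)) + ua(u, B)`. -/
def updateVB : Cmd :=
  .list [
    .set y' (get yVB u b),
    .set cnt 0,
    .set sum (get uaVB u b),
    .for c m (.when (get inB c u) (.list [
      .when (and (eq (get yBV c u) 0) (get uaBV c u)) (.set cnt (cnt + 1)),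
      .when (not (eq c b)) (.set sum (sum + get yBV c u - get uaBV c u))])),
    .when (lt cnt 2) (.set y' sum),
    .when (lt (get yVB u b) y') (.list [.put yVB u b y', .set updated 1])]

/-- The fixed-point iteration: start with `y = 0`; as long as the last sweep over the directed
edges of the block-tree has increased a value, sweep again; a sweep ends with its first increase
(the rest of the sweep does nothing once `updated` is set). -/
def iteratePotentials : Cmd :=
  .list [
    .for b m (.for u n (.list [.put yBV b u 0, .put yVB u b 0])),
    .set updated 1,
    .loop updated (.list [
      .set updated 0,
      forTreeEdges (.list [
        .when (not updated) updateBV,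
        .when (not updated) updateVB])])]

/-- The procedure Compute-potentials, including the computation of the block-tree and of `ua`. -/
def computePotentials : Cmd :=
  .list [findBlocks, findCutVerts, computeUa, iteratePotentials]

end Program

open Classical in
/-- The initial store for the input `(G, C)`: the register `n` holds the number of vertices, `adj`
the adjacency matrix of `G`, `tok` the indicator of `C`, and everything else is `0`. -/
noncomputable def inputStore {n : ℕ} (G : SimpleGraph (Fin n)) (C : Finset (Fin n)) : Store where
  reg := fun x => match x with
    | .n => n
    | _ => 0
  arr := fun a i j => match a with
    | .adj => if ∃ v w : Fin n, i = (v : ℤ) ∧ j = (w : ℤ) ∧ G.Adj v w then 1 else 0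
    | .tok => if ∃ v ∈ C, i = (v : ℤ) ∧ j = 0 then 1 else 0
    | _ => 0

/-- The final store `s` holds the potentials: with respect to a numbering `blk` of the blocks of
`G` by `0, …, m - 1`, which the table `inB` describes, the cells `yBV[b][u]` and `yVB[u][b]` hold
the potentials of the directed edges `(B, u)` and `(u, B)`, where `B` is the `b`-th block. -/
def HoldsPotentials {n : ℕ} (G : SimpleGraph (Fin n)) (C : Finset (Fin n)) (s : Store) : Prop :=
  ∃ (m : ℕ) (blk : Fin m → Finset (Fin n)),
    s.reg .m = m ∧ Function.Injective blk ∧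
    (∀ B, B ∈ blocks G Finset.univ ↔ ∃ b, blk b = B) ∧
    (∀ (b : Fin m) (v : Fin n), s.arr .inB b v = if v ∈ blk b then 1 else 0) ∧
    ∀ (b : Fin m) (u : Fin n),
      (.toCut (blk b) u ∈ treeArcs G → IsPot G C (.toCut (blk b) u) (s.arr .yBV b u)) ∧
      (.toBlock u (blk b) ∈ treeArcs G → IsPot G C (.toBlock u (blk b)) (s.arr .yVB u b))

end TokenSliding

/-! Call capacity plus load the value of a directed edge `p` for a token set. The potential of `p`
is the largest value over all reachable sets minus the load of `C`. The theorem says that the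
iteration computes these potentials as the least nonnegative solution of a system of inequalities
(`Closed`), and the proof squeezes the result `y` from both sides.

Upper bound: the potentials are themselves `Closed` (`closed_of_isPot`). The iteration starts at 0,
below the potentials, and its updates are monotone, so `y` never exceeds them.

Lower bound: when a sweep changes nothing, `y` is `Closed`, and every nonnegative `Closed` `y`
dominates the potentials (`Closed.val_sub_load_le`). Such a `y` dominates the capacities of `C`.
Along a slide from `C` to `C'`, the function `y` shifted by the change of load is again nonnegative
and `Closed` for `C'` (`Closed.slide`). Following a sequence of slides to its end gives the bound
for every reachable set.

That the potentials are `Closed` is the combinatorial core. It requires one reachable set that is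
optimal in several branches at once. The gluing lemma `exists_glue` supplies it: an optimal
configuration inside `G[p]` can be combined with any reachable configuration outside. The outer
slides are replayed while the inside reacts in three ways, each proved by induction over the
block-tree without lowering a value. It frees the neighbours of the base (`CanClear`), takes in a
token from the base (`CanAbsorb`), or hands a token to the base (`CanEmit`). The Boolean `ua` and
the notion `Open` describe when there is room for this. For `(B, u)` the value is a sum over the
branches plus a constant, so gluing is enough. For `(u, B)` a branch that is not open destroys the
capacity. If only one branch at `u` is closed in a simultaneously optimal set, moving its token to
`u` opens it (`exists_move_to_cut`). Two closed branches would give two zeros of the kind excluded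
by the update rule.

Geometry enters through one fact: distinct blocks through `u` reach into distinct components of `G -
u` (`block_eq_of_conn`). It makes branches disjoint, leaves the base as their only gateway, and
turns the sets `κ` and `β` into statements about cut-vertices and blocks of `G`.

Running time: let `M = max(1, |E|)`. Then `n ≤ M + 1`, and the block sizes sum to at most `2M`,
which also bounds the number of blocks. A sweep does linear work for each incident pair of a block
and a cut-vertex, hence `O(M²)` in all. Every sweep but the last raises the sum of all values by at
least one, and that sum stays `O(M²)`. The other phases cost `O(M³)`. -/

set_option linter.unusedSectionVars false
set_option linter.unusedSimpArgs false

namespace TokenSliding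

/-! ### Walks confined to a vertex set. -/

section Walks

variable {V : Type*} {G : SimpleGraph V}

/-- Some walk from `a` to `b` stays in `S`. -/
def Conn (G : SimpleGraph V) (S : Set V) (a b : V) : Prop :=
  ∃ p : G.Walk a b, ∀ x ∈ p.support, x ∈ S

theorem Conn.refl {S : Set V} {a : V} (h : a ∈ S) : Conn G S a a := ⟨.nil, by simpa using h⟩

theorem Conn.left_mem {S : Set V} {a b : V} (h : Conn G S a b) : a ∈ S :=
  h.choose_spec _ h.choose.start_mem_support

theorem Conn.right_mem {S : Set V} {a b : V} (h : Conn G S a b) : b ∈ S :=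
  h.choose_spec _ h.choose.end_mem_support

theorem Conn.symm {S : Set V} {a b : V} (h : Conn G S a b) : Conn G S b a := by
  obtain ⟨p, hp⟩ := h
  exact ⟨p.reverse, by simpa using hp⟩

theorem Conn.trans {S : Set V} {a b c : V} (h : Conn G S a b) (h' : Conn G S b c) :
    Conn G S a c := by
  obtain ⟨p, hp⟩ := h
  obtain ⟨q, hq⟩ := h'
  refine ⟨p.append q, fun x hx => ?_⟩
  rw [SimpleGraph.Walk.mem_support_append_iff] at hx
  exact hx.elim (hp x) (hq x)

theorem Conn.mono {S T : Set V} {a b : V} (h : Conn G S a b) (hST : S ⊆ T) : Conn G T a b := by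
  obtain ⟨p, hp⟩ := h
  exact ⟨p, fun x hx => hST (hp x hx)⟩

theorem Conn.of_adj {S : Set V} {a b : V} (h : G.Adj a b) (ha : a ∈ S) (hb : b ∈ S) :
    Conn G S a b := ⟨.cons h .nil, by simp [ha, hb]⟩

theorem conn_univ_of_connected (hc : G.Connected) (a b : V) : Conn G Set.univ a b := by
  obtain ⟨p⟩ := hc.preconnected a b
  exact ⟨p, by simp⟩

/-- Cut-vertices and blocks are defined by connectivity of induced subgraphs. Confined walks of `G`
itself replace these, so that all arguments run in one graph and sets can be enlarged freely. -/
theorem preconnected_induce_iff_conn {S : Set V} :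
    (G.induce S).Preconnected ↔ ∀ a ∈ S, ∀ b ∈ S, Conn G S a b := by
  constructor
  · intro h a ha b hb
    have key : ∀ {x y : S} (p : (G.induce S).Walk x y), Conn G S x y := by
      intro x y p
      induction p with
      | nil => exact Conn.refl (Subtype.prop _)
      | @cons x y _ hxy _ ih =>
        exact (Conn.of_adj (SimpleGraph.induce_adj.1 hxy) x.2 y.2).trans ih
    obtain ⟨p⟩ := h ⟨a, ha⟩ ⟨b, hb⟩
    exact key p
  · rintro h ⟨a, ha⟩ ⟨b, hb⟩
    obtain ⟨p, hp⟩ := h a ha b hb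
    exact ⟨p.induce S hp⟩

/-- Every vertex of a walk within `S` is reached by a walk within `S`. -/
theorem conn_of_mem_support {S : Set V} {a b x : V} (p : G.Walk a b)
    (hp : ∀ x ∈ p.support, x ∈ S) (hx : x ∈ p.support) : Conn G S a x := by
  classical
  exact ⟨p.takeUntil x hx, fun y hy => hp y (p.support_takeUntil_subset_support hx hy)⟩

/-- The part of a walk after its last visit to `B`. -/
theorem Conn.exists_last_exit {S B : Set V} {a w : V} (h : Conn G S a w) (ha : a ∈ B)
    (hw : w ∉ B) : ∃ v ∈ B, v ∈ S ∧ ∃ b, b ∉ B ∧ G.Adj v b ∧ Conn G (S ∩ Bᶜ) b w := by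
  obtain ⟨p, hp⟩ := h
  -- For the induction the start need not lie in `B`: either the walk avoids `B` altogether or it
  -- has a last exit.
  have key : ∀ {a : V} (p : G.Walk a w), (∀ x ∈ p.support, x ∈ S) →
      Conn G (S ∩ Bᶜ) a w ∨
      ∃ v ∈ B, v ∈ S ∧ ∃ b, b ∉ B ∧ G.Adj v b ∧ Conn G (S ∩ Bᶜ) b w := by
    clear hp ha p a
    intro a p hp
    induction p with
    | nil => exact Or.inl (Conn.refl (Set.mem_inter (hp _ (by simp)) hw))
    | @cons a c w hac q ih =>
      have haS : a ∈ S := hp _ (by simp)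
      rcases ih hw (fun x hx => hp x (by simp [hx])) with h1 | h1
      · by_cases haB : a ∈ B
        · exact Or.inr ⟨a, haB, haS, c, h1.left_mem.2, hac, h1⟩
        · exact Or.inl ((Conn.of_adj hac (Set.mem_inter haS haB) h1.left_mem).trans h1)
      · exact Or.inr h1
  rcases key p hp with h1 | h1
  · exact absurd ha h1.left_mem.2
  · exact h1

/-- On a path, a vertex `x` other than `z` can be reached from one of the ends without
passing `z`. -/
theorem Conn.exists_path_avoiding {S : Set V} {a b : V} (h : Conn G S a b) :
    ∃ T : Finset V, (T : Set V) ⊆ S ∧ a ∈ T ∧ b ∈ T ∧ (∀ x ∈ T, Conn G T a x) ∧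
      ∀ z, ∀ x ∈ T, x ≠ z → Conn G ((T : Set V) ∩ {z}ᶜ) a x ∨ Conn G ((T : Set V) ∩ {z}ᶜ) b x := by
  classical
  obtain ⟨p, hp⟩ := h
  have hS : ∀ x ∈ p.bypass.support, x ∈ S := fun x hx => hp x (p.support_bypass_subset_support hx)
  have hpath := p.bypass_isPath
  generalize p.bypass = q at hS hpath
  refine ⟨q.support.toFinset, fun x hx => hS x (by simpa using hx), by simp, by simp, ?_, ?_⟩
  · intro x hx
    exact conn_of_mem_support q (by simp) (by simpa using hx)
  · intro z x hx hxz
    have hxq : x ∈ q.support := by simpa using hx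
    -- A path visits `z` at most once. If `z` occurs before `x`, then the part from `x` to `b`
    -- misses `z`.
    by_cases hz : z ∈ (q.takeUntil x hxq).support
    · right
      refine Conn.symm ⟨q.dropUntil x hxq, fun y hy => ⟨?_, ?_⟩⟩
      · simpa using q.support_dropUntil_subset_support hxq hy
      · rintro rfl
        refine hxz ?_
        have := q.take_spec hxq
        rw [← this] at hpath
        by_contra hne
        exact hpath.ne_of_mem_support_of_append (x := y) (y := y) (Ne.symm hne) hz hy rfl
    · left
      refine ⟨q.takeUntil x hxq, fun y hy => ⟨?_, ?_⟩⟩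
      · simpa using q.support_takeUntil_subset_support hxq hy
      · rintro rfl
        exact hz hy

end Walks

/-! ### Blocks of block graphs and how they intersect. -/

section Blocks

variable {V : Type*} [DecidableEq V] [Fintype V] {G : SimpleGraph V}

/-- A connected graph has exactly one component, so an increase of their number means at least two,
that is, disconnection. -/
theorem mem_cutVerts_iff {S : Finset V} (hS : (G.induce (S : Set V)).Connected) {v : V} :
    v ∈ cutVerts G S ↔ v ∈ S ∧ ¬ (G.induce ((S.erase v : Finset V) : Set V)).Preconnected := by
  classical
  unfold cutVerts
  rw [Finset.mem_filter]
  refine and_congr_right fun _ => ?_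
  have h1 : Nat.card (G.induce (S : Set V)).ConnectedComponent = 1 := by
    rw [Nat.card_eq_one_iff_unique]
    exact ⟨hS.preconnected.subsingleton_connectedComponent, ⟨(G.induce (S : Set V)).connectedComponentMk
      hS.nonempty.some⟩⟩
  rw [h1, Finite.one_lt_card_iff_nontrivial, ← not_subsingleton_iff_nontrivial]
  refine not_congr ⟨fun h a b => ?_, fun h => h.subsingleton_connectedComponent⟩
  exact SimpleGraph.ConnectedComponent.exact (Subsingleton.elim _ _)

/-- `G[T]` is connected and has no cut-vertex. -/
def Biconn (G : SimpleGraph V) (T : Finset V) : Prop :=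
  (G.induce (T : Set V)).Connected ∧ cutVerts G T = ∅

theorem biconn_of_conn {T : Finset V} (hne : T.Nonempty)
    (h : ∀ a ∈ T, ∀ b ∈ T, Conn G T a b)
    (h' : ∀ z, ∀ a ∈ T, ∀ b ∈ T, a ≠ z → b ≠ z → Conn G ((T : Set V) ∩ {z}ᶜ) a b) :
    Biconn G T := by
  have hc : (G.induce (T : Set V)).Connected := by
    have : Nonempty (T : Set V) := ⟨⟨hne.choose, hne.choose_spec⟩⟩
    exact ⟨preconnected_induce_iff_conn.2 h⟩
  refine ⟨hc, ?_⟩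
  ext v
  rw [mem_cutVerts_iff hc]
  simp only [Finset.notMem_empty, iff_false, not_and, not_not]
  intro _
  rw [preconnected_induce_iff_conn]
  intro a ha b hb
  simp only [Finset.coe_erase, Set.mem_sdiff, Finset.mem_coe, Set.mem_singleton_iff] at ha hb
  exact (h' v a ha.1 b hb.1 ha.2 hb.2).mono fun x hx => by simpa using hx

theorem biconn_of_isClique {T : Finset V} (hne : T.Nonempty) (h : G.IsClique (T : Set V)) :
    Biconn G T := by
  have key : ∀ S : Set V, S ⊆ T → ∀ a ∈ S, ∀ b ∈ S, Conn G S a b := by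
    intro S hS a ha b hb
    by_cases hab : a = b
    · subst hab; exact Conn.refl ha
    · exact Conn.of_adj (h (hS ha) (hS hb) hab) ha hb
  exact biconn_of_conn hne (key _ subset_rfl)
    fun z a ha b hb haz hbz => key _ Set.inter_subset_left a ⟨ha, haz⟩ b ⟨hb, hbz⟩

theorem mem_blocks_iff {S B : Finset V} :
    B ∈ blocks G S ↔ B ⊆ S ∧ Biconn G B ∧ ∀ T ⊆ S, Biconn G T → B ⊆ T → T = B := by
  classical
  unfold blocks
  rw [Finset.mem_filter, Finset.mem_powerset]
  constructor
  · rintro ⟨h1, h2⟩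
    exact ⟨h1, h2.1.2, fun T hT hT' hBT => (h2.eq_of_le ⟨hT, hT'⟩ hBT).symm⟩
  · rintro ⟨h1, h2, h3⟩
    exact ⟨h1, ⟨⟨h1, h2⟩, fun T hT hBT => (h3 T hT.1 hT.2 hBT).le⟩⟩

theorem exists_block {T : Finset V} (h : Biconn G T) : ∃ B ∈ blocks G Finset.univ, T ⊆ B := by
  obtain ⟨B, hTB, hB⟩ := (Set.toFinite {T : Finset V | Biconn G T}).exists_le_maximal h
  exact ⟨B, mem_blocks_iff.2 ⟨Finset.subset_univ _, hB.1,
    fun T _ hT hBT => (hB.eq_of_le hT hBT).symm⟩, hTB⟩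

theorem exists_block_of_isClique {T : Finset V} (hne : T.Nonempty)
    (h : G.IsClique (T : Set V)) : ∃ B ∈ blocks G Finset.univ, T ⊆ B :=
  exists_block (biconn_of_isClique hne h)

theorem block_nonempty {S B : Finset V} (hB : B ∈ blocks G S) : B.Nonempty := by
  have := (mem_blocks_iff.1 hB).2.1.1.nonempty
  obtain ⟨x, hx⟩ := this
  exact ⟨x, hx⟩

/-- A block contains every vertex set without cut-vertices that contains it. -/
theorem block_eq_of_subset {B T : Finset V} (hB : B ∈ blocks G Finset.univ) (hT : Biconn G T)
    (h : B ⊆ T) : T = B := (mem_blocks_iff.1 hB).2.2 T (Finset.subset_univ _) hT h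

theorem adj_of_mem_block (hb : IsBlockGraph G) {B : Finset V} (hB : B ∈ blocks G Finset.univ)
    {x y : V} (hx : x ∈ B) (hy : y ∈ B) (hxy : x ≠ y) : G.Adj x y :=
  hb B hB hx hy hxy

theorem exists_block_of_adj {x y : V} (h : G.Adj x y) :
    ∃ B ∈ blocks G Finset.univ, x ∈ B ∧ y ∈ B := by
  obtain ⟨B, hB, hs⟩ := exists_block_of_isClique (T := {x, y}) ⟨x, by simp⟩ (by
    simpa [SimpleGraph.isClique_pair] using fun _ => h)
  exact ⟨B, hB, hs (by simp), hs (by simp)⟩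

/-- Distinct blocks through `u` lie in distinct components of `G - u`. -/
theorem block_eq_of_conn (hb : IsBlockGraph G) {B B' : Finset V} {u b b' : V}
    (hB : B ∈ blocks G Finset.univ) (hB' : B' ∈ blocks G Finset.univ) (hu : u ∈ B) (hu' : u ∈ B')
    (hbB : b ∈ B) (hbB' : b' ∈ B') (h : Conn G {u}ᶜ b b') : B = B' := by
  -- The union of both blocks and a path `P` that joins them outside `u` is connected without
  -- cut-vertices. By maximality it equals both blocks.
  obtain ⟨P, hPS, hbP, hbP', hP, hPz⟩ := h.exists_path_avoiding
  have huP : u ∉ P := fun hu => hPS hu rfl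
  have clique : ∀ D ∈ blocks G Finset.univ, ∀ S : Set V, ∀ x ∈ D, ∀ y ∈ D, x ∈ S → y ∈ S →
      Conn G S x y := by
    intro D hD S x hx y hy hxS hyS
    by_cases hxy : x = y
    · subst hxy; exact Conn.refl hxS
    · exact Conn.of_adj (adj_of_mem_block hb hD hx hy hxy) hxS hyS
  set T : Finset V := B ∪ B' ∪ P with hT
  have hmem : ∀ x, x ∈ T ↔ x ∈ B ∨ x ∈ B' ∨ x ∈ P := by intro x; simp [hT]
  have hPT : (P : Set V) ⊆ T := fun x hx => (hmem x).2 (Or.inr (Or.inr hx))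
  have hub : ∀ x ∈ T, Conn G T u x := by
    intro x hx
    have huT : u ∈ T := (hmem u).2 (Or.inl hu)
    rcases (hmem x).1 hx with h1 | h1 | h1
    · exact clique B hB _ _ hu _ h1 huT hx
    · exact clique B' hB' _ _ hu' _ h1 huT hx
    · exact (clique B hB _ _ hu _ hbB huT (hPT hbP)).trans ((hP x h1).mono hPT)
  -- After removal of `z`, all of `T` still hangs on one vertex. For `z = u` this is `b`, as `P`
  -- misses `u`. Otherwise it is `u`, since each vertex of `P` reaches an end of `P` without `z`,
  -- and both ends are joined to `u` in their blocks.
  have hubz : ∀ z, ∃ c, ∀ x ∈ T, x ≠ z → Conn G ((T : Set V) ∩ {z}ᶜ) c x := by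
    intro z
    have hPTz : (P : Set V) ∩ {z}ᶜ ⊆ (T : Set V) ∩ {z}ᶜ := Set.inter_subset_inter_left _ hPT
    by_cases hz : z = u
    · subst hz
      have hPz' : (P : Set V) ⊆ (T : Set V) ∩ {z}ᶜ := fun x hx => ⟨hPT hx, hPS hx⟩
      refine ⟨b, fun x hx hxz => ?_⟩
      have hx' : x ∈ (T : Set V) ∩ {z}ᶜ := ⟨hx, hxz⟩
      rcases (hmem x).1 hx with h1 | h1 | h1
      · exact clique B hB _ _ hbB _ h1 (hPz' hbP) hx'
      · exact ((hP b' hbP').mono hPz').trans (clique B' hB' _ _ hbB' _ h1 (hPz' hbP') hx')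
      · exact (hP x h1).mono hPz'
    · refine ⟨u, fun x hx hxz => ?_⟩
      have hu1 : u ∈ (T : Set V) ∩ {z}ᶜ := ⟨(hmem u).2 (Or.inl hu), Ne.symm hz⟩
      have hx' : x ∈ (T : Set V) ∩ {z}ᶜ := ⟨hx, hxz⟩
      rcases (hmem x).1 hx with h1 | h1 | h1
      · exact clique B hB _ _ hu _ h1 hu1 hx'
      · exact clique B' hB' _ _ hu' _ h1 hu1 hx'
      · rcases hPz z x h1 hxz with h2 | h2
        · exact (clique B hB _ _ hu _ hbB hu1 (hPTz h2.left_mem)).trans (h2.mono hPTz)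
        · exact (clique B' hB' _ _ hu' _ hbB' hu1 (hPTz h2.left_mem)).trans (h2.mono hPTz)
  have hbi : Biconn G T := by
    refine biconn_of_conn ⟨u, (hmem u).2 (Or.inl hu)⟩
      (fun a ha c hc => (hub a ha).symm.trans (hub c hc)) ?_
    intro z a ha c hc haz hcz
    obtain ⟨d, hd⟩ := hubz z
    exact (hd a ha haz).symm.trans (hd c hc hcz)
  have h1 := block_eq_of_subset hB hbi fun x hx => (hmem x).2 (Or.inl hx)
  have h2 := block_eq_of_subset hB' hbi fun x hx => (hmem x).2 (Or.inr (Or.inl hx))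
  exact h1.symm.trans h2

/-- Distinct blocks share at most one vertex. -/
theorem block_eq_of_two_mem (hb : IsBlockGraph G) {B B' : Finset V} {x y : V}
    (hB : B ∈ blocks G Finset.univ) (hB' : B' ∈ blocks G Finset.univ) (hx : x ∈ B) (hx' : x ∈ B')
    (hy : y ∈ B) (hy' : y ∈ B') (hxy : x ≠ y) : B = B' :=
  block_eq_of_conn hb hB hB' hx hx' hy hy' (Conn.refl (Ne.symm hxy))

end Blocks

end TokenSliding

namespace TokenSliding

/-! ### The branches `G[p]` of the block-tree, and the sets `κ` and `β`. -/

section Branches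

variable {V : Type*} [DecidableEq V] [Fintype V] {G : SimpleGraph V}

theorem Conn.of_graph {H : SimpleGraph V} {S : Set V} {a b : V} (h : Conn G S a b)
    (hGH : ∀ x ∈ S, ∀ y ∈ S, G.Adj x y → H.Adj x y) : Conn H S a b := by
  obtain ⟨p, hp⟩ := h
  induction p with
  | nil => exact Conn.refl (hp _ (by simp))
  | @cons a c b hac q ih =>
    have ha : a ∈ S := hp _ (by simp)
    have hq : ∀ x ∈ q.support, x ∈ S := fun x hx => hp x (by simp [hx])
    have hc : c ∈ S := hq _ q.start_mem_support
    exact (Conn.of_adj (hGH a ha c hc hac) ha hc).trans (ih hq)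

/-- All deleted edges contain `u`. After its last visit to `u` a walk is therefore only required to
avoid `u`, and just the edge leaving `u` has to respect `P`. Taking for `P` membership in `B` or in
its complement covers both kinds of directed edges. -/
theorem reachable_deleteEdges_iff {P : V → Prop} {u w : V} :
    (G.deleteEdges {e | ∃ v, P v ∧ e = s(u, v)}).Reachable u w ↔
      w = u ∨ ∃ b, ¬ P b ∧ G.Adj u b ∧ Conn G {u}ᶜ b w := by
  have hadj : ∀ x y, (G.deleteEdges {e | ∃ v, P v ∧ e = s(u, v)}).Adj x y ↔
      G.Adj x y ∧ ¬ ∃ v, P v ∧ s(x, y) = s(u, v) := by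
    intro x y; simp [SimpleGraph.deleteEdges_adj]
  constructor
  · rintro ⟨p⟩
    by_cases hw : w = u
    · exact Or.inl hw
    right
    obtain ⟨v, hv, -, b, hb, hvb, hconn⟩ :=
      Conn.exists_last_exit (S := Set.univ) (B := {u}) ⟨p, by simp⟩ rfl hw
    obtain rfl : v = u := hv
    have h1 := (hadj _ _).1 hvb
    refine ⟨b, fun hPb => h1.2 ⟨b, hPb, rfl⟩, h1.1, ?_⟩
    exact (hconn.mono Set.inter_subset_right).of_graph fun x _ y _ h => ((hadj x y).1 h).1
  · rintro (rfl | ⟨b, hPb, hub, hconn⟩)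
    · exact SimpleGraph.Reachable.refl _
    · have h1 : (G.deleteEdges {e | ∃ v, P v ∧ e = s(u, v)}).Adj u b := by
        rw [hadj]
        refine ⟨hub, ?_⟩
        rintro ⟨v, hPv, he⟩
        rw [Sym2.congr_right] at he
        exact hPb (he ▸ hPv)
      refine h1.reachable.trans ?_
      obtain ⟨p, -⟩ := hconn.of_graph (H := G.deleteEdges {e | ∃ v, P v ∧ e = s(u, v)}) (by
        intro x hx y hy hxy
        rw [hadj]
        refine ⟨hxy, ?_⟩
        rintro ⟨v, -, he⟩
        have : u ∈ s(x, y) := he ▸ Sym2.mem_mk_left u v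
        rcases Sym2.mem_iff.1 this with rfl | rfl
        · exact hx rfl
        · exact hy rfl)
      exact ⟨p⟩

/-- The vertices of `G[p]` other than the base of `p`. -/
noncomputable def inner (G : SimpleGraph V) (p : Arc V) : Finset V := (p.verts G).erase p.base

theorem base_notMem_inner (p : Arc V) : p.base ∉ inner G p := Finset.notMem_erase _ _

theorem base_mem_verts (p : Arc V) : p.base ∈ p.verts G := by
  cases p <;> simp [Arc.verts, Arc.base]

theorem mem_verts_iff {p : Arc V} {w : V} : w ∈ p.verts G ↔ w = p.base ∨ w ∈ inner G p := by
  unfold inner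
  by_cases h : w = p.base
  · simp [h, base_mem_verts]
  · simp [h]

theorem card_verts (p : Arc V) : (p.verts G).card = (inner G p).card + 1 :=
  (Finset.card_erase_add_one (base_mem_verts p)).symm

variable (hb : IsBlockGraph G)
include hb

/-- The edge from `u` to the first vertex needs no mention because `B` is a clique. From here on,
deletion of edges is replaced by avoidance of `u`. -/
theorem mem_inner_toCut {B : Finset V} {u w : V} (hB : B ∈ blocks G Finset.univ) (hu : u ∈ B) :
    w ∈ inner G (.toCut B u) ↔ ∃ b ∈ B, Conn G {u}ᶜ b w := by
  have h1 : w ∈ (Arc.toCut B u).verts G ↔ w = u ∨ ∃ b, ¬ b ∉ B ∧ G.Adj u b ∧ Conn G {u}ᶜ b w := by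
    rw [← reachable_deleteEdges_iff]
    simp [Arc.verts]
  unfold inner
  rw [Finset.mem_erase, h1]
  constructor
  · rintro ⟨hwu, h | ⟨b, hbB, -, h⟩⟩
    · exact absurd h hwu
    · exact ⟨b, not_not.1 hbB, h⟩
  · rintro ⟨b, hbB, h⟩
    exact ⟨h.right_mem, Or.inr ⟨b, not_not.2 hbB,
      adj_of_mem_block hb hB hu hbB (Ne.symm h.left_mem), h⟩⟩

/-- An edge leaving `u` outside `B` lies in some other block. Conversely, a vertex of another block
through `u` is outside `B` unless it is `u`, because distinct blocks share at most one vertex. -/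
theorem mem_inner_toBlock {B : Finset V} {u w : V} (hB : B ∈ blocks G Finset.univ) (hu : u ∈ B) :
    w ∈ inner G (.toBlock u B) ↔
      ∃ B' ∈ blocks G Finset.univ, u ∈ B' ∧ B' ≠ B ∧ w ∈ inner G (.toCut B' u) := by
  have h1 : w ∈ (Arc.toBlock u B).verts G ↔ w = u ∨ ∃ b, ¬ b ∈ B ∧ G.Adj u b ∧ Conn G {u}ᶜ b w := by
    rw [← reachable_deleteEdges_iff]
    simp [Arc.verts]
  rw [inner, Finset.mem_erase, h1]
  constructor
  · rintro ⟨hwu, h | ⟨b, hbB, hub, h⟩⟩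
    · exact absurd h hwu
    · obtain ⟨B', hB', huB', hbB'⟩ := exists_block_of_adj hub
      refine ⟨B', hB', huB', ?_, (mem_inner_toCut hb hB' huB').2 ⟨b, hbB', h⟩⟩
      rintro rfl
      exact hbB hbB'
  · rintro ⟨B', hB', huB', hne, hw⟩
    obtain ⟨b, hbB', h⟩ := (mem_inner_toCut hb hB' huB').1 hw
    refine ⟨h.right_mem, Or.inr ⟨b, fun hbB => hne ?_,
      adj_of_mem_block hb hB' huB' hbB' (Ne.symm h.left_mem), h⟩⟩
    exact block_eq_of_two_mem hb hB' hB huB' hu hbB' hbB (Ne.symm h.left_mem)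

theorem mem_inner_of_mem_block {B : Finset V} {u w : V} (hB : B ∈ blocks G Finset.univ)
    (hu : u ∈ B) (hw : w ∈ B) (hwu : w ≠ u) : w ∈ inner G (.toCut B u) :=
  (mem_inner_toCut hb hB hu).2 ⟨w, hw, Conn.refl hwu⟩

/-- The branches at `u` are disjoint. -/
theorem block_eq_of_mem_inner {B B' : Finset V} {u w : V} (hB : B ∈ blocks G Finset.univ)
    (hu : u ∈ B) (hB' : B' ∈ blocks G Finset.univ) (hu' : u ∈ B')
    (hw : w ∈ inner G (.toCut B u)) (hw' : w ∈ inner G (.toCut B' u)) : B = B' := by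
  obtain ⟨b, hbB, h⟩ := (mem_inner_toCut hb hB hu).1 hw
  obtain ⟨b', hbB', h'⟩ := (mem_inner_toCut hb hB' hu').1 hw'
  exact block_eq_of_conn hb hB hB' hu hu' hbB hbB' (h.trans h'.symm)

theorem conn_of_mem_inner {B : Finset V} {u a w : V} (hB : B ∈ blocks G Finset.univ)
    (hu : u ∈ B) (hw : w ∈ inner G (.toCut B u)) (ha : a ∈ B) (hau : a ≠ u) :
    Conn G {u}ᶜ a w := by
  obtain ⟨b, hbB, h⟩ := (mem_inner_toCut hb hB hu).1 hw
  by_cases hab : a = b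
  · exact hab ▸ h
  · exact (Conn.of_adj (adj_of_mem_block hb hB ha hbB hab) hau h.left_mem).trans h

/-- A walk that ends outside `B` leaves `B` for the last time at some `v`, through a different
block, and continues in a branch at `v`. Conversely, a walk in such a branch cannot meet `u`, which
lies in `B` and hence in another component of `G - v`. -/
theorem mem_inner_toCut_iff {B : Finset V} {u w : V} (hB : B ∈ blocks G Finset.univ)
    (hu : u ∈ B) : w ∈ inner G (.toCut B u) ↔
      (w ∈ B ∧ w ≠ u) ∨ ∃ v ∈ B, v ≠ u ∧ w ∈ inner G (.toBlock v B) := by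
  constructor
  · intro hw
    obtain ⟨b, hbB, h⟩ := (mem_inner_toCut hb hB hu).1 hw
    by_cases hwB : w ∈ B
    · exact Or.inl ⟨hwB, h.right_mem⟩
    right
    obtain ⟨v, hvB, hvu, c, hcB, hvc, hconn⟩ :=
      h.exists_last_exit (B := (B : Set V)) hbB hwB
    obtain ⟨B', hB', hvB', hcB'⟩ := exists_block_of_adj hvc
    have hvB : v ∈ B := hvB
    refine ⟨v, hvB, hvu, (mem_inner_toBlock hb hB hvB).2 ⟨B', hB', hvB', ?_,
      (mem_inner_toCut hb hB' hvB').2 ⟨c, hcB', hconn.mono ?_⟩⟩⟩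
    · rintro rfl
      exact hcB hcB'
    · rintro x hx rfl
      exact hx.2 hvB
  · rintro (⟨hwB, hwu⟩ | ⟨v, hvB, hvu, hw⟩)
    · exact mem_inner_of_mem_block hb hB hu hwB hwu
    · obtain ⟨B', hB', hvB', hne, hw⟩ := (mem_inner_toBlock hb hB hvB).1 hw
      obtain ⟨c, hcB', p, hp⟩ := (mem_inner_toCut hb hB' hvB').1 hw
      have hpu : ∀ x ∈ p.support, x ∈ ({u}ᶜ : Set V) := by
        rintro x hx rfl
        exact hne (block_eq_of_conn hb hB' hB hvB' hvB hcB' hu (conn_of_mem_support p hp hx))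
      have hcv : c ≠ v := hp c p.start_mem_support
      refine (mem_inner_toCut hb hB hu).2 ⟨v, hvB, ?_⟩
      exact (Conn.of_adj (adj_of_mem_block hb hB' hvB' hcB' hcv.symm) hvu
        (hpu c p.start_mem_support)).trans ⟨p, hpu⟩

theorem notMem_block_of_mem_inner_toBlock {B : Finset V} {v w : V}
    (hB : B ∈ blocks G Finset.univ) (hv : v ∈ B) (hw : w ∈ inner G (.toBlock v B)) : w ∉ B := by
  intro hwB
  obtain ⟨B', hB', hvB', hne, hw'⟩ := (mem_inner_toBlock hb hB hv).1 hw
  have hwv : w ≠ v := fun h => base_notMem_inner (G := G) (.toBlock v B) (h ▸ hw)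
  exact hne (block_eq_of_mem_inner hb hB' hvB' hB hv hw' (mem_inner_of_mem_block hb hB hv hwB hwv))

/-- Seen from `v'`, everything behind `v ≠ v'` belongs to the branch of `B`, which is disjoint from
all other branches at `v'`. -/
theorem eq_of_mem_inner_toBlock {B : Finset V} {v v' w : V} (hB : B ∈ blocks G Finset.univ)
    (hv : v ∈ B) (hv' : v' ∈ B) (hw : w ∈ inner G (.toBlock v B))
    (hw' : w ∈ inner G (.toBlock v' B)) : v = v' := by
  by_contra hne
  have h1 : w ∈ inner G (.toCut B v') :=
    (mem_inner_toCut_iff hb hB hv').2 (Or.inr ⟨v, hv, hne, hw⟩)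
  obtain ⟨B', hB', hvB', hne', h2⟩ := (mem_inner_toBlock hb hB hv').1 hw'
  exact hne' (block_eq_of_mem_inner hb hB' hvB' hB hv' h2 h1)

/-- Adjacent vertices of `G - u` lie in one component, so only `u` can be the outer end. The block
of the edge then determines the branch that contains `x`. -/
theorem boundary_toCut {B : Finset V} {u x y : V} (hB : B ∈ blocks G Finset.univ) (hu : u ∈ B)
    (hx : x ∈ inner G (.toCut B u)) (hy : y ∉ inner G (.toCut B u)) (hxy : G.Adj x y) :
    y = u ∧ x ∈ B := by
  have hxu : x ≠ u := fun h => base_notMem_inner (G := G) (.toCut B u) (h ▸ hx)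
  have hyu : y = u := by
    by_contra hyu
    obtain ⟨b, hbB, h⟩ := (mem_inner_toCut hb hB hu).1 hx
    exact hy ((mem_inner_toCut hb hB hu).2 ⟨b, hbB, h.trans (Conn.of_adj hxy h.right_mem hyu)⟩)
  refine ⟨hyu, ?_⟩
  subst hyu
  obtain ⟨D, hD, hxD, hyD⟩ := exists_block_of_adj hxy
  obtain rfl := block_eq_of_mem_inner hb hB hu hD hyD hx (mem_inner_of_mem_block hb hD hyD hxD hxu)
  exact hxD

/-- Otherwise `B` would consist of `u` alone and be a proper subset of the block `B'`, against
maximality. -/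
theorem exists_mem_ne {B B' : Finset V} {u : V} (hB : B ∈ blocks G Finset.univ)
    (hB' : B' ∈ blocks G Finset.univ) (hu' : u ∈ B') (hne : B ≠ B') :
    ∃ b ∈ B, b ≠ u := by
  by_contra! h
  refine hne (block_eq_of_subset hB (mem_blocks_iff.1 hB').2.1 fun x hx => ?_).symm
  rw [h x hx]; exact hu'

theorem exists_mem_inner (hc : G.Connected) {u w : V} (hwu : w ≠ u) :
    ∃ B ∈ blocks G Finset.univ, u ∈ B ∧ w ∈ inner G (.toCut B u) := by
  obtain ⟨v, hv, -, b, hbu, hvb, hconn⟩ :=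
    (conn_univ_of_connected hc u w).exists_last_exit (B := {u}) rfl hwu
  obtain rfl : v = u := hv
  obtain ⟨B, hB, hvB, hbB⟩ := exists_block_of_adj hvb
  exact ⟨B, hB, hvB, (mem_inner_toCut hb hB hvB).2 ⟨b, hbB, hconn.mono Set.inter_subset_right⟩⟩

/-- The cut-vertices are the vertices in at least two blocks. -/
theorem mem_cutVerts_univ_iff (hc : G.Connected) {u : V} : u ∈ cutVerts G Finset.univ ↔
    ∃ B ∈ blocks G Finset.univ, ∃ B' ∈ blocks G Finset.univ, u ∈ B ∧ u ∈ B' ∧ B ≠ B' := by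
  have hc' : (G.induce ((Finset.univ : Finset V) : Set V)).Connected := by
    have : Nonempty ((Finset.univ : Finset V) : Set V) := ⟨⟨hc.nonempty.some, by simp⟩⟩
    refine ⟨preconnected_induce_iff_conn.2 fun a _ b _ => ?_⟩
    exact (conn_univ_of_connected hc a b).mono (by simp)
  have hset : ((Finset.univ.erase u : Finset V) : Set V) = {u}ᶜ := by ext; simp
  rw [mem_cutVerts_iff hc', hset, preconnected_induce_iff_conn]
  simp only [Finset.mem_univ, true_and]
  constructor
  · intro h
    by_contra! hall
    refine h fun a ha b hb' => ?_
    obtain ⟨B, hB, huB, haB⟩ := exists_mem_inner hb hc (u := u) ha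
    obtain ⟨B', hB', huB', hbB'⟩ := exists_mem_inner hb hc (u := u) hb'
    obtain rfl := hall B hB B' hB' huB huB'
    obtain ⟨c, hcB, hca⟩ := (mem_inner_toCut hb hB huB).1 haB
    exact hca.symm.trans (conn_of_mem_inner hb hB huB hbB' hcB hca.left_mem)
  · rintro ⟨B, hB, B', hB', hu, hu', hne⟩ h
    obtain ⟨b, hbB, hbu⟩ := exists_mem_ne hb hB hB' hu' hne
    obtain ⟨b', hbB', hbu'⟩ := exists_mem_ne hb hB' hB hu hne.symm
    exact hne (block_eq_of_conn hb hB hB' hu hu' hbB hbB' (h b hbu b' hbu'))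

/-- The definition of `κ` refers to cut-vertices of `G[B, u]`, while the procedure knows only those
of `G`. The vertex `u` drops out, since `G[B, u] - u` is held together by `B`. Any other `v` in `B`
has all its blocks inside `G[B, u]`, so the two notions agree for it. -/
theorem mem_kappa_iff (hc : G.Connected) {B : Finset V} {u v : V}
    (hB : B ∈ blocks G Finset.univ) (hu : u ∈ B) :
    v ∈ kappa G B u ↔ v ∈ B ∧ v ≠ u ∧ v ∈ cutVerts G Finset.univ := by
  set S := (Arc.toCut B u).verts G with hS
  have hmem : ∀ x, x ∈ S ↔ x = u ∨ x ∈ inner G (.toCut B u) := fun x => mem_verts_iff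
  have huS : u ∈ S := (hmem u).2 (Or.inl rfl)
  have hBS : ∀ x ∈ B, x ∈ S := by
    intro x hx
    by_cases hxu : x = u
    · exact hxu ▸ huS
    · exact (hmem x).2 (Or.inr (mem_inner_of_mem_block hb hB hu hx hxu))
  have hin : ∀ b ∈ B, ∀ w, Conn G {u}ᶜ b w → Conn G ((S : Set V) ∩ {u}ᶜ) b w := by
    rintro b hbB w ⟨p, hp⟩
    refine ⟨p, fun x hx => ⟨(hmem x).2 (Or.inr ?_), hp x hx⟩⟩
    exact (mem_inner_toCut hb hB hu).2 ⟨b, hbB, conn_of_mem_support p hp hx⟩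
  have hSc : (G.induce (S : Set V)).Connected := by
    have hhub : ∀ x ∈ S, Conn G S u x := by
      intro x hx
      rcases (hmem x).1 hx with rfl | h
      · exact Conn.refl hx
      · obtain ⟨b, hbB, hbx⟩ := (mem_inner_toCut hb hB hu).1 h
        exact (Conn.of_adj (adj_of_mem_block hb hB hu hbB (Ne.symm hbx.left_mem)) huS
          (hBS b hbB)).trans ((hin b hbB x hbx).mono Set.inter_subset_left)
    have : Nonempty (S : Set V) := ⟨⟨u, huS⟩⟩
    exact ⟨preconnected_induce_iff_conn.2 fun a ha b hb' => (hhub a ha).symm.trans (hhub b hb')⟩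
  have herase : ∀ v, ((S.erase v : Finset V) : Set V) = (S : Set V) ∩ {v}ᶜ := by
    intro v; ext x; simp
  rw [kappa, Finset.mem_inter, ← hS, mem_cutVerts_iff hSc, herase, preconnected_induce_iff_conn]
  constructor
  · rintro ⟨hvB, hvS, hpre⟩
    have hvu : v ≠ u := by
      rintro rfl
      refine hpre fun a ha b hb' => ?_
      have ha' := ((hmem a).1 ha.1).resolve_left ha.2
      have hb'' := ((hmem b).1 hb'.1).resolve_left hb'.2
      obtain ⟨c, hcB, hca⟩ := (mem_inner_toCut hb hB hu).1 ha'
      exact (hin c hcB a hca).symm.trans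
        (hin c hcB b (conn_of_mem_inner hb hB hu hb'' hcB hca.left_mem))
    refine ⟨hvB, hvu, ?_⟩
    by_contra hcut
    rw [mem_cutVerts_univ_iff hb hc] at hcut
    -- If `B` is the only block at `v`, nothing hangs on `v`, and the rest of `S` stays attached to
    -- `u` through the clique `B`.
    have honly : ∀ x ∈ S, x ≠ v → Conn G ((S : Set V) ∩ {v}ᶜ) u x := by
      intro x hx hxv
      have huv' : u ∈ (S : Set V) ∩ {v}ᶜ := ⟨huS, Ne.symm hvu⟩
      rcases (hmem x).1 hx with rfl | h
      · exact Conn.refl huv'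
      rcases (mem_inner_toCut_iff hb hB hu).1 h with ⟨hxB, hxu⟩ | ⟨y, hyB, hyu, hxy⟩
      · exact Conn.of_adj (adj_of_mem_block hb hB hu hxB hxu.symm) huv' ⟨hx, hxv⟩
      · have hyv : y ≠ v := by
          rintro rfl
          obtain ⟨B', hB', hyB', hne, -⟩ := (mem_inner_toBlock hb hB hyB).1 hxy
          exact hcut ⟨B', hB', B, hB, hyB', hyB, hne⟩
        obtain ⟨B', hB', hyB', hne, hxB'⟩ := (mem_inner_toBlock hb hB hyB).1 hxy
        obtain ⟨c, hcB', p, hp⟩ := (mem_inner_toCut hb hB' hyB').1 hxB'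
        have hpS : ∀ z ∈ p.support, z ∈ (S : Set V) ∩ {v}ᶜ := by
          intro z hz
          have hzy : z ∈ inner G (.toBlock y B) := (mem_inner_toBlock hb hB hyB).2
            ⟨B', hB', hyB', hne, (mem_inner_toCut hb hB' hyB').2
              ⟨c, hcB', conn_of_mem_support p hp hz⟩⟩
          refine ⟨(hmem z).2 (Or.inr ((mem_inner_toCut_iff hb hB hu).2
            (Or.inr ⟨y, hyB, hyu, hzy⟩))), ?_⟩
          rintro rfl
          exact notMem_block_of_mem_inner_toBlock hb hB hyB hzy hvB
        have hyS : y ∈ (S : Set V) ∩ {v}ᶜ := ⟨hBS y hyB, hyv⟩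
        have hcy : c ≠ y := hp c p.start_mem_support
        exact (Conn.of_adj (adj_of_mem_block hb hB hu hyB hyu.symm) huv' hyS).trans
          ((Conn.of_adj (adj_of_mem_block hb hB' hyB' hcB' hcy.symm) hyS
            (hpS c p.start_mem_support)).trans ⟨p, hpS⟩)
    exact hpre fun a ha b hb' => (honly a ha.1 ha.2).symm.trans (honly b hb'.1 hb'.2)
  · rintro ⟨hvB, hvu, hcut⟩
    refine ⟨hvB, hBS v hvB, fun hpre => ?_⟩
    have : ∃ B' ∈ blocks G Finset.univ, v ∈ B' ∧ B' ≠ B := by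
      obtain ⟨B₁, h₁, B₂, h₂, hv₁, hv₂, hne⟩ := (mem_cutVerts_univ_iff hb hc).1 hcut
      by_cases h : B₁ = B
      · exact ⟨B₂, h₂, hv₂, fun h' => hne (h.trans h'.symm)⟩
      · exact ⟨B₁, h₁, hv₁, h⟩
    obtain ⟨B', hB', hvB', hne⟩ := this
    obtain ⟨b, hbB', hbv⟩ := exists_mem_ne hb hB' hB hvB hne
    have hbS : b ∈ S := (hmem b).2 (Or.inr ((mem_inner_toCut_iff hb hB hu).2 (Or.inr ⟨v, hvB, hvu,
      (mem_inner_toBlock hb hB hvB).2 ⟨B', hB', hvB', hne,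
        mem_inner_of_mem_block hb hB' hvB' hbB' hbv⟩⟩)))
    have hconn := hpre b ⟨hbS, hbv⟩ u ⟨huS, hvu.symm⟩
    exact hne (block_eq_of_conn hb hB' hB hvB' hvB hbB' hu (hconn.mono Set.inter_subset_right))

/-- Blocks of `G[u, B]` and of `G` are matched by maximality in both directions. That `u` is a
cut-vertex is needed: otherwise `G[u, B]` would be the single vertex `u`, with the block `{u}`. -/
theorem mem_beta_iff (hc : G.Connected) {B B' : Finset V} {u : V}
    (hB : B ∈ blocks G Finset.univ) (hu : u ∈ B) (hcut : u ∈ cutVerts G Finset.univ) :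
    B' ∈ beta G u B ↔ B' ∈ blocks G Finset.univ ∧ u ∈ B' ∧ B' ≠ B := by
  set S := (Arc.toBlock u B).verts G with hS
  have hmem : ∀ x, x ∈ S ↔ x = u ∨ x ∈ inner G (.toBlock u B) := fun x => mem_verts_iff
  have hsub : ∀ D ∈ blocks G Finset.univ, u ∈ D → D ≠ B → D ⊆ S := by
    intro D hD huD hne x hx
    rw [hmem]
    by_cases hxu : x = u
    · exact Or.inl hxu
    · exact Or.inr ((mem_inner_toBlock hb hB hu).2
        ⟨D, hD, huD, hne, mem_inner_of_mem_block hb hD huD hx hxu⟩)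
  have hother : ∃ D ∈ blocks G Finset.univ, u ∈ D ∧ D ≠ B := by
    obtain ⟨B₁, h₁, B₂, h₂, hv₁, hv₂, hne⟩ := (mem_cutVerts_univ_iff hb hc).1 hcut
    by_cases h : B₁ = B
    · exact ⟨B₂, h₂, hv₂, fun h' => hne (h.trans h'.symm)⟩
    · exact ⟨B₁, h₁, hv₁, h⟩
  rw [beta, Finset.mem_filter, ← hS]
  constructor
  · rintro ⟨hT, huT⟩
    obtain ⟨hTS, hTbi, hTmax⟩ := mem_blocks_iff.1 hT
    obtain ⟨D, hD, hTD⟩ := exists_block hTbi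
    have key : ∀ D ∈ blocks G Finset.univ, B' ⊆ D → D ≠ B → D = B' := fun D hD hTD hne =>
      hTmax D (hsub D hD (hTD huT) hne) (mem_blocks_iff.1 hD).2.1 hTD
    -- A block of `G[u, B]` contained in `B` could only be `{u}`, but another block through `u` lies
    -- in `G[u, B]` and is larger.
    have hDB : D ≠ B := by
      rintro rfl
      obtain ⟨D', hD', huD', hne'⟩ := hother
      have hTu : ∀ x ∈ B', x = u := by
        intro x hx
        rcases (hmem x).1 (hTS hx) with h | h
        · exact h
        · exact absurd (hTD hx) (notMem_block_of_mem_inner_toBlock hb hD hu h)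
      have h1 := key D' hD' (fun x hx => (hTu x hx).symm ▸ huD') hne'
      obtain ⟨b, hbD', hbu⟩ := exists_mem_ne hb hD' hD hu hne'
      exact hbu (hTu b (h1 ▸ hbD'))
    have h1 := key D hD hTD hDB
    exact ⟨h1 ▸ hD, huT, h1 ▸ hDB⟩
  · rintro ⟨hB', huB', hne⟩
    refine ⟨mem_blocks_iff.2 ⟨hsub B' hB' huB' hne, (mem_blocks_iff.1 hB').2.1,
      fun T _ hT hBT => block_eq_of_subset hB' hT hBT⟩, huB'⟩

omit hb in
theorem mem_treeArcs_toCut {B : Finset V} {u : V} : .toCut B u ∈ treeArcs G ↔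
    u ∈ cutVerts G Finset.univ ∧ B ∈ blocks G Finset.univ ∧ u ∈ B := Iff.rfl

omit hb in
theorem mem_treeArcs_toBlock {B : Finset V} {u : V} : .toBlock u B ∈ treeArcs G ↔
    u ∈ cutVerts G Finset.univ ∧ B ∈ blocks G Finset.univ ∧ u ∈ B := Iff.rfl

/-- The vertex `v` is lost as an inner vertex. The doubled cardinality drops by at least two, which
outweighs the extra one in the size of `(v, B)`. -/
theorem size_toBlock_lt {B : Finset V} {u v : V} (hB : B ∈ blocks G Finset.univ) (hu : u ∈ B)
    (hv : v ∈ B) (hvu : v ≠ u) : (Arc.toBlock v B).size G < (Arc.toCut B u).size G := by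
  have h : inner G (.toBlock v B) ⊂ inner G (.toCut B u) := by
    rw [Finset.ssubset_iff_of_subset fun w hw =>
      (mem_inner_toCut_iff hb hB hu).2 (Or.inr ⟨v, hv, hvu, hw⟩)]
    exact ⟨v, mem_inner_of_mem_block hb hB hu hv hvu, base_notMem_inner (.toBlock v B)⟩
  have h1 := Finset.card_lt_card h
  simp only [Arc.size, card_verts]
  omega

/-- Here the vertex sets may coincide, and the extra one in the size of `(u, B)` makes the
inequality strict. -/
theorem size_toCut_lt {B B' : Finset V} {u : V} (hB : B ∈ blocks G Finset.univ) (hu : u ∈ B)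
    (hB' : B' ∈ blocks G Finset.univ) (hu' : u ∈ B') (hne : B' ≠ B) :
    (Arc.toCut B' u).size G < (Arc.toBlock u B).size G := by
  have h1 := Finset.card_le_card fun w hw =>
    (mem_inner_toBlock (w := w) hb hB hu).2 ⟨B', hB', hu', hne, hw⟩
  simp only [Arc.size, card_verts]
  omega

end Branches

end TokenSliding

namespace TokenSliding

/-! ### Recursions and bounds for `ua`, capacity, load and value. -/

section Values

variable {V : Type*} [DecidableEq V] [Fintype V] {G : SimpleGraph V}

/-- The capacity of the part of `Q` in `G[p]`. -/
noncomputable def capOn (G : SimpleGraph V) (p : Arc V) (Q : Finset V) : ℤ :=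
  cap G p (p.verts G ∩ Q)

/-- The number of tokens of `Q` in `G[p]` other than one on the base of `p`. -/
noncomputable def load (G : SimpleGraph V) (p : Arc V) (Q : Finset V) : ℤ :=
  ((inner G p ∩ Q).card : ℤ)

/-- Capacity plus load. -/
noncomputable def val (G : SimpleGraph V) (p : Arc V) (Q : Finset V) : ℤ :=
  capOn G p Q + load G p Q

theorem load_nonneg (p : Arc V) (Q : Finset V) : 0 ≤ load G p Q := Int.natCast_nonneg _

theorem uaNum_of_ua {p : Arc V} (h : ua G p) : uaNum G p = 1 := by simp [uaNum, h]

theorem uaNum_of_not_ua {p : Arc V} (h : ¬ ua G p) : uaNum G p = 0 := by simp [uaNum, h]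

theorem uaNum_nonneg (p : Arc V) : 0 ≤ uaNum G p := by unfold uaNum; split <;> simp

theorem uaNum_le_one (p : Arc V) : uaNum G p ≤ 1 := by unfold uaNum; split <;> simp

variable (hc : G.Connected) (hb : IsBlockGraph G)
include hc hb

theorem exists_mem_block_ne {B : Finset V} {u : V} (hp : .toCut B u ∈ treeArcs G) :
    ∃ b ∈ B, b ≠ u := by
  obtain ⟨hcut, hB, hu⟩ := hp
  obtain ⟨B₁, h₁, B₂, h₂, hv₁, hv₂, hne⟩ := (mem_cutVerts_univ_iff hb hc).1 hcut
  by_cases h : B₁ = B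
  · exact exists_mem_ne hb hB h₂ hv₂ (h ▸ hne)
  · exact exists_mem_ne hb hB h₁ hv₁ (Ne.symm h)

theorem mem_kappa {B : Finset V} {u v : V} (hp : .toCut B u ∈ treeArcs G) :
    v ∈ kappa G B u ↔ v ∈ B ∧ v ≠ u ∧ v ∈ cutVerts G Finset.univ :=
  mem_kappa_iff hb hc hp.2.1 hp.2.2

theorem mem_beta {B B' : Finset V} {u : V} (hp : .toBlock u B ∈ treeArcs G) :
    B' ∈ beta G u B ↔ B' ∈ blocks G Finset.univ ∧ u ∈ B' ∧ B' ≠ B :=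
  mem_beta_iff hb hc hp.2.1 hp.2.2 hp.1

theorem toBlock_mem_of_kappa {B : Finset V} {u v : V} (hp : .toCut B u ∈ treeArcs G)
    (hv : v ∈ kappa G B u) : .toBlock v B ∈ treeArcs G := by
  obtain ⟨h1, h2, h3⟩ := (mem_kappa hc hb hp).1 hv
  exact ⟨h3, hp.2.1, h1⟩

theorem toCut_mem_of_beta {B B' : Finset V} {u : V} (hp : .toBlock u B ∈ treeArcs G)
    (hB' : B' ∈ beta G u B) : .toCut B' u ∈ treeArcs G := by
  obtain ⟨h1, h2, h3⟩ := (mem_beta hc hb hp).1 hB'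
  exact ⟨hp.1, h1, h2⟩

theorem size_kappa {B : Finset V} {u v : V} (hp : .toCut B u ∈ treeArcs G)
    (hv : v ∈ kappa G B u) : (Arc.toBlock v B).size G < (Arc.toCut B u).size G := by
  obtain ⟨h1, h2, h3⟩ := (mem_kappa hc hb hp).1 hv
  exact size_toBlock_lt hb hp.2.1 hp.2.2 h1 h2

theorem size_beta {B B' : Finset V} {u : V} (hp : .toBlock u B ∈ treeArcs G)
    (hB' : B' ∈ beta G u B) : (Arc.toCut B' u).size G < (Arc.toBlock u B).size G := by
  obtain ⟨h1, h2, h3⟩ := (mem_beta hc hb hp).1 hB'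
  exact size_toCut_lt hb hp.2.1 hp.2.2 h1 h2 h3

/-- Induction along the block-tree away from the base. -/
theorem treeArcs_induction {motive : Arc V → Prop}
    (cutStep : ∀ B u, .toCut B u ∈ treeArcs G → (∀ v ∈ kappa G B u, motive (.toBlock v B)) →
      motive (.toCut B u))
    (blockStep : ∀ u B, .toBlock u B ∈ treeArcs G → (∀ B' ∈ beta G u B, motive (.toCut B' u)) →
      motive (.toBlock u B)) :
    ∀ p ∈ treeArcs G, motive p := by
  intro p
  induction hn : p.size G using Nat.strong_induction_on generalizing p with
  | _ n ih =>
    subst hn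
    intro hp
    cases p with
    | toCut B u =>
      exact cutStep B u hp fun v hv => ih _ (size_kappa hc hb hp hv) _ rfl
        (toBlock_mem_of_kappa hc hb hp hv)
    | toBlock u B =>
      exact blockStep u B hp fun B' hB' => ih _ (size_beta hc hb hp hB') _ rfl
        (toCut_mem_of_beta hc hb hp hB')

/-- A nonempty branch at `v` means a second block at `v`, so only the cut-vertices in `κ`
contribute. -/
theorem mem_inner_toCut_iff' {B : Finset V} {u w : V} (hp : .toCut B u ∈ treeArcs G) :
    w ∈ inner G (.toCut B u) ↔ w ∈ B.erase u ∨ ∃ v ∈ kappa G B u, w ∈ inner G (.toBlock v B) := by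
  have hB : B ∈ blocks G Finset.univ := hp.2.1
  have hu : u ∈ B := hp.2.2
  rw [mem_inner_toCut_iff hb hB hu, Finset.mem_erase, and_comm]
  refine or_congr_right ⟨?_, ?_⟩
  · rintro ⟨v, hv, hvu, hw⟩
    refine ⟨v, (mem_kappa hc hb hp).2 ⟨hv, hvu, (mem_cutVerts_univ_iff hb hc).2 ?_⟩, hw⟩
    obtain ⟨B', hB', hvB', hne, -⟩ := (mem_inner_toBlock hb hp.2.1 hv).1 hw
    exact ⟨B', hB', B, hp.2.1, hvB', hv, hne⟩
  · rintro ⟨v, hv, hw⟩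
    obtain ⟨h1, h2, h3⟩ := (mem_kappa hc hb hp).1 hv
    exact ⟨v, h1, h2, hw⟩

theorem mem_inner_toBlock_iff' {B : Finset V} {u w : V} (hp : .toBlock u B ∈ treeArcs G) :
    w ∈ inner G (.toBlock u B) ↔ ∃ B' ∈ beta G u B, w ∈ inner G (.toCut B' u) := by
  have hB : B ∈ blocks G Finset.univ := hp.2.1
  have hu : u ∈ B := hp.2.2
  rw [mem_inner_toBlock hb hB hu]
  simp only [mem_beta hc hb hp, and_assoc]

theorem inner_kappa_subset {B : Finset V} {u v : V} (hp : .toCut B u ∈ treeArcs G)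
    (hv : v ∈ kappa G B u) : inner G (.toBlock v B) ⊆ inner G (.toCut B u) :=
  fun _ hw => (mem_inner_toCut_iff' hc hb hp).2 (Or.inr ⟨v, hv, hw⟩)

theorem inner_beta_subset {B B' : Finset V} {u : V} (hp : .toBlock u B ∈ treeArcs G)
    (hB' : B' ∈ beta G u B) : inner G (.toCut B' u) ⊆ inner G (.toBlock u B) :=
  fun _ hw => (mem_inner_toBlock_iff' hc hb hp).2 ⟨B', hB', hw⟩

theorem pairwiseDisjoint_kappa {B : Finset V} {u : V} (hp : .toCut B u ∈ treeArcs G) :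
    (kappa G B u : Set V).PairwiseDisjoint fun v => inner G (.toBlock v B) := by
  intro v hv v' hv' hne
  refine Finset.disjoint_left.2 fun w hw hw' => hne ?_
  exact eq_of_mem_inner_toBlock hb hp.2.1 ((mem_kappa hc hb hp).1 hv).1
    ((mem_kappa hc hb hp).1 hv').1 hw hw'

theorem pairwiseDisjoint_blocks (u : V) :
    ({B | B ∈ blocks G Finset.univ ∧ u ∈ B} : Set (Finset V)).PairwiseDisjoint
      fun B => inner G (.toCut B u) := by
  intro B hB B' hB' hne
  exact Finset.disjoint_left.2 fun w hw hw' =>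
    hne (block_eq_of_mem_inner hb hB.1 hB.2 hB'.1 hB'.2 hw hw')

theorem pairwiseDisjoint_beta {B : Finset V} {u : V} (hp : .toBlock u B ∈ treeArcs G) :
    (beta G u B : Set (Finset V)).PairwiseDisjoint fun B' => inner G (.toCut B' u) :=
  (pairwiseDisjoint_blocks hc hb u).subset fun _ hB' =>
    ⟨((mem_beta hc hb hp).1 hB').1, ((mem_beta hc hb hp).1 hB').2.1⟩

/-- A vertex outside `G[p]` and adjacent to an inner vertex of `G[p]` is the base. -/
theorem eq_base_of_adj {p : Arc V} (hp : p ∈ treeArcs G) {x y : V} (hx : x ∈ inner G p)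
    (hy : y ∉ inner G p) (hxy : G.Adj x y) : y = p.base := by
  cases p with
  | toCut B u => exact (boundary_toCut hb hp.2.1 hp.2.2 hx hy hxy).1
  | toBlock u B =>
    obtain ⟨B', hB', hxB'⟩ := (mem_inner_toBlock_iff' hc hb hp).1 hx
    have hp' := toCut_mem_of_beta hc hb hp hB'
    exact (boundary_toCut hb hp'.2.1 hp'.2.2 hxB'
      (fun h => hy (inner_beta_subset hc hb hp hB' h)) hxy).1

theorem mem_block_of_adj_base {B : Finset V} {u x : V} (hp : .toCut B u ∈ treeArcs G)
    (hx : x ∈ inner G (.toCut B u)) (hxu : G.Adj u x) : x ∈ B :=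
  (boundary_toCut hb hp.2.1 hp.2.2 hx (base_notMem_inner (.toCut B u)) hxu.symm).2

/-- The separate clause for complete `G[B, u]` is redundant. If all vertices of `B` other than `u`
are cut-vertices, then `G[B, u]` has a vertex beyond `B`, which is not adjacent to `u`, so `G[B, u]`
is not complete. -/
theorem ua_toCut_iff {B : Finset V} {u : V} (hp : .toCut B u ∈ treeArcs G) :
    ua G (.toCut B u) ↔
      ¬ ∀ v ∈ B, v ≠ u → v ∈ cutVerts G Finset.univ ∧ ua G (.toBlock v B) := by
  obtain ⟨b, hbB, hbu⟩ := exists_mem_block_ne hc hb hp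
  rw [ua]
  have h1 : ((∀ v ∈ kappa G B u, ∀ _h : (Arc.toBlock v B).size G < (Arc.toCut B u).size G,
      ua G (.toBlock v B)) ∧ B = kappa G B u ∪ {u}) ↔
      ∀ v ∈ B, v ≠ u → v ∈ cutVerts G Finset.univ ∧ ua G (.toBlock v B) := by
    constructor
    · rintro ⟨h1, h2⟩ v hv hvu
      have : v ∈ kappa G B u := by
        have := h2 ▸ hv
        simpa [hvu] using this
      exact ⟨((mem_kappa hc hb hp).1 this).2.2, h1 v this (size_kappa hc hb hp this)⟩
    · intro h
      refine ⟨fun v hv _ => ?_, ?_⟩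
      · obtain ⟨h1, h2, h3⟩ := (mem_kappa hc hb hp).1 hv
        exact (h v h1 h2).2
      · ext v
        simp only [Finset.mem_union, Finset.mem_singleton, mem_kappa hc hb hp]
        constructor
        · intro hv
          by_cases hvu : v = u
          · exact Or.inr hvu
          · exact Or.inl ⟨hv, hvu, (h v hv hvu).1⟩
        · rintro (h | rfl)
          · exact h.1
          · exact hp.2.2
  rw [h1]
  refine ⟨?_, Or.inr⟩
  rintro (hcl | h)
  · intro h
    have hbk : b ∈ kappa G B u := (mem_kappa hc hb hp).2 ⟨hbB, hbu, (h b hbB hbu).1⟩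
    obtain ⟨B₁, h₁, B₂, h₂, hv₁, hv₂, hne⟩ := (mem_cutVerts_univ_iff hb hc).1 (h b hbB hbu).1
    obtain ⟨B', hB', hbB', hne⟩ : ∃ B' ∈ blocks G Finset.univ, b ∈ B' ∧ B' ≠ B := by
      by_cases h : B₁ = B
      · exact ⟨B₂, h₂, hv₂, fun h' => hne (h.trans h'.symm)⟩
      · exact ⟨B₁, h₁, hv₁, h⟩
    obtain ⟨w, hwB', hwb⟩ := exists_mem_ne hb hB' hp.2.1 hbB hne
    have hw : w ∈ inner G (.toBlock b B) := (mem_inner_toBlock hb hp.2.1 hbB).2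
      ⟨B', hB', hbB', hne, mem_inner_of_mem_block hb hB' hbB' hwB' hwb⟩
    have hw' := inner_kappa_subset hc hb hp hbk hw
    have hwu : u ≠ w := fun h => base_notMem_inner (G := G) (.toCut B u) (h ▸ hw')
    have := hcl (mem_verts_iff.2 (Or.inl rfl)) (mem_verts_iff.2 (Or.inr hw')) hwu
    exact notMem_block_of_mem_inner_toBlock hb hp.2.1 hbB hw
      (mem_block_of_adj_base hc hb hp hw' this)
  · exact h

theorem ua_toBlock_iff {B : Finset V} {u : V} (hp : .toBlock u B ∈ treeArcs G) :
    ua G (.toBlock u B) ↔ ∃ B' ∈ beta G u B, ua G (.toCut B' u) := by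
  rw [ua]
  refine exists_congr fun _ => and_congr_right fun hB' => ?_
  exact ⟨fun h => h.2, fun h => ⟨size_beta hc hb hp hB', h⟩⟩

/-- The successive restrictions of the token set collapse, because the subgraphs are nested and
tokens on the base are not counted. The recursion can thus be read with one fixed `Q`, and the size
tests of the definition always succeed. -/
theorem capOn_toCut {B : Finset V} {u : V} (hp : .toCut B u ∈ treeArcs G) (Q : Finset V) :
    capOn G (.toCut B u) Q = (∑ v ∈ kappa G B u, capOn G (.toBlock v B) Q) +
      uaNum G (.toCut B u) - ((B.erase u ∩ Q).card : ℤ) := by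
  have h1 : B ∩ ((Arc.toCut B u).verts G ∩ Q).erase u = B.erase u ∩ Q := by
    ext x
    simp only [Finset.mem_inter, Finset.mem_erase, mem_verts_iff]
    constructor
    · rintro ⟨h1, h2, h3, h4⟩; exact ⟨⟨h2, h1⟩, h4⟩
    · rintro ⟨⟨h2, h1⟩, h4⟩
      exact ⟨h1, h2, Or.inr (mem_inner_of_mem_block hb hp.2.1 hp.2.2 h1 h2), h4⟩
  rw [capOn, cap, h1]
  congr 2
  refine Finset.sum_congr rfl fun v hv => ?_
  rw [dif_pos (size_kappa hc hb hp hv), capOn]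
  congr 1
  ext x
  simp only [Finset.mem_inter, mem_verts_iff]
  constructor
  · rintro ⟨h1, -, h2⟩; exact ⟨h1, h2⟩
  · rintro ⟨h1, h2⟩
    refine ⟨h1, ?_, h2⟩
    rcases h1 with rfl | h1
    · obtain ⟨h3, h4, h5⟩ := (mem_kappa hc hb hp).1 hv
      exact Or.inr (mem_inner_of_mem_block hb hp.2.1 hp.2.2 h3 h4)
    · exact Or.inr (inner_kappa_subset hc hb hp hv h1)

open Classical in
theorem capOn_toBlock {B : Finset V} {u : V} (hp : .toBlock u B ∈ treeArcs G) (Q : Finset V) :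
    capOn G (.toBlock u B) Q =
      if ∃ B' ∈ beta G u B, capOn G (.toCut B' u) Q = 0 ∧ ua G (.toCut B' u) then 0
      else (∑ B' ∈ beta G u B, (capOn G (.toCut B' u) Q - uaNum G (.toCut B' u))) +
        uaNum G (.toBlock u B) := by
  have key : ∀ B' ∈ beta G u B, (if _h : (Arc.toCut B' u).size G < (Arc.toBlock u B).size G then
      cap G (.toCut B' u) ((Arc.toCut B' u).verts G ∩ ((Arc.toBlock u B).verts G ∩ Q)) else 0) =
      capOn G (.toCut B' u) Q := by
    intro B' hB'
    rw [dif_pos (size_beta hc hb hp hB'), capOn]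
    congr 1
    ext x
    simp only [Finset.mem_inter, mem_verts_iff]
    constructor
    · rintro ⟨h1, -, h2⟩; exact ⟨h1, h2⟩
    · rintro ⟨h1, h2⟩
      refine ⟨h1, ?_, h2⟩
      rcases h1 with rfl | h1
      · exact Or.inl rfl
      · exact Or.inr (inner_beta_subset hc hb hp hB' h1)
  rw [capOn, cap]
  refine if_congr (exists_congr fun _ => and_congr_right fun hB' => by rw [key _ hB']) rfl ?_
  congr 1
  exact Finset.sum_congr rfl fun B' hB' => by rw [key B' hB']

theorem load_toCut {B : Finset V} {u : V} (hp : .toCut B u ∈ treeArcs G) (Q : Finset V) :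
    load G (.toCut B u) Q = (∑ v ∈ kappa G B u, load G (.toBlock v B) Q) +
      ((B.erase u ∩ Q).card : ℤ) := by
  have h : inner G (.toCut B u) ∩ Q =
      (kappa G B u).biUnion (fun v => inner G (.toBlock v B) ∩ Q) ∪ (B.erase u ∩ Q) := by
    ext x
    simp only [Finset.mem_inter, Finset.mem_union, Finset.mem_biUnion, mem_inner_toCut_iff' hc hb hp]
    constructor
    · rintro ⟨h | ⟨v, hv, h⟩, hQ⟩
      · exact Or.inr ⟨h, hQ⟩
      · exact Or.inl ⟨v, hv, h, hQ⟩
    · rintro (⟨v, hv, h, hQ⟩ | ⟨h, hQ⟩)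
      · exact ⟨Or.inr ⟨v, hv, h⟩, hQ⟩
      · exact ⟨Or.inl h, hQ⟩
  rw [load, h, Finset.card_union_of_disjoint, Finset.card_biUnion]
  · simp [load]
  · intro v hv v' hv' hne
    exact (pairwiseDisjoint_kappa hc hb hp hv hv' hne).mono Finset.inter_subset_left
      Finset.inter_subset_left
  · refine Finset.disjoint_left.2 fun x hx hx' => ?_
    obtain ⟨v, hv, hxv⟩ := Finset.mem_biUnion.1 hx
    exact notMem_block_of_mem_inner_toBlock hb hp.2.1 ((mem_kappa hc hb hp).1 hv).1
      (Finset.mem_inter.1 hxv).1 (Finset.mem_erase.1 (Finset.mem_inter.1 hx').1).2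

theorem load_toBlock {B : Finset V} {u : V} (hp : .toBlock u B ∈ treeArcs G) (Q : Finset V) :
    load G (.toBlock u B) Q = ∑ B' ∈ beta G u B, load G (.toCut B' u) Q := by
  have h : inner G (.toBlock u B) ∩ Q =
      (beta G u B).biUnion (fun B' => inner G (.toCut B' u) ∩ Q) := by
    ext x
    simp only [Finset.mem_inter, Finset.mem_biUnion, mem_inner_toBlock_iff' hc hb hp]
    constructor
    · rintro ⟨⟨v, hv, h⟩, hQ⟩; exact ⟨v, hv, h, hQ⟩
    · rintro ⟨v, hv, h, hQ⟩; exact ⟨⟨v, hv, h⟩, hQ⟩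
  rw [load, h, Finset.card_biUnion]
  · simp [load]
  · intro v hv v' hv' hne
    exact (pairwiseDisjoint_beta hc hb hp hv hv' hne).mono Finset.inter_subset_left
      Finset.inter_subset_left

/-- A token in `B` other than one on `u` costs one unit of capacity and adds one unit of load. The
two cancel in the value, which therefore ignores tokens in `B`. -/
theorem val_toCut {B : Finset V} {u : V} (hp : .toCut B u ∈ treeArcs G) (Q : Finset V) :
    val G (.toCut B u) Q = (∑ v ∈ kappa G B u, val G (.toBlock v B) Q) +
      uaNum G (.toCut B u) := by
  simp only [val, capOn_toCut hc hb hp, load_toCut hc hb hp, Finset.sum_add_distrib]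
  ring

/-- All branches that a token on `u` could use up have positive capacity. -/
def Open (G : SimpleGraph V) (p : Arc V) (Q : Finset V) : Prop := ua G p → 1 ≤ capOn G p Q

/-- The two claims support each other. The only danger for `(B, u)` is a token `s` in `B` while
`ua(B, u)` is false. Then `s` is in `κ` with `ua(s, B)` true, and the second claim for `(s, B)`
provides the unit of capacity that the token costs. If `u` carries a token, the rest of the clique
`B` is empty and nothing is subtracted. -/
theorem capOn_nonneg_aux {p : Arc V} (hp : p ∈ treeArcs G) {Q : Finset V}
    (hQ : G.IsIndepSet (Q : Set V)) :
    0 ≤ capOn G p Q ∧ (p.base ∈ Q → uaNum G p ≤ capOn G p Q) := by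
  suffices H : ∀ p ∈ treeArcs G, 0 ≤ capOn G p Q ∧ (p.base ∈ Q → uaNum G p ≤ capOn G p Q) from H p hp
  refine treeArcs_induction hc hb ?_ ?_
  · intro B u hp ih
    have hle : (B.erase u ∩ Q).card ≤ 1 := by
      rw [Finset.card_le_one]
      intro a ha b hb'
      simp only [Finset.mem_inter, Finset.mem_erase] at ha hb'
      by_contra hne
      exact hQ ha.2 hb'.2 hne (adj_of_mem_block hb hp.2.1 ha.1.2 hb'.1.2 hne)
    have hsum : 0 ≤ ∑ v ∈ kappa G B u, capOn G (.toBlock v B) Q :=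
      Finset.sum_nonneg fun v hv => (ih v hv).1
    have hua := uaNum_nonneg (G := G) (.toCut B u)
    rw [capOn_toCut hc hb hp]
    constructor
    · by_cases h : ua G (.toCut B u)
      · rw [uaNum_of_ua h]; omega
      rcases Finset.eq_empty_or_nonempty (B.erase u ∩ Q) with h0 | ⟨s, hs⟩
      · rw [h0]; simp; omega
      simp only [Finset.mem_inter, Finset.mem_erase] at hs
      rw [ua_toCut_iff hc hb hp, not_not] at h
      obtain ⟨hcut, hua'⟩ := h s hs.1.2 hs.1.1
      have hsk : s ∈ kappa G B u := (mem_kappa hc hb hp).2 ⟨hs.1.2, hs.1.1, hcut⟩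
      have h1 := (ih s hsk).2 hs.2
      rw [uaNum_of_ua hua'] at h1
      have h2 := Finset.single_le_sum (f := fun v => capOn G (.toBlock v B) Q)
        (fun v hv => (ih v hv).1) hsk
      omega
    · intro huQ
      have : B.erase u ∩ Q = ∅ := by
        ext x
        simp only [Finset.mem_inter, Finset.mem_erase, Finset.notMem_empty, iff_false]
        rintro ⟨⟨h1, h2⟩, h3⟩
        exact hQ h3 huQ h1 (adj_of_mem_block hb hp.2.1 h2 hp.2.2 h1)
      rw [this]; simp; omega
  · intro u B hp ih
    rw [capOn_toBlock hc hb hp]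
    split_ifs with h
    · obtain ⟨B', hB', h0, hua⟩ := h
      refine ⟨le_rfl, fun huQ => ?_⟩
      have := (ih B' hB').2 huQ
      rw [uaNum_of_ua hua] at this
      omega
    · have hsum : 0 ≤ ∑ B' ∈ beta G u B, (capOn G (.toCut B' u) Q - uaNum G (.toCut B' u)) := by
        refine Finset.sum_nonneg fun B' hB' => ?_
        have h0 := (ih B' hB').1
        by_cases hua : ua G (.toCut B' u)
        · have : capOn G (.toCut B' u) Q ≠ 0 := fun h' => h ⟨B', hB', h', hua⟩
          rw [uaNum_of_ua hua]; omega
        · rw [uaNum_of_not_ua hua]; omega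
      have := uaNum_nonneg (G := G) (.toBlock u B)
      exact ⟨by omega, fun _ => by omega⟩

theorem capOn_nonneg {p : Arc V} (hp : p ∈ treeArcs G) {Q : Finset V}
    (hQ : G.IsIndepSet (Q : Set V)) : 0 ≤ capOn G p Q := (capOn_nonneg_aux hc hb hp hQ).1

theorem uaNum_le_capOn {p : Arc V} (hp : p ∈ treeArcs G) {Q : Finset V}
    (hQ : G.IsIndepSet (Q : Set V)) (hbase : p.base ∈ Q) : uaNum G p ≤ capOn G p Q :=
  (capOn_nonneg_aux hc hb hp hQ).2 hbase

theorem open_of_base_mem {p : Arc V} (hp : p ∈ treeArcs G) {Q : Finset V}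
    (hQ : G.IsIndepSet (Q : Set V)) (hbase : p.base ∈ Q) : Open G p Q := fun h => by
  have := uaNum_le_capOn hc hb hp hQ hbase
  rwa [uaNum_of_ua h] at this

theorem Open.uaNum_le {p : Arc V} (hp : p ∈ treeArcs G) {Q : Finset V}
    (hQ : G.IsIndepSet (Q : Set V)) (h : Open G p Q) : uaNum G p ≤ capOn G p Q := by
  by_cases hua : ua G p
  · rw [uaNum_of_ua hua]; exact h hua
  · rw [uaNum_of_not_ua hua]; exact capOn_nonneg hc hb hp hQ

theorem not_open_iff {p : Arc V} (hp : p ∈ treeArcs G) {Q : Finset V}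
    (hQ : G.IsIndepSet (Q : Set V)) : ¬ Open G p Q ↔ capOn G p Q = 0 ∧ ua G p := by
  have := capOn_nonneg hc hb hp hQ
  unfold Open
  rw [Classical.not_imp, and_comm]
  exact and_congr_left fun _ => by omega

theorem capOn_toBlock_of_open {B : Finset V} {u : V} (hp : .toBlock u B ∈ treeArcs G)
    {Q : Finset V} (h : ∀ B' ∈ beta G u B, Open G (.toCut B' u) Q) :
    capOn G (.toBlock u B) Q =
      (∑ B' ∈ beta G u B, (capOn G (.toCut B' u) Q - uaNum G (.toCut B' u))) +
        uaNum G (.toBlock u B) := by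
  rw [capOn_toBlock hc hb hp, if_neg]
  rintro ⟨B', hB', h0, hua⟩
  have := h B' hB' hua
  omega

theorem capOn_toBlock_of_not_open {B B' : Finset V} {u : V} (hp : .toBlock u B ∈ treeArcs G)
    {Q : Finset V} (hQ : G.IsIndepSet (Q : Set V)) (hB' : B' ∈ beta G u B)
    (h : ¬ Open G (.toCut B' u) Q) : capOn G (.toBlock u B) Q = 0 := by
  rw [capOn_toBlock hc hb hp, if_pos]
  exact ⟨B', hB', (not_open_iff hc hb (toCut_mem_of_beta hc hb hp hB') hQ).1 h⟩

theorem val_toBlock_of_open {B : Finset V} {u : V} (hp : .toBlock u B ∈ treeArcs G)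
    {Q : Finset V} (h : ∀ B' ∈ beta G u B, Open G (.toCut B' u) Q) :
    val G (.toBlock u B) Q =
      (∑ B' ∈ beta G u B, (val G (.toCut B' u) Q - uaNum G (.toCut B' u))) +
        uaNum G (.toBlock u B) := by
  rw [val, capOn_toBlock_of_open hc hb hp h, load_toBlock hc hb hp]
  simp only [val, Finset.sum_sub_distrib, Finset.sum_add_distrib]
  ring

theorem load_le_val {p : Arc V} (hp : p ∈ treeArcs G) {Q : Finset V}
    (hQ : G.IsIndepSet (Q : Set V)) : load G p Q ≤ val G p Q := by
  have := capOn_nonneg hc hb hp hQ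
  unfold val; omega

/-- A closed branch makes `ua(u, B)` true and the capacity of `(u, B)` zero. If all branches are
open, all summands of the capacity are nonnegative and `ua(u, B)` remains. -/
theorem open_toBlock_iff {B : Finset V} {u : V} (hp : .toBlock u B ∈ treeArcs G)
    {Q : Finset V} (hQ : G.IsIndepSet (Q : Set V)) :
    Open G (.toBlock u B) Q ↔ ∀ B' ∈ beta G u B, Open G (.toCut B' u) Q := by
  constructor
  · intro h B' hB'
    by_contra hno
    have h1 := (not_open_iff hc hb (toCut_mem_of_beta hc hb hp hB') hQ).1 hno
    have h2 := h ((ua_toBlock_iff hc hb hp).2 ⟨B', hB', h1.2⟩)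
    have h3 := capOn_toBlock_of_not_open hc hb hp hQ hB' hno
    omega
  · intro h hua
    rw [capOn_toBlock_of_open hc hb hp h, uaNum_of_ua hua]
    have : 0 ≤ ∑ B' ∈ beta G u B, (capOn G (.toCut B' u) Q - uaNum G (.toCut B' u)) :=
      Finset.sum_nonneg fun B' hB' => by
        have := (h B' hB').uaNum_le hc hb (toCut_mem_of_beta hc hb hp hB') hQ
        omega
    omega

/-- A token on the base is invisible to the capacity of `p`, so agreement on the inner vertices is
enough. This locality is what allows branches to be treated independently. -/
theorem capOn_congr {p : Arc V} (hp : p ∈ treeArcs G) {Q Q' : Finset V}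
    (h : ∀ x ∈ inner G p, x ∈ Q ↔ x ∈ Q') : capOn G p Q = capOn G p Q' := by
  suffices H : ∀ p ∈ treeArcs G, (∀ x ∈ inner G p, x ∈ Q ↔ x ∈ Q') → capOn G p Q = capOn G p Q' from H p hp h
  refine treeArcs_induction hc hb ?_ ?_
  · intro B u hp ih h
    rw [capOn_toCut hc hb hp, capOn_toCut hc hb hp]
    have h1 : B.erase u ∩ Q = B.erase u ∩ Q' := by
      ext x
      simp only [Finset.mem_inter]
      exact and_congr_right fun hx => h x ((mem_inner_toCut_iff' hc hb hp).2 (Or.inl hx))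
    rw [h1, Finset.sum_congr rfl fun v hv =>
      ih v hv fun x hx => h x (inner_kappa_subset hc hb hp hv hx)]
  · intro u B hp ih h
    have key : ∀ B' ∈ beta G u B, capOn G (.toCut B' u) Q = capOn G (.toCut B' u) Q' :=
      fun B' hB' => ih B' hB' fun x hx => h x (inner_beta_subset hc hb hp hB' hx)
    classical
    rw [capOn_toBlock hc hb hp, capOn_toBlock hc hb hp]
    refine if_congr (exists_congr fun _ => and_congr_right fun hB' => by rw [key _ hB']) rfl ?_
    congr 1
    exact Finset.sum_congr rfl fun B' hB' => by rw [key B' hB']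

omit hc hb in
theorem load_congr {p : Arc V} {Q Q' : Finset V}
    (h : ∀ x ∈ inner G p, x ∈ Q ↔ x ∈ Q') : load G p Q = load G p Q' := by
  unfold load
  congr 2
  ext x
  simp only [Finset.mem_inter]
  exact and_congr_right fun hx => h x hx

theorem val_congr {p : Arc V} (hp : p ∈ treeArcs G) {Q Q' : Finset V}
    (h : ∀ x ∈ inner G p, x ∈ Q ↔ x ∈ Q') : val G p Q = val G p Q' := by
  rw [val, val, capOn_congr hc hb hp h, load_congr h]

/-- Capacity plus load is at most the number of vertices. -/
theorem val_le {p : Arc V} (hp : p ∈ treeArcs G) {Q : Finset V}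
    (hQ : G.IsIndepSet (Q : Set V)) : val G p Q ≤ (inner G p).card := by
  have hload : ∀ p : Arc V, ((inner G p).card : ℤ) = load G p Finset.univ := by
    intro p; simp [load]
  suffices H : ∀ p ∈ treeArcs G, val G p Q ≤ (inner G p).card from H p hp
  refine treeArcs_induction hc hb ?_ ?_
  · intro B u hp ih
    rw [val_toCut hc hb hp, hload, load_toCut hc hb hp]
    -- The block has a vertex besides `u`, which pays for `ua(B, u)`.
    have h1 : 1 ≤ (B.erase u ∩ Finset.univ).card := by
      obtain ⟨b, hbB, hbu⟩ := exists_mem_block_ne hc hb hp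
      exact Finset.card_pos.2 ⟨b, by simp [hbB, hbu]⟩
    have h2 := Finset.sum_le_sum ih
    simp only [hload] at h2
    have := uaNum_le_one (G := G) (.toCut B u)
    omega
  · intro u B hp ih
    by_cases h : ∀ B' ∈ beta G u B, Open G (.toCut B' u) Q
    · rw [val_toBlock_of_open hc hb hp h, hload, load_toBlock hc hb hp]
      have h2 := Finset.sum_le_sum ih
      simp only [hload] at h2
      rw [Finset.sum_sub_distrib]
      -- If `ua(u, B)` is true, some branch has true `ua` as well, so the subtracted terms
      -- compensate the added one.
      have h3 : uaNum G (.toBlock u B) ≤ ∑ B' ∈ beta G u B, uaNum G (.toCut B' u) := by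
        by_cases hua : ua G (.toBlock u B)
        · obtain ⟨B', hB', hua'⟩ := (ua_toBlock_iff hc hb hp).1 hua
          have := Finset.single_le_sum (f := fun B' => uaNum G (.toCut B' u))
            (fun B' _ => uaNum_nonneg _) hB'
          simp only [uaNum_of_ua hua'] at this
          exact (uaNum_le_one _).trans this
        · rw [uaNum_of_not_ua hua]
          exact Finset.sum_nonneg fun B' _ => uaNum_nonneg _
      omega
    · push Not at h
      obtain ⟨B', hB', hno⟩ := h
      rw [val, capOn_toBlock_of_not_open hc hb hp hQ hB' hno, zero_add, load]
      exact_mod_cast Finset.card_le_card Finset.inter_subset_left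

end Values

end TokenSliding

namespace TokenSliding

/-! ### Slides inside a branch: freeing the neighbours of the base and taking in a token. -/

section Moves

variable {V : Type*} [DecidableEq V] [Fintype V] {G : SimpleGraph V}

theorem Slide.symm {I J : Finset V} (h : Slide G I J) : Slide G J I := by
  obtain ⟨h1, h2, h3⟩ := h
  refine ⟨h2, h1, ?_⟩
  rcases h3 with rfl | ⟨v, w, hv, hw, hvw⟩
  · exact Or.inl rfl
  · exact Or.inr ⟨w, v, hw, hv, hvw.symm⟩

theorem Reachable.symm {I J : Finset V} (h : Reachable G I J) : Reachable G J I := by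
  induction h with
  | refl => exact .refl
  | tail _ h ih => exact .head h.symm ih

theorem Reachable.indep {I J : Finset V} (h : Reachable G I J) (hI : G.IsIndepSet (I : Set V)) :
    G.IsIndepSet (J : Set V) := by
  cases h with
  | refl => exact hI
  | tail _ h => exact h.2.1

/-- A slide is trivial or moves one token to a vertex without other occupied neighbours. -/
theorem Slide.cases {I J : Finset V} (h : Slide G I J) : I = J ∨
    ∃ v w, v ∈ I ∧ w ∉ I ∧ G.Adj v w ∧ J = insert w (I.erase v) ∧ ∀ y ∈ I, G.Adj w y → y = v := by
  obtain ⟨h1, h2, h3⟩ := h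
  rcases h3 with h3 | ⟨v, w, hv, hw, hvw⟩
  · exact Or.inl h3
  right
  have hv' : ∀ x, (x ∈ I ∧ x ∉ J) ↔ x = v := fun x => by
    rw [← Finset.mem_sdiff, hv, Finset.mem_singleton]
  have hw' : ∀ x, (x ∈ J ∧ x ∉ I) ↔ x = w := fun x => by
    rw [← Finset.mem_sdiff, hw, Finset.mem_singleton]
  have hvI := (hv' v).2 rfl
  have hwJ := (hw' w).2 rfl
  refine ⟨v, w, hvI.1, hwJ.2, hvw, ?_, ?_⟩
  · ext x
    have h4 := hv' x
    have h5 := hw' x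
    simp only [Finset.mem_insert, Finset.mem_erase]
    tauto
  · intro y hy hwy
    by_contra hyv
    have hyJ : y ∈ J := by
      by_contra hyJ
      exact hyv ((hv' y).1 ⟨hy, hyJ⟩)
    exact h2 hwJ.1 hyJ hwy.ne hwy

theorem slide_insert_erase {Q : Finset V} (hQ : G.IsIndepSet (Q : Set V)) {v w : V} (hv : v ∈ Q)
    (hvw : G.Adj v w) (hfree : ∀ y ∈ Q, G.Adj w y → y = v) :
    Slide G Q (insert w (Q.erase v)) := by
  have hw : w ∉ Q := fun hw => hQ hv hw hvw.ne hvw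
  refine ⟨hQ, ?_, Or.inr ⟨v, w, ?_, ?_, hvw⟩⟩
  · intro a ha b hb hab hadj
    simp only [Finset.coe_insert, Finset.coe_erase, Set.mem_insert_iff, Set.mem_sdiff,
      Finset.mem_coe, Set.mem_singleton_iff] at ha hb
    rcases ha with rfl | ha <;> rcases hb with rfl | hb
    · exact hab rfl
    · exact hb.2 (hfree b hb.1 hadj)
    · exact ha.2 (hfree a ha.1 hadj.symm)
    · exact hQ ha.1 hb.1 hab hadj
  · ext x
    simp only [Finset.mem_sdiff, Finset.mem_insert, Finset.mem_erase, Finset.mem_singleton]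
    by_cases hx : x = v
    · subst hx; simp [hv, hvw.ne]
    · simp only [hx]; tauto
  · ext x
    simp only [Finset.mem_sdiff, Finset.mem_insert, Finset.mem_erase, Finset.mem_singleton]
    by_cases hx : x = w
    · subst hx; simp [hw]
    · simp only [hx]; tauto

theorem Reachable.card_eq {I J : Finset V} (h : Reachable G I J) : I.card = J.card := by
  induction h with
  | refl => rfl
  | tail _ h ih =>
    rw [ih]
    rcases h.cases with rfl | ⟨v, w, hv, hw, -, rfl, -⟩
    · rfl
    · rw [Finset.card_insert_of_notMem (fun h => hw (Finset.mem_of_mem_erase h)),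
        Finset.card_erase_add_one hv]

/-- Slides preserve the number of tokens, so an unchanged outside forces an unchanged count inside.
-/
theorem load_eq_of_reachable {p : Arc V} {Q Q' : Finset V} (h : Reachable G Q Q')
    (hout : ∀ x ∉ inner G p, x ∈ Q' ↔ x ∈ Q) : load G p Q' = load G p Q := by
  have h1 := h.card_eq
  have h2 := Finset.card_inter_add_card_sdiff Q (inner G p)
  have h3 := Finset.card_inter_add_card_sdiff Q' (inner G p)
  have h4 : Q' \ inner G p = Q \ inner G p := by
    ext x
    simp only [Finset.mem_sdiff]
    exact and_congr_left fun hx => hout x hx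
  rw [h4] at h3
  rw [load, load, Finset.inter_comm, Finset.inter_comm _ Q]
  omega

theorem load_eq_add_one_of_reachable {p : Arc V} {Q Q' : Finset V} (h : Reachable G Q Q')
    (hout : ∀ x ∉ inner G p, x ≠ p.base → (x ∈ Q' ↔ x ∈ Q)) (hQ : p.base ∈ Q)
    (hQ' : p.base ∉ Q') : load G p Q' = load G p Q + 1 := by
  have h1 := h.card_eq
  have h2 := Finset.card_inter_add_card_sdiff Q (inner G p)
  have h3 := Finset.card_inter_add_card_sdiff Q' (inner G p)
  have h4 : Q \ inner G p = insert p.base (Q' \ inner G p) := by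
    ext x
    simp only [Finset.mem_sdiff, Finset.mem_insert]
    by_cases hx : x = p.base
    · subst hx; simp [hQ, base_notMem_inner]
    · simp only [hx, false_or]
      exact and_congr_left fun hx' => (hout x hx' hx).symm
  rw [h4, Finset.card_insert_of_notMem (by simp [hQ'])] at h2
  rw [load, load, Finset.inter_comm, Finset.inter_comm _ Q]
  omega

/-- `Below G q p`: the directed edge `q` occurs in the recursion for `p`. -/
inductive Below (G : SimpleGraph V) : Arc V → Arc V → Prop where
  | refl (p : Arc V) : Below G p p
  | kappa {q : Arc V} {B : Finset V} {u v : V} :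
      v ∈ kappa G B u → Below G q (.toBlock v B) → Below G q (.toCut B u)
  | beta {q : Arc V} {B B' : Finset V} {u : V} :
      B' ∈ beta G u B → Below G q (.toCut B' u) → Below G q (.toBlock u B)

/-- No `q` below `p` has a smaller value for `Q'` than for `Q`. -/
def ValLE (G : SimpleGraph V) (p : Arc V) (Q Q' : Finset V) : Prop :=
  ∀ q, Below G q p → val G q Q ≤ val G q Q'

theorem ValLE.val_le {p : Arc V} {Q Q' : Finset V} (h : ValLE G p Q Q') :
    val G p Q ≤ val G p Q' := h p (.refl p)

theorem ValLE.refl (p : Arc V) (Q : Finset V) : ValLE G p Q Q := fun _ _ => le_rfl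

theorem ValLE.trans {p : Arc V} {Q Q' Q'' : Finset V} (h : ValLE G p Q Q')
    (h' : ValLE G p Q' Q'') : ValLE G p Q Q'' := fun q hq => (h q hq).trans (h' q hq)

theorem ValLE.capOn_le {p : Arc V} {Q Q' : Finset V} (h : ValLE G p Q Q')
    (hl : load G p Q' = load G p Q) : capOn G p Q ≤ capOn G p Q' := by
  have := h.val_le
  unfold val at this
  omega

theorem Open.mono {p : Arc V} {Q Q' : Finset V} (h : Open G p Q)
    (hle : capOn G p Q ≤ capOn G p Q') : Open G p Q' := fun hua => (h hua).trans hle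

/-- The value of `(u, B)` itself needs a separate hypothesis: unlike that of `(B, u)`, it is not
monotone in the values of the branches, because a closed branch cancels the whole capacity. -/
theorem ValLE.toBlock {u : V} {B : Finset V} {Q Q' : Finset V}
    (h : ∀ B' ∈ beta G u B, ValLE G (.toCut B' u) Q Q')
    (h' : val G (.toBlock u B) Q ≤ val G (.toBlock u B) Q') : ValLE G (.toBlock u B) Q Q' := by
  intro q hq
  cases hq with
  | refl => exact h'
  | beta hB' hq => exact h _ hB' q hq

theorem exists_capOn_pos {B : Finset V} {u : V} {Q : Finset V}
    (h : 1 ≤ ∑ v ∈ kappa G B u, capOn G (.toBlock v B) Q) :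
    ∃ v ∈ kappa G B u, 1 ≤ capOn G (.toBlock v B) Q := by
  by_contra! hno
  have := Finset.sum_nonpos fun _ hv => Int.lt_add_one_iff.1 (hno _ hv)
  omega

variable (hc : G.Connected) (hb : IsBlockGraph G)
include hc hb

theorem Below.mem_treeArcs {p q : Arc V} (h : Below G q p) (hp : p ∈ treeArcs G) :
    q ∈ treeArcs G := by
  induction h with
  | refl => exact hp
  | kappa hv _ ih => exact ih (toBlock_mem_of_kappa hc hb hp hv)
  | beta hB' _ ih => exact ih (toCut_mem_of_beta hc hb hp hB')

theorem Below.inner_subset {p q : Arc V} (h : Below G q p) (hp : p ∈ treeArcs G) :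
    inner G q ⊆ inner G p := by
  induction h with
  | refl => exact subset_rfl
  | kappa hv _ ih =>
    exact (ih (toBlock_mem_of_kappa hc hb hp hv)).trans (inner_kappa_subset hc hb hp hv)
  | beta hB' _ ih =>
    exact (ih (toCut_mem_of_beta hc hb hp hB')).trans (inner_beta_subset hc hb hp hB')

theorem ValLE.of_agree {p : Arc V} (hp : p ∈ treeArcs G) {Q Q' : Finset V}
    (h : ∀ x ∈ inner G p, x ∈ Q' ↔ x ∈ Q) : ValLE G p Q Q' := fun _ hq =>
  (val_congr hc hb (hq.mem_treeArcs hc hb hp) fun x hx =>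
    (h x (hq.inner_subset hc hb hp hx)).symm).le

/-- The value of `(B, u)` is the sum of the values of its branches plus a constant, hence monotone
in them. -/
theorem ValLE.toCut {u : V} {B : Finset V} (hp : .toCut B u ∈ treeArcs G) {Q Q' : Finset V}
    (h : ∀ v ∈ kappa G B u, ValLE G (.toBlock v B) Q Q') : ValLE G (.toCut B u) Q Q' := by
  intro q hq
  cases hq with
  | refl =>
    rw [val_toCut hc hb hp, val_toCut hc hb hp]
    have := Finset.sum_le_sum fun v hv => (h v hv).val_le
    omega
  | kappa hv hq => exact h _ hv q hq

theorem notMem_block_of_mem_inner_kappa {B : Finset V} {u v x : V} (hp : .toCut B u ∈ treeArcs G)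
    (hv : v ∈ kappa G B u) (hx : x ∈ inner G (.toBlock v B)) : x ∉ B :=
  notMem_block_of_mem_inner_toBlock hb hp.2.1 ((mem_kappa hc hb hp).1 hv).1 hx

/-- The values below `(B, u)` do not depend on the tokens in `B`. -/
theorem ValLE.toCut_of_agree {u : V} {B : Finset V} (hp : .toCut B u ∈ treeArcs G)
    {Q Q' : Finset V} (h : ∀ x ∈ inner G (.toCut B u), x ∉ B → (x ∈ Q' ↔ x ∈ Q)) :
    ValLE G (.toCut B u) Q Q' := by
  refine ValLE.toCut hc hb hp fun v hv => ValLE.of_agree hc hb (toBlock_mem_of_kappa hc hb hp hv)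
    fun x hx => h x (inner_kappa_subset hc hb hp hv hx)
      (notMem_block_of_mem_inner_kappa hc hb hp hv hx)

theorem val_toBlock_le_of_open {B : Finset V} {u : V} (hp : .toBlock u B ∈ treeArcs G)
    {Q Q' : Finset V} (h : ∀ B' ∈ beta G u B, Open G (.toCut B' u) Q)
    (h' : ∀ B' ∈ beta G u B, Open G (.toCut B' u) Q')
    (hle : ∀ B' ∈ beta G u B, val G (.toCut B' u) Q ≤ val G (.toCut B' u) Q') :
    val G (.toBlock u B) Q ≤ val G (.toBlock u B) Q' := by
  rw [val_toBlock_of_open hc hb hp h, val_toBlock_of_open hc hb hp h']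
  have := Finset.sum_le_sum fun B' hB' => sub_le_sub_right (hle B' hB') (uaNum G (.toCut B' u))
  omega

/-- Slides inside `G[p]` can free the neighbours of the base. -/
def CanClear (G : SimpleGraph V) (p : Arc V) : Prop :=
  ∀ Q : Finset V, G.IsIndepSet (Q : Set V) → p.base ∉ Q → Open G p Q →
    ∃ Q', Reachable G Q Q' ∧ (∀ x ∉ inner G p, x ∈ Q' ↔ x ∈ Q) ∧
      (∀ x ∈ inner G p, G.Adj p.base x → x ∉ Q') ∧ ValLE G p Q Q'

/-- Slides inside `G[p]` can move a token from the base into `G[p]`. -/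
def CanAbsorb (G : SimpleGraph V) (p : Arc V) : Prop :=
  ∀ Q : Finset V, G.IsIndepSet (Q : Set V) → p.base ∈ Q → 1 ≤ capOn G p Q →
    ∃ Q', Reachable G Q Q' ∧ (∀ x ∉ inner G p, x ≠ p.base → (x ∈ Q' ↔ x ∈ Q)) ∧
      p.base ∉ Q' ∧ ValLE G p Q Q'

theorem mem_block_or_mem_inner_of_adj {B : Finset V} {x y : V} (hB : B ∈ blocks G Finset.univ)
    (hx : x ∈ B) (hxy : G.Adj x y) :
    y ∈ B ∨ x ∈ cutVerts G Finset.univ ∧ y ∈ inner G (.toBlock x B) := by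
  obtain ⟨D, hD, hxD, hyD⟩ := exists_block_of_adj hxy
  by_cases hDB : D = B
  · exact Or.inl (hDB ▸ hyD)
  · exact Or.inr ⟨(mem_cutVerts_univ_iff hb hc).2 ⟨D, hD, B, hB, hxD, hx, hDB⟩,
      (mem_inner_toBlock hb hB hx).2 ⟨D, hD, hxD, hDB,
        mem_inner_of_mem_block hb hD hxD hyD hxy.ne'⟩⟩

theorem eq_of_mem_block_of_indep {B Q : Finset V} {x y : V} (hB : B ∈ blocks G Finset.univ)
    (hQ : G.IsIndepSet (Q : Set V)) (hx : x ∈ B) (hy : y ∈ B) (hxQ : x ∈ Q) (hyQ : y ∈ Q) :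
    x = y := by
  by_contra hne
  exact hQ hxQ hyQ hne (adj_of_mem_block hb hB hx hy hne)

/-- Moving a token within a block, after freeing the other neighbours of the target. -/
theorem exists_move_in_block {B Q : Finset V} {s x : V} (hB : B ∈ blocks G Finset.univ)
    (hQ : G.IsIndepSet (Q : Set V)) (hs : s ∈ B) (hsQ : s ∈ Q) (hx : x ∈ B) (hxs : x ≠ s)
    (hclear : x ∈ cutVerts G Finset.univ →
      CanClear G (.toBlock x B) ∧ Open G (.toBlock x B) Q) :
    ∃ Q', Reachable G Q Q' ∧
      (∀ y ∉ inner G (.toBlock x B), y ≠ s → y ≠ x → (y ∈ Q' ↔ y ∈ Q)) ∧ s ∉ Q' ∧ x ∈ Q' ∧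
      (x ∈ cutVerts G Finset.univ → ValLE G (.toBlock x B) Q Q' ∧
        load G (.toBlock x B) Q' = load G (.toBlock x B) Q) := by
  have hxQ : x ∉ Q := fun h => hxs (eq_of_mem_block_of_indep hc hb hB hQ hx hs h hsQ)
  -- Before the slide, the neighbours of `x` outside `B` are freed. There are none if `x` is not a
  -- cut-vertex. Inside `B` the only token is the one on `s`.
  obtain ⟨Q₁, hreach, hout, hfree, hle⟩ : ∃ Q₁, Reachable G Q Q₁ ∧
      (∀ y ∉ inner G (.toBlock x B), y ∈ Q₁ ↔ y ∈ Q) ∧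
      (∀ y ∈ inner G (.toBlock x B), G.Adj x y → y ∉ Q₁) ∧
      (x ∈ cutVerts G Finset.univ → ValLE G (.toBlock x B) Q Q₁) := by
    by_cases hcut : x ∈ cutVerts G Finset.univ
    · obtain ⟨hcl, hop⟩ := hclear hcut
      obtain ⟨Q₁, h1, h2, h3, h4⟩ := hcl Q hQ hxQ hop
      exact ⟨Q₁, h1, h2, h3, fun _ => h4⟩
    · refine ⟨Q, .refl, fun _ _ => Iff.rfl, fun y hy _ => ?_, fun h => absurd h hcut⟩
      obtain ⟨D, hD, hxD, hne, -⟩ := (mem_inner_toBlock hb hB hx).1 hy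
      exact absurd ((mem_cutVerts_univ_iff hb hc).2 ⟨D, hD, B, hB, hxD, hx, hne⟩) hcut
  have hnot : ∀ y ∈ B, y ∉ inner G (.toBlock x B) := fun y hy h =>
    notMem_block_of_mem_inner_toBlock hb hB hx h hy
  have hQ₁ := hreach.indep hQ
  have hslide : Slide G Q₁ (insert x (Q₁.erase s)) := by
    refine slide_insert_erase hQ₁ ((hout s (hnot s hs)).2 hsQ)
      (adj_of_mem_block hb hB hs hx hxs.symm) fun y hy hxy => ?_
    rcases mem_block_or_mem_inner_of_adj hc hb hB hx hxy with h | h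
    · exact eq_of_mem_block_of_indep hc hb hB hQ h hs ((hout y (hnot y h)).1 hy) hsQ
    · exact absurd hy (hfree y h.2 hxy)
  have hagree : ∀ y ∈ inner G (.toBlock x B), y ∈ insert x (Q₁.erase s) ↔ y ∈ Q₁ := by
    intro y hy
    have h1 : y ≠ x := fun h => hnot x hx (h ▸ hy)
    have h2 : y ≠ s := fun h => hnot s hs (h ▸ hy)
    simp [h1, h2]
  refine ⟨_, hreach.tail hslide, fun y hy hys hyx => ?_, ?_, by simp, fun hcut => ⟨?_, ?_⟩⟩
  · simp [hys, hyx, hout y hy]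
  · simp [hxs.symm]
  · exact (hle hcut).trans (ValLE.of_agree hc hb (mem_treeArcs_toBlock.2 ⟨hcut, hB, hx⟩) hagree)
  · exact (load_congr hagree).trans (load_eq_of_reachable hreach hout)

/-- Moving a token of a block `B` into a branch `(v, B)` with positive capacity. -/
theorem exists_push {B Q : Finset V} {s v : V} (hv : .toBlock v B ∈ treeArcs G)
    (hQ : G.IsIndepSet (Q : Set V)) (hs : s ∈ B) (hsQ : s ∈ Q)
    (hclear : CanClear G (.toBlock v B)) (habs : CanAbsorb G (.toBlock v B))
    (hcap : 1 ≤ capOn G (.toBlock v B) Q) :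
    ∃ Q', Reachable G Q Q' ∧
      (∀ y ∉ inner G (.toBlock v B), y ≠ s → y ≠ v → (y ∈ Q' ↔ y ∈ Q)) ∧ s ∉ Q' ∧ v ∉ Q' ∧
      ValLE G (.toBlock v B) Q Q' := by
  by_cases hvs : v = s
  · subst hvs
    obtain ⟨Q', h1, h2, h3, h4⟩ := habs Q hQ hsQ hcap
    exact ⟨Q', h1, fun y hy hys _ => h2 y hy hys, h3, h3, h4⟩
  · obtain ⟨Q₁, h1, h2, h3, h4, h5⟩ := exists_move_in_block hc hb hv.2.1 hQ hs hsQ hv.2.2 hvs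
      (fun _ => ⟨hclear, fun _ => hcap⟩)
    obtain ⟨h6, h7⟩ := h5 hv.1
    obtain ⟨Q', h1', h2', h3', h4'⟩ := habs Q₁ (h1.indep hQ) h4 (hcap.trans (h6.capOn_le h7))
    have hsin : s ∉ inner G (.toBlock v B) := fun h =>
      notMem_block_of_mem_inner_toBlock hb hv.2.1 hv.2.2 h hs
    refine ⟨Q', h1.trans h1', fun y hy hys hyv => (h2' y hy hyv).trans (h2 y hy hys hyv),
      fun h => h3 ((h2' s hsin (Ne.symm hvs)).1 h), h3', h6.trans h4'⟩

theorem sum_capOn_nonneg {B : Finset V} {u : V} (hp : .toCut B u ∈ treeArcs G) {Q : Finset V}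
    (hQ : G.IsIndepSet (Q : Set V)) : 0 ≤ ∑ v ∈ kappa G B u, capOn G (.toBlock v B) Q :=
  Finset.sum_nonneg fun _ hv => capOn_nonneg hc hb (toBlock_mem_of_kappa hc hb hp hv) hQ

/-- The change made by `exists_push` does not affect the other branches at the block. -/
theorem ValLE.toCut_of_agree_off {B : Finset V} {u v : V} (hp : .toCut B u ∈ treeArcs G)
    {Q Q' : Finset V} (hv : v ∈ B)
    (hout : ∀ y ∉ inner G (.toBlock v B), y ∉ B → (y ∈ Q' ↔ y ∈ Q))
    (hle : v ∈ kappa G B u → ValLE G (.toBlock v B) Q Q') : ValLE G (.toCut B u) Q Q' := by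
  refine ValLE.toCut hc hb hp fun v' hv' => ?_
  by_cases h : v' = v
  · subst h; exact hle hv'
  · refine ValLE.of_agree hc hb (toBlock_mem_of_kappa hc hb hp hv') fun x hx => hout x ?_ ?_
    · intro hx'
      exact h (eq_of_mem_inner_toBlock hb hp.2.1 ((mem_kappa hc hb hp).1 hv').1 hv hx hx')
    · exact notMem_block_of_mem_inner_kappa hc hb hp hv' hx

/-- At most one token `s` lies in the clique `B` without `u`. It lowers the capacity by one, so
openness forces the capacities of the branches to sum to at least one. Some branch `(v, B)` has
room, and `s` is pushed into it. -/
theorem canClear_toCut {B : Finset V} {u : V} (hp : .toCut B u ∈ treeArcs G)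
    (ih : ∀ v ∈ kappa G B u, CanClear G (.toBlock v B) ∧ CanAbsorb G (.toBlock v B)) :
    CanClear G (.toCut B u) := by
  intro Q hQ huQ hop
  have huQ : u ∉ Q := huQ
  have hB : B ∈ blocks G Finset.univ := hp.2.1
  rcases Finset.eq_empty_or_nonempty (B.erase u ∩ Q) with h0 | ⟨s, hs⟩
  · refine ⟨Q, .refl, fun _ _ => Iff.rfl, fun x hx hux hxQ => ?_, ValLE.refl _ _⟩
    have : x ∈ B.erase u ∩ Q := by
      rw [Finset.mem_inter, Finset.mem_erase]
      exact ⟨⟨hux.ne', mem_block_of_adj_base hc hb hp hx hux⟩, hxQ⟩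
    simp [h0] at this
  have hcard : (B.erase u ∩ Q).card = 1 := by
    rw [Finset.card_eq_one]
    refine ⟨s, Finset.eq_singleton_iff_unique_mem.2 ⟨hs, fun y hy => ?_⟩⟩
    simp only [Finset.mem_inter, Finset.mem_erase] at hs hy
    exact eq_of_mem_block_of_indep hc hb hB hQ hy.1.2 hs.1.2 hy.2 hs.2
  simp only [Finset.mem_inter, Finset.mem_erase] at hs
  have hcap := capOn_toCut hc hb hp Q
  have hle := hop.uaNum_le hc hb hp hQ
  obtain ⟨v, hv, hcapv⟩ := exists_capOn_pos (G := G) (B := B) (u := u) (Q := Q) (by omega)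
  obtain ⟨hvB, hvu, hvcut⟩ := (mem_kappa hc hb hp).1 hv
  obtain ⟨Q', h1, h2, h3, h4, h5⟩ := exists_push hc hb (toBlock_mem_of_kappa hc hb hp hv) hQ
    hs.1.2 hs.2 (ih v hv).1 (ih v hv).2 hcapv
  refine ⟨Q', h1, fun x hx => h2 x (fun h => hx (inner_kappa_subset hc hb hp hv h)) ?_ ?_,
    fun x hx hux hxQ' => ?_, ValLE.toCut_of_agree_off hc hb hp hvB ?_ fun _ => h5⟩
  · rintro rfl
    exact hx (mem_inner_of_mem_block hb hB hp.2.2 hs.1.2 hs.1.1)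
  · rintro rfl
    exact hx (mem_inner_of_mem_block hb hB hp.2.2 hvB hvu)
  · have hxB := mem_block_of_adj_base hc hb hp hx hux
    have hxs : x ≠ s := fun h => h3 (h ▸ hxQ')
    have hxv : x ≠ v := fun h => h4 (h ▸ hxQ')
    have hxQ := (h2 x (fun h => notMem_block_of_mem_inner_kappa hc hb hp hv h hxB) hxs hxv).1 hxQ'
    exact hxs (eq_of_mem_block_of_indep hc hb hB hQ hxB hs.1.2 hxQ hs.2)
  · intro y hy hyB
    exact h2 y hy (fun h => hyB (h ▸ hs.1.2)) (fun h => hyB (h ▸ hvB))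

/-- If some branch `(v, B)` has room, the token on `u` is pushed there. Otherwise the capacity comes
from `ua(B, u)` alone, so some `x` in `B` is not a cut-vertex or has `ua(x, B)` false. In the latter
case `(x, B)` is open without any capacity, and the token can stop on `x`. -/
theorem canAbsorb_toCut {B : Finset V} {u : V} (hp : .toCut B u ∈ treeArcs G)
    (ih : ∀ v ∈ kappa G B u, CanClear G (.toBlock v B) ∧ CanAbsorb G (.toBlock v B)) :
    CanAbsorb G (.toCut B u) := by
  intro Q hQ huQ hcap
  have huQ : u ∈ Q := huQ
  have hB : B ∈ blocks G Finset.univ := hp.2.1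
  have hu : u ∈ B := hp.2.2
  have hsub : ∀ v ∈ B, v ≠ u → ∀ x ∉ inner G (.toCut B u), x ≠ u →
      x ∉ inner G (.toBlock v B) ∧ x ≠ v := by
    intro v hv hvu x hx hxu
    refine ⟨fun h => hx ((mem_inner_toCut_iff hb hB hu).2 (Or.inr ⟨v, hv, hvu, h⟩)), ?_⟩
    rintro rfl
    exact hx (mem_inner_of_mem_block hb hB hu hv hxu)
  by_cases hex : ∃ v ∈ kappa G B u, 1 ≤ capOn G (.toBlock v B) Q
  · obtain ⟨v, hv, hcapv⟩ := hex
    obtain ⟨hvB, hvu, hvcut⟩ := (mem_kappa hc hb hp).1 hv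
    obtain ⟨Q', h1, h2, h3, h4, h5⟩ := exists_push hc hb (toBlock_mem_of_kappa hc hb hp hv) hQ
      hu huQ (ih v hv).1 (ih v hv).2 hcapv
    refine ⟨Q', h1, fun x hx hxu => ?_, h3,
      ValLE.toCut_of_agree_off hc hb hp hvB ?_ fun _ => h5⟩
    · exact h2 x (hsub v hvB hvu x hx hxu).1 hxu (hsub v hvB hvu x hx hxu).2
    · exact fun y hy hyB => h2 y hy (fun h => hyB (h ▸ hu)) (fun h => hyB (h ▸ hvB))
  · have hua : ua G (.toCut B u) := by
      by_contra hua
      have h1 := capOn_toCut hc hb hp Q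
      rw [uaNum_of_not_ua hua] at h1
      exact hex (exists_capOn_pos (G := G) (by omega))
    rw [ua_toCut_iff hc hb hp] at hua
    push Not at hua
    obtain ⟨x, hxB, hxu, hx⟩ := hua
    obtain ⟨Q', h1, h2, h3, h4, h5⟩ := exists_move_in_block hc hb hB hQ hu huQ hxB hxu
      (fun hcut => ⟨(ih x ((mem_kappa hc hb hp).2 ⟨hxB, hxu, hcut⟩)).1,
        fun h => absurd h (hx hcut)⟩)
    refine ⟨Q', h1, fun y hy hyu => ?_, h3, ValLE.toCut_of_agree_off hc hb hp hxB ?_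
      fun hxk => (h5 ((mem_kappa hc hb hp).1 hxk).2.2).1⟩
    · exact h2 y (hsub x hxB hxu y hy hyu).1 hyu (hsub x hxB hxu y hy hyu).2
    · exact fun y hy hyB => h2 y hy (fun h => hyB (h ▸ hu)) (fun h => hyB (h ▸ hxB))

theorem notMem_inner_of_ne {B D : Finset V} {u x : V} (hB : .toCut B u ∈ treeArcs G)
    (hD : .toCut D u ∈ treeArcs G) (hne : B ≠ D) (hx : x ∈ inner G (.toCut B u)) :
    x ∉ inner G (.toCut D u) := fun hx' =>
  hne (block_eq_of_mem_inner hb hB.2.1 hB.2.2 hD.2.1 hD.2.2 hx hx')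

/-- Freeing the neighbours of `u` in several blocks. -/
theorem exists_clear_many {u : V} {Q : Finset V} (hQ : G.IsIndepSet (Q : Set V)) (huQ : u ∉ Q)
    (K : Finset (Finset V)) (hK : ∀ D ∈ K, .toCut D u ∈ treeArcs G)
    (hclear : ∀ D ∈ K, CanClear G (.toCut D u)) (hop : ∀ D ∈ K, Open G (.toCut D u) Q) :
    ∃ Q', Reachable G Q Q' ∧ (∀ x, (∀ D ∈ K, x ∉ inner G (.toCut D u)) → (x ∈ Q' ↔ x ∈ Q)) ∧
      (∀ D ∈ K, ∀ x ∈ inner G (.toCut D u), G.Adj u x → x ∉ Q') ∧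
      (∀ D ∈ K, ValLE G (.toCut D u) Q Q' ∧ load G (.toCut D u) Q' = load G (.toCut D u) Q) := by
  induction K using Finset.induction_on with
  | empty => exact ⟨Q, .refl, by simp, by simp, by simp⟩
  | insert D K hDK ih =>
    obtain ⟨Q₁, h1, h2, h3, h4⟩ := ih (fun D hD => hK D (Finset.mem_insert_of_mem hD))
      (fun D hD => hclear D (Finset.mem_insert_of_mem hD))
      (fun D hD => hop D (Finset.mem_insert_of_mem hD))
    have hD := hK D (Finset.mem_insert_self D K)
    have hagree : ∀ x ∈ inner G (.toCut D u), x ∈ Q₁ ↔ x ∈ Q := fun x hx =>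
      h2 x fun D' hD' => notMem_inner_of_ne hc hb hD (hK D' (Finset.mem_insert_of_mem hD'))
        (fun h => hDK (h ▸ hD')) hx
    have hcap := capOn_congr hc hb hD fun x hx => (hagree x hx).symm
    obtain ⟨Q₂, h1', h2', h3', h4'⟩ := hclear D (Finset.mem_insert_self D K) Q₁ (h1.indep hQ)
      (by
        rw [Arc.base, h2 u fun D' hD' => base_notMem_inner (.toCut D' u)]
        exact huQ)
      ((hop D (Finset.mem_insert_self D K)).mono hcap.le)
    have hagree' : ∀ D' ∈ K, ∀ x ∈ inner G (.toCut D' u), x ∈ Q₂ ↔ x ∈ Q₁ := fun D' hD' x hx =>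
      h2' x (notMem_inner_of_ne hc hb (hK D' (Finset.mem_insert_of_mem hD')) hD
        (fun h => hDK (h ▸ hD')) hx)
    refine ⟨Q₂, h1.trans h1', fun x hx => ?_, fun D' hD' => ?_, fun D' hD' => ?_⟩
    · rw [Finset.forall_mem_insert] at hx
      exact (h2' x hx.1).trans (h2 x hx.2)
    · rcases Finset.mem_insert.1 hD' with rfl | hD'
      · exact h3'
      · intro x hx hux
        rw [hagree' D' hD' x hx]
        exact h3 D' hD' x hx hux
    · rcases Finset.mem_insert.1 hD' with rfl | hD'
      · exact ⟨(ValLE.of_agree hc hb hD hagree).trans h4',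
          (load_eq_of_reachable h1' h2').trans (load_congr hagree)⟩
      · exact ⟨(h4 D' hD').1.trans (ValLE.of_agree hc hb
          (hK D' (Finset.mem_insert_of_mem hD')) (hagree' D' hD')),
          (load_congr (hagree' D' hD')).trans (h4 D' hD').2⟩

/-- Openness of `(u, B)` passes to every branch, and clearing one branch does not disturb the
others, so the branches stay open and the additive formula for the value applies before and after.
-/
theorem canClear_toBlock {B : Finset V} {u : V} (hp : .toBlock u B ∈ treeArcs G)
    (ih : ∀ B' ∈ beta G u B, CanClear G (.toCut B' u)) : CanClear G (.toBlock u B) := by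
  intro Q hQ huQ hop
  rw [open_toBlock_iff hc hb hp hQ] at hop
  obtain ⟨Q', h1, h2, h3, h4⟩ := exists_clear_many hc hb hQ huQ (beta G u B)
    (fun D hD => toCut_mem_of_beta hc hb hp hD) ih hop
  refine ⟨Q', h1, fun x hx => h2 x fun D hD h => hx (inner_beta_subset hc hb hp hD h),
    fun x hx hux => ?_, ValLE.toBlock (fun D hD => (h4 D hD).1)
      (val_toBlock_le_of_open hc hb hp hop (fun D hD =>
        (hop D hD).mono ((h4 D hD).1.capOn_le (h4 D hD).2)) fun D hD => (h4 D hD).1.val_le)⟩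
  obtain ⟨D, hD, hxD⟩ := (mem_inner_toBlock_iff' hc hb hp).1 hx
  exact h3 D hD x hxD hux

theorem canAbsorb_toBlock {B : Finset V} {u : V} (hp : .toBlock u B ∈ treeArcs G)
    (ih : ∀ B' ∈ beta G u B, CanAbsorb G (.toCut B' u)) : CanAbsorb G (.toBlock u B) := by
  intro Q hQ huQ hcap
  have huQ : u ∈ Q := huQ
  have harc : ∀ D ∈ beta G u B, .toCut D u ∈ treeArcs G := fun D hD =>
    toCut_mem_of_beta hc hb hp hD
  have hop : ∀ D ∈ beta G u B, Open G (.toCut D u) Q := fun D hD =>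
    open_of_base_mem hc hb (harc D hD) hQ huQ
  have hform := capOn_toBlock_of_open hc hb hp hop
  -- Preferably the token goes to a branch with capacity beyond its `ua`, which stays open
  -- afterwards. If there is none, the capacity of `(u, B)` is just `ua(u, B)`, so it is at most
  -- one, and a branch with true `ua` takes the token.
  obtain ⟨D, hD, hDcap, hcase⟩ : ∃ D ∈ beta G u B, 1 ≤ capOn G (.toCut D u) Q ∧
      (1 ≤ capOn G (.toCut D u) Q - uaNum G (.toCut D u) ∨ capOn G (.toBlock u B) Q ≤ 1) := by
    by_cases hex : ∃ D ∈ beta G u B, 1 ≤ capOn G (.toCut D u) Q - uaNum G (.toCut D u)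
    · obtain ⟨D, hD, h⟩ := hex
      have := uaNum_nonneg (G := G) (.toCut D u)
      exact ⟨D, hD, by omega, Or.inl h⟩
    · push Not at hex
      have hsum := Finset.sum_nonpos fun D hD => Int.lt_add_one_iff.1 (hex D hD)
      have hua : ua G (.toBlock u B) := by
        by_contra hua
        rw [uaNum_of_not_ua hua] at hform
        omega
      obtain ⟨D, hD, huaD⟩ := (ua_toBlock_iff hc hb hp).1 hua
      have := uaNum_le_one (G := G) (.toBlock u B)
      exact ⟨D, hD, hop D hD huaD, Or.inr (by omega)⟩
  obtain ⟨Q', h1, h2, h3, h4⟩ := ih D hD Q hQ huQ hDcap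
  have hagree : ∀ D' ∈ beta G u B, D' ≠ D → ∀ x ∈ inner G (.toCut D' u), x ∈ Q' ↔ x ∈ Q := by
    intro D' hD' hne x hx
    exact h2 x (notMem_inner_of_ne hc hb (harc D' hD') (harc D hD) hne hx)
      fun h => base_notMem_inner (G := G) (.toCut D' u) (h ▸ hx)
  have hle : ∀ D' ∈ beta G u B, ValLE G (.toCut D' u) Q Q' := by
    intro D' hD'
    by_cases hne : D' = D
    · exact hne ▸ h4
    · exact ValLE.of_agree hc hb (harc D' hD') (hagree D' hD' hne)
  have hout : ∀ x ∉ inner G (.toBlock u B), x ≠ u → (x ∈ Q' ↔ x ∈ Q) := fun x hx hxu =>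
    h2 x (fun h => hx (inner_beta_subset hc hb hp hD h)) hxu
  refine ⟨Q', h1, hout, h3, ValLE.toBlock hle ?_⟩
  -- In the first case all branches remain open and the additive formula compares the values. In the
  -- second a branch may close, but the load has grown by one, which makes up for a capacity of at
  -- most one.
  rcases hcase with hcase | hcase
  · refine val_toBlock_le_of_open hc hb hp hop (fun D' hD' => ?_) fun D' hD' => (hle D' hD').val_le
    by_cases hne : D' = D
    · subst hne
      intro hua
      have h5 := h4.val_le
      have h6 := load_eq_add_one_of_reachable h1 h2 huQ h3
      rw [uaNum_of_ua hua] at hcase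
      unfold val at h5
      omega
    · exact (hop D' hD').mono (capOn_congr hc hb (harc D' hD')
        fun x hx => (hagree D' hD' hne x hx).symm).le
  · have h6 := load_eq_add_one_of_reachable (p := .toBlock u B) h1 hout huQ h3
    have h7 := load_le_val hc hb hp (h1.indep hQ)
    unfold val at h7 ⊢
    omega

theorem canClear_and_canAbsorb {p : Arc V} (hp : p ∈ treeArcs G) :
    CanClear G p ∧ CanAbsorb G p := by
  suffices H : ∀ p ∈ treeArcs G, CanClear G p ∧ CanAbsorb G p from H p hp
  exact treeArcs_induction hc hb
    (fun B u hp ih => ⟨canClear_toCut hc hb hp ih, canAbsorb_toCut hc hb hp ih⟩)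
    (fun u B hp ih => ⟨canClear_toBlock hc hb hp fun D hD => (ih D hD).1,
      canAbsorb_toBlock hc hb hp fun D hD => (ih D hD).2⟩)

end Moves

end TokenSliding

namespace TokenSliding

/-! ### Handing a token to the base, and gluing of configurations. -/

section Gluing

variable {V : Type*} [DecidableEq V] [Fintype V] {G : SimpleGraph V}

/-- The values of all directed edges below `p` are maximal among the sets reachable from `Q`. -/
def IsMax (G : SimpleGraph V) (p : Arc V) (Q : Finset V) : Prop :=
  ∀ q, Below G q p → ∀ D, Reachable G Q D → val G q D ≤ val G q Q

theorem IsMax.val_le {p : Arc V} {Q D : Finset V} (h : IsMax G p Q) (hD : Reachable G Q D) :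
    val G p D ≤ val G p Q := h p (.refl p) D hD

theorem IsMax.of_valLE {p : Arc V} {Q Q' : Finset V} (h : IsMax G p Q) (hr : Reachable G Q Q')
    (hle : ValLE G p Q Q') : IsMax G p Q' := fun q hq D hD =>
  (h q hq D (hr.trans hD)).trans (hle q hq)

variable (hc : G.Connected) (hb : IsBlockGraph G)
include hc hb

/-- The base is the only gateway of `G[p]`, so a slide with an empty base before and after stays on
one side of it. -/
theorem load_eq_of_slide {p : Arc V} (hp : p ∈ treeArcs G) {D D' : Finset V} (h : Slide G D D')
    (hD : p.base ∉ D) (hD' : p.base ∉ D') : load G p D' = load G p D := by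
  rcases h.cases with rfl | ⟨v, w, hv, hw, hvw, rfl, -⟩
  · rfl
  have hvb : v ≠ p.base := fun h => hD (h ▸ hv)
  have hwb : w ≠ p.base := fun h => hD' (h ▸ Finset.mem_insert_self _ _)
  by_cases hvi : v ∈ inner G p
  · have hwi : w ∈ inner G p := by
      by_contra hwi
      exact hwb (eq_base_of_adj hc hb hp hvi hwi hvw)
    refine load_eq_of_reachable (.single h) fun x hx => ?_
    have h1 : x ≠ v := fun h => hx (h ▸ hvi)
    have h2 : x ≠ w := fun h => hx (h ▸ hwi)
    simp [h1, h2]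
  · have hwi : w ∉ inner G p := fun hwi => hvb (eq_base_of_adj hc hb hp hwi hvi hvw.symm)
    refine load_congr fun x hx => ?_
    have h1 : x ≠ v := fun h => hvi (h ▸ hx)
    have h2 : x ≠ w := fun h => hwi (h ▸ hx)
    simp [h1, h2]

/-- The load of a branch changes only through its base. -/
theorem exists_base_mem_of_load_ne {p : Arc V} (hp : p ∈ treeArcs G) {Q D : Finset V}
    (hD : Reachable G Q D) (hne : load G p D ≠ load G p Q) :
    ∃ E, Reachable G Q E ∧ p.base ∈ E := by
  by_contra! hno
  refine hne ?_
  clear hne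
  induction hD with
  | refl => rfl
  | @tail D D' hD h ih =>
    exact (load_eq_of_slide hc hb hp h (hno _ hD) (hno _ (hD.tail h))).trans ih

theorem exists_toCut_of_adj {u y : V} (hu : u ∈ cutVerts G Finset.univ) (h : G.Adj u y) :
    ∃ D, .toCut D u ∈ treeArcs G ∧ y ∈ D ∧ y ∈ inner G (.toCut D u) := by
  obtain ⟨D, hD, huD, hyD⟩ := exists_block_of_adj h
  exact ⟨D, ⟨hu, hD, huD⟩, hyD, mem_inner_of_mem_block hb hD huD hyD h.ne'⟩

/-- If two branches at `u` are full and cannot be improved, then `u` is never occupied. -/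
theorem notMem_of_two_closed {u : V} {B₁ B₂ Q : Finset V} (h₁ : .toCut B₁ u ∈ treeArcs G)
    (h₂ : .toCut B₂ u ∈ treeArcs G) (hne : B₁ ≠ B₂) (hQ : G.IsIndepSet (Q : Set V))
    (hcl₁ : ¬ Open G (.toCut B₁ u) Q) (hcl₂ : ¬ Open G (.toCut B₂ u) Q)
    (hmax₁ : ∀ D, Reachable G Q D → val G (.toCut B₁ u) D ≤ val G (.toCut B₁ u) Q)
    (hmax₂ : ∀ D, Reachable G Q D → val G (.toCut B₂ u) D ≤ val G (.toCut B₂ u) Q)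
    {D : Finset V} (hD : Reachable G Q D) :
    u ∉ D ∧ load G (.toCut B₁ u) D = load G (.toCut B₁ u) Q ∧
      load G (.toCut B₂ u) D = load G (.toCut B₂ u) Q := by
  induction hD with
  | refl => exact ⟨fun h => hcl₁ (open_of_base_mem hc hb h₁ hQ h), rfl, rfl⟩
  | @tail D D' hD h ih =>
    obtain ⟨huD, hl₁, hl₂⟩ := ih
    -- A token arriving on `u` must come from every closed maximal branch. Otherwise the load of
    -- that branch is unchanged while its capacity rises from 0 to at least 1, against maximality of
    -- its value. No vertex lies in two branches.
    have key : ∀ B, .toCut B u ∈ treeArcs G → ¬ Open G (.toCut B u) Q →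
        (∀ D, Reachable G Q D → val G (.toCut B u) D ≤ val G (.toCut B u) Q) →
        load G (.toCut B u) D = load G (.toCut B u) Q →
        u ∈ D' → ∀ v ∈ D, G.Adj v u → D' = insert u (D.erase v) → v ∈ inner G (.toCut B u) := by
      intro B hB hcl hmax hl huD' v hvD hvu hD'
      by_contra hv
      have h3 : load G (.toCut B u) D' = load G (.toCut B u) D := by
        refine load_congr fun x hx => ?_
        have h1 : x ≠ v := fun h => hv (h ▸ hx)
        have h2 : x ≠ u := fun h => base_notMem_inner (G := G) (.toCut B u) (h ▸ hx)
        simp [hD', h1, h2]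
      obtain ⟨h4, h5⟩ := (not_open_iff hc hb hB hQ).1 hcl
      have h6 := uaNum_le_capOn hc hb hB (h.2.1) (show (Arc.toCut B u).base ∈ D' from huD')
      have h7 := hmax D' (hD.tail h)
      rw [uaNum_of_ua h5] at h6
      unfold val at h7
      omega
    have huD' : u ∉ D' := by
      intro huD'
      rcases h.cases with rfl | ⟨v, w, hv, hw, hvw, hD', -⟩
      · exact huD huD'
      · have hwu : w = u := by
          by_contra hwu
          rw [hD', Finset.mem_insert, Finset.mem_erase] at huD'
          rcases huD' with h | h
          · exact hwu h.symm
          · exact huD h.2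
        subst hwu
        exact notMem_inner_of_ne hc hb h₁ h₂ hne (key B₁ h₁ hcl₁ hmax₁ hl₁ huD' v hv hvw hD')
          (key B₂ h₂ hcl₂ hmax₂ hl₂ huD' v hv hvw hD')
    exact ⟨huD', (load_eq_of_slide hc hb h₁ h huD huD').trans hl₁,
      (load_eq_of_slide hc hb h₂ h huD huD').trans hl₂⟩

/-- Slides inside `G[p]` can move a token to the base. -/
def CanEmit (G : SimpleGraph V) (p : Arc V) : Prop :=
  ∀ Q : Finset V, G.IsIndepSet (Q : Set V) → p.base ∉ Q →
    (∀ x ∉ inner G p, G.Adj p.base x → x ∉ Q) → IsMax G p Q →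
    (∃ D, Reachable G Q D ∧ load G p D < load G p Q) →
    ∃ Q', Reachable G Q Q' ∧ (∀ x ∉ inner G p, x ≠ p.base → (x ∈ Q' ↔ x ∈ Q)) ∧
      p.base ∈ Q' ∧ ValLE G p Q Q'

/-- A token already in `B` slides to `u` directly. If there is none, the load lost in `D` is lost in
some branch `(v, B)`. That branch emits a token to `v`, from which it slides on to `u`. -/
theorem canEmit_toCut {B : Finset V} {u : V} (hp : .toCut B u ∈ treeArcs G)
    (ih : ∀ v ∈ kappa G B u, CanEmit G (.toBlock v B)) : CanEmit G (.toCut B u) := by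
  rintro Q hQ huQ hfree hmax ⟨D, hD, hload⟩
  have huQ : u ∉ Q := huQ
  have hfree : ∀ x ∉ inner G (.toCut B u), G.Adj u x → x ∉ Q := hfree
  have hB : B ∈ blocks G Finset.univ := hp.2.1
  have hu : u ∈ B := hp.2.2
  rcases Finset.eq_empty_or_nonempty (B.erase u ∩ Q) with h0 | ⟨s, hs⟩
  · have hBQ : ∀ x ∈ B, x ∉ Q := by
      intro x hx hxQ
      have : x ∈ B.erase u ∩ Q :=
        Finset.mem_inter.2 ⟨Finset.mem_erase.2 ⟨fun h => huQ (h ▸ hxQ), hx⟩, hxQ⟩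
      simp [h0] at this
    rw [load_toCut hc hb hp, load_toCut hc hb hp, h0] at hload
    obtain ⟨v, hv, hlt⟩ : ∃ v ∈ kappa G B u,
        load G (.toBlock v B) D < load G (.toBlock v B) Q := by
      refine Finset.exists_lt_of_sum_lt ?_
      simp only [Finset.card_empty, Nat.cast_zero] at hload
      omega
    obtain ⟨hvB, hvu, hvcut⟩ := (mem_kappa hc hb hp).1 hv
    have hvarc := toBlock_mem_of_kappa hc hb hp hv
    obtain ⟨Q₁, h1, h2, h3, h4⟩ := ih v hv Q hQ (hBQ v hvB)
      (fun x hx hvx => by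
        rcases mem_block_or_mem_inner_of_adj hc hb hB hvB hvx with h | h
        · exact hBQ x h
        · exact absurd h.2 hx)
      (fun q hq => hmax q (.kappa hv hq)) ⟨D, hD, hlt⟩
    have h3 : v ∈ Q₁ := h3
    have h2 : ∀ x ∉ inner G (.toBlock v B), x ≠ v → (x ∈ Q₁ ↔ x ∈ Q) := h2
    have hnin : ∀ x ∈ B, x ∉ inner G (.toBlock v B) := fun x hx h =>
      notMem_block_of_mem_inner_kappa hc hb hp hv h hx
    have hslide : Slide G Q₁ (insert u (Q₁.erase v)) := by
      refine slide_insert_erase (h1.indep hQ) h3 (adj_of_mem_block hb hB hvB hu hvu)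
        fun y hy huy => ?_
      by_contra hyv
      by_cases hyi : y ∈ inner G (.toCut B u)
      · have hyB := mem_block_of_adj_base hc hb hp hyi huy
        exact hBQ y hyB ((h2 y (hnin y hyB) hyv).1 hy)
      · exact hfree y hyi huy
          ((h2 y (fun h => hyi (inner_kappa_subset hc hb hp hv h)) hyv).1 hy)
    refine ⟨_, h1.tail hslide, fun x hx hxu => ?_, by simp [Arc.base],
      ValLE.toCut_of_agree_off hc hb hp hvB ?_ fun _ => ?_⟩
    · have hxu : x ≠ u := hxu
      have hxv : x ≠ v := fun h => hx (h ▸ mem_inner_of_mem_block hb hB hu hvB hvu)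
      simp [hxu, hxv, h2 x (fun h => hx (inner_kappa_subset hc hb hp hv h)) hxv]
    · intro y hy hyB
      have hyu : y ≠ u := fun h => hyB (h ▸ hu)
      have hyv : y ≠ v := fun h => hyB (h ▸ hvB)
      simp [hyu, hyv, h2 y hy hyv]
    · refine h4.trans (ValLE.of_agree hc hb hvarc fun x hx => ?_)
      have hxu : x ≠ u := fun h => hnin u hu (h ▸ hx)
      have hxv : x ≠ v := fun h => hnin v hvB (h ▸ hx)
      simp [hxu, hxv]
  · simp only [Finset.mem_inter, Finset.mem_erase] at hs
    have hslide : Slide G Q (insert u (Q.erase s)) := by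
      refine slide_insert_erase hQ hs.2 (adj_of_mem_block hb hB hs.1.2 hu hs.1.1) fun y hy huy => ?_
      by_cases hyi : y ∈ inner G (.toCut B u)
      · exact eq_of_mem_block_of_indep hc hb hB hQ (mem_block_of_adj_base hc hb hp hyi huy)
          hs.1.2 hy hs.2
      · exact absurd hy (hfree y hyi huy)
    refine ⟨_, .single hslide, fun x hx hxu => ?_, by simp [Arc.base],
      ValLE.toCut_of_agree hc hb hp fun x hx hxB => ?_⟩
    · have hxu : x ≠ u := hxu
      have hxs : x ≠ s := fun h => hx (h ▸ mem_inner_of_mem_block hb hB hu hs.1.2 hs.1.1)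
      simp [hxu, hxs]
    · have hxu : x ≠ u := fun h => hxB (h ▸ hu)
      have hxs : x ≠ s := fun h => hxB (h ▸ hs.1.2)
      simp [hxu, hxs]

/-- A branch that is not open has a token next to the base. -/
theorem exists_mem_block_of_not_open {B Q : Finset V} {u : V} (hp : .toCut B u ∈ treeArcs G)
    (hQ : G.IsIndepSet (Q : Set V)) (h : ¬ Open G (.toCut B u) Q) :
    ∃ t ∈ B, t ≠ u ∧ t ∈ Q := by
  obtain ⟨h1, h2⟩ := (not_open_iff hc hb hp hQ).1 h
  rw [capOn_toCut hc hb hp, uaNum_of_ua h2] at h1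
  have h3 := sum_capOn_nonneg hc hb hp hQ
  obtain ⟨t, ht⟩ := Finset.card_pos.1 (show 0 < (B.erase u ∩ Q).card by omega)
  simp only [Finset.mem_inter, Finset.mem_erase] at ht
  exact ⟨t, ht.1.2, ht.1.1, ht.2⟩

/-- Moving a token from a full branch `(B₁, u)` to `u`, after freeing the other neighbours. -/
theorem exists_move_to_cut {u : V} {B₁ Q : Finset V} (h₁ : .toCut B₁ u ∈ treeArcs G)
    (hQ : G.IsIndepSet (Q : Set V)) (huQ : u ∉ Q) (hcl : ¬ Open G (.toCut B₁ u) Q)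
    (K : Finset (Finset V)) (hK : ∀ D ∈ K, .toCut D u ∈ treeArcs G) (hBK : B₁ ∉ K)
    (hop : ∀ D ∈ K, Open G (.toCut D u) Q)
    (hfree : ∀ D, .toCut D u ∈ treeArcs G → D ≠ B₁ → D ∉ K → ∀ y ∈ D, y ∉ Q) :
    ∃ Q', Reachable G Q Q' ∧ u ∈ Q' ∧
      (∀ x, (∀ D ∈ K, x ∉ inner G (.toCut D u)) → x ∉ inner G (.toCut B₁ u) → x ≠ u →
        (x ∈ Q' ↔ x ∈ Q)) ∧
      ValLE G (.toCut B₁ u) Q Q' ∧ ∀ D ∈ K, ValLE G (.toCut D u) Q Q' := by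
  obtain ⟨t, htB, htu, htQ⟩ := exists_mem_block_of_not_open hc hb h₁ hQ hcl
  obtain ⟨Q₁, h1, h2, h3, h4⟩ := exists_clear_many hc hb hQ huQ K hK
    (fun D hD => (canClear_and_canAbsorb hc hb (hK D hD)).1) hop
  have hB₁ : B₁ ∈ blocks G Finset.univ := h₁.2.1
  have hu : u ∈ B₁ := h₁.2.2
  have hin : ∀ x ∈ inner G (.toCut B₁ u), x ∈ Q₁ ↔ x ∈ Q := fun x hx =>
    h2 x fun D hD => notMem_inner_of_ne hc hb h₁ (hK D hD) (fun h => hBK (h ▸ hD)) hx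
  have hti := mem_inner_of_mem_block hb hB₁ hu htB htu
  have hslide : Slide G Q₁ (insert u (Q₁.erase t)) := by
    refine slide_insert_erase (h1.indep hQ) ((hin t hti).2 htQ)
      (adj_of_mem_block hb hB₁ htB hu htu) fun y hy huy => ?_
    obtain ⟨D, hD, hyD, hyi⟩ := exists_toCut_of_adj hc hb h₁.1 huy
    by_cases hDB : D = B₁
    · subst hDB
      exact eq_of_mem_block_of_indep hc hb hB₁ hQ hyD htB ((hin y hyi).1 hy) htQ
    · by_cases hDK : D ∈ K
      · exact absurd hy (h3 D hDK y hyi huy)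
      · refine absurd ((h2 y fun D' hD' => notMem_inner_of_ne hc hb hD (hK D' hD')
          (fun h => hDK (h ▸ hD')) hyi).1 hy) (hfree D hD hDB hDK y hyD)
  refine ⟨_, h1.tail hslide, by simp, fun x hxK hxi hxu => ?_,
    ValLE.toCut_of_agree hc hb h₁ fun x hx hxB => ?_, fun D hD => (h4 D hD).1.trans
      (ValLE.of_agree hc hb (hK D hD) fun x hx => ?_)⟩
  · have hxt : x ≠ t := fun h => hxi (h ▸ hti)
    simp [hxu, hxt, h2 x hxK]
  · have hxu : x ≠ u := fun h => hxB (h ▸ hu)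
    have hxt : x ≠ t := fun h => hxB (h ▸ htB)
    simp [hxu, hxt, hin x hx]
  · have hxu : x ≠ u := fun h => base_notMem_inner (G := G) (.toCut D u) (h ▸ hx)
    have hxt : x ≠ t := fun h => notMem_inner_of_ne hc hb (hK D hD) h₁ (fun h => hBK (h ▸ hD))
      hx (h ▸ hti)
    simp [hxu, hxt]

/-- A change of load shows that `u` is occupied in some reachable set, so at most one branch is
closed. If there is a closed branch, the other branches are cleared and its token moves to `u`. If
all are open, a branch with smaller load in `D` emits after the others have been cleared. -/
theorem canEmit_toBlock {B : Finset V} {u : V} (hp : .toBlock u B ∈ treeArcs G)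
    (ih : ∀ B' ∈ beta G u B, CanEmit G (.toCut B' u)) : CanEmit G (.toBlock u B) := by
  rintro Q hQ huQ hfree hmax ⟨D, hD, hload⟩
  have huQ : u ∉ Q := huQ
  have hB : B ∈ blocks G Finset.univ := hp.2.1
  have hu : u ∈ B := hp.2.2
  have hfree : ∀ x ∉ inner G (.toBlock u B), G.Adj u x → x ∉ Q := hfree
  have harc : ∀ D ∈ beta G u B, .toCut D u ∈ treeArcs G := fun D hD =>
    toCut_mem_of_beta hc hb hp hD
  have hbeta : ∀ D, .toCut D u ∈ treeArcs G → D ∉ beta G u B → D = B := by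
    intro D hD hDb
    by_contra hne
    exact hDb ((mem_beta hc hb hp).2 ⟨hD.2.1, hD.2.2, hne⟩)
  have hBQ : ∀ y ∈ B, y ∉ Q := by
    intro y hy hyQ
    have hyu : y ≠ u := fun h => huQ (h ▸ hyQ)
    exact hfree y (fun h => notMem_block_of_mem_inner_toBlock hb hB hu h hy)
      (adj_of_mem_block hb hB hu hy hyu.symm) hyQ
  have hmaxD : ∀ D ∈ beta G u B, IsMax G (.toCut D u) Q := fun D hD q hq => hmax q (.beta hD hq)
  by_cases hex : ∃ B₁ ∈ beta G u B, ¬ Open G (.toCut B₁ u) Q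
  · obtain ⟨B₁, hB₁, hcl⟩ := hex
    obtain ⟨E, hE, huE⟩ := exists_base_mem_of_load_ne hc hb hp hD hload.ne
    have hop : ∀ D ∈ (beta G u B).erase B₁, Open G (.toCut D u) Q := by
      intro D hD
      rw [Finset.mem_erase] at hD
      by_contra hcl'
      exact (notMem_of_two_closed hc hb (harc B₁ hB₁) (harc D hD.2) hD.1.symm hQ hcl hcl'
        (fun D => (hmaxD B₁ hB₁).val_le) (fun D' => (hmaxD D hD.2).val_le) hE).1 huE
    obtain ⟨Q', h1, h2, h3, h4, h5⟩ := exists_move_to_cut hc hb (harc B₁ hB₁) hQ huQ hcl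
      ((beta G u B).erase B₁) (fun D hD => harc D (Finset.mem_of_mem_erase hD)) (by simp) hop
      (fun D hD hne hDK => by
        rw [hbeta D hD fun h => hDK (Finset.mem_erase.2 ⟨hne, h⟩)]
        exact hBQ)
    have hout : ∀ x ∉ inner G (.toBlock u B), x ≠ u → (x ∈ Q' ↔ x ∈ Q) := fun x hx hxu =>
      h3 x (fun D hD h => hx (inner_beta_subset hc hb hp (Finset.mem_of_mem_erase hD) h))
        (fun h => hx (inner_beta_subset hc hb hp hB₁ h)) hxu
    refine ⟨Q', h1, hout, h2, ValLE.toBlock (fun D hD => ?_) ?_⟩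
    · by_cases hne : D = B₁
      · exact hne ▸ h4
      · exact h5 D (Finset.mem_erase.2 ⟨hne, hD⟩)
    -- The closed branch makes the capacity 0 before the move. Afterwards `u` is occupied and `ua(u,
    -- B)` is true, so the capacity is at least 1 and makes up for the token that left.
    · have hQ' := h1.indep hQ
      have h6 := load_eq_add_one_of_reachable (p := .toBlock u B) h1.symm
        (fun x hx hxu => (hout x hx hxu).symm) h2 huQ
      have h7 := capOn_toBlock_of_not_open hc hb hp hQ hB₁ hcl
      have h8 := uaNum_le_capOn hc hb hp hQ' h2
      rw [uaNum_of_ua ((ua_toBlock_iff hc hb hp).2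
        ⟨B₁, hB₁, ((not_open_iff hc hb (harc B₁ hB₁) hQ).1 hcl).2⟩)] at h8
      unfold val
      omega
  · push Not at hex
    rw [load_toBlock hc hb hp, load_toBlock hc hb hp] at hload
    obtain ⟨B₂, hB₂, hlt⟩ := Finset.exists_lt_of_sum_lt hload
    have hKmem : ∀ D ∈ (beta G u B).erase B₂, D ≠ B₂ ∧ D ∈ beta G u B := fun D hD =>
      Finset.mem_erase.1 hD
    obtain ⟨Q₁, h1, h2, h3, h4⟩ := exists_clear_many hc hb hQ huQ ((beta G u B).erase B₂)
      (fun D hD => harc D (hKmem D hD).2)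
      (fun D hD => (canClear_and_canAbsorb hc hb (harc D (hKmem D hD).2)).1)
      (fun D hD => hex D (hKmem D hD).2)
    have huQ₁ : u ∉ Q₁ := by
      rw [h2 u fun D _ => base_notMem_inner (.toCut D u)]
      exact huQ
    have hin : ∀ x ∈ inner G (.toCut B₂ u), x ∈ Q₁ ↔ x ∈ Q := fun x hx =>
      h2 x fun D hD => notMem_inner_of_ne hc hb (harc B₂ hB₂) (harc D (hKmem D hD).2)
        (hKmem D hD).1.symm hx
    obtain ⟨Q₂, h1', h2', h3', h4'⟩ := ih B₂ hB₂ Q₁ (h1.indep hQ) huQ₁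
      (fun x hx hux => by
        have hux : G.Adj u x := hux
        obtain ⟨D, hD, hxD, hxi⟩ := exists_toCut_of_adj hc hb hp.1 hux
        by_cases hDb : D ∈ beta G u B
        · have hne : D ≠ B₂ := by
            rintro rfl
            exact hx hxi
          exact h3 D (Finset.mem_erase.2 ⟨hne, hDb⟩) x hxi hux
        · rw [h2 x fun D' hD' => notMem_inner_of_ne hc hb hD (harc D' (hKmem D' hD').2)
            (fun h => hDb (h ▸ (hKmem D' hD').2)) hxi]
          exact hBQ x (hbeta D hD hDb ▸ hxD))
      ((hmaxD B₂ hB₂).of_valLE h1 (ValLE.of_agree hc hb (harc B₂ hB₂) hin))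
      ⟨D, h1.symm.trans hD, by
        rw [load_congr hin]
        exact hlt⟩
    have hQ₂ := h1'.indep (h1.indep hQ)
    have hle : ∀ D ∈ beta G u B, ValLE G (.toCut D u) Q Q₂ := by
      intro D hD
      by_cases hne : D = B₂
      · subst hne
        exact (ValLE.of_agree hc hb (harc D hD) hin).trans h4'
      · refine (h4 D (Finset.mem_erase.2 ⟨hne, hD⟩)).1.trans
          (ValLE.of_agree hc hb (harc D hD) fun x hx => h2' x ?_ ?_)
        · exact notMem_inner_of_ne hc hb (harc D hD) (harc B₂ hB₂) hne hx
        · exact fun h => base_notMem_inner (G := G) (.toCut D u) (h ▸ hx)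
    refine ⟨Q₂, h1.trans h1', fun x hx hxu => ?_, h3', ValLE.toBlock hle ?_⟩
    · exact (h2' x (fun h => hx (inner_beta_subset hc hb hp hB₂ h)) hxu).trans
        (h2 x fun D hD h => hx (inner_beta_subset hc hb hp (hKmem D hD).2 h))
    · exact val_toBlock_le_of_open hc hb hp hex
        (fun D hD => open_of_base_mem hc hb (harc D hD) hQ₂ h3') fun D hD => (hle D hD).val_le

theorem canEmit {p : Arc V} (hp : p ∈ treeArcs G) : CanEmit G p := by
  suffices H : ∀ p ∈ treeArcs G, CanEmit G p from H p hp
  exact treeArcs_induction hc hb (fun B u hp ih => canEmit_toCut hc hb hp ih)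
    (fun u B hp ih => canEmit_toBlock hc hb hp ih)

/-- A maximal configuration of `G[p]` can be combined with any reachable configuration of the
rest. -/
theorem exists_glue {p : Arc V} (hp : p ∈ treeArcs G) {Q D : Finset V}
    (hQ : G.IsIndepSet (Q : Set V)) (hmax : IsMax G p Q) (hD : Reachable G Q D) :
    ∃ E, Reachable G Q E ∧ (∀ x ∉ inner G p, x ∈ E ↔ x ∈ D) ∧ ValLE G p Q E := by
  induction hD with
  | refl => exact ⟨Q, .refl, fun _ _ => Iff.rfl, ValLE.refl _ _⟩
  | @tail D D' hD h ih =>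
    obtain ⟨E, hE, hED, hle⟩ := ih
    rcases h.cases with rfl | ⟨v, w, hv, hw, hvw, hD', hwfree⟩
    · exact ⟨E, hE, hED, hle⟩
    have hEi := hE.indep hQ
    have hload : load G p E = load G p D := load_eq_of_reachable ((Reachable.symm hD).trans hE) hED
    -- Since `D` and `E` have equal loads at `p`, this comparison of values yields lower bounds for
    -- the capacity of `E`, which permit the reactions below.
    have hval : val G p D' ≤ val G p E := (hmax.val_le (hD.tail h)).trans hle.val_le
    have hmaxE := hmax.of_valLE hE hle
    have hbase := base_notMem_inner (G := G) p
    have hmem : ∀ x, x ∈ D' ↔ x = w ∨ (x ≠ v ∧ x ∈ D) := fun x => by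
      rw [hD', Finset.mem_insert, Finset.mem_erase]
    -- A slide inside is ignored, a slide to the base is imitated by emitting, and a slide from the
    -- base into `G[p]` by absorbing. A slide outside is copied, after clearing if its target is the
    -- base.
    by_cases hvi : v ∈ inner G p <;> by_cases hwi : w ∈ inner G p
    · refine ⟨E, hE, fun x hx => ?_, hle⟩
      have h1 : x ≠ v := fun h => hx (h ▸ hvi)
      have h2 : x ≠ w := fun h => hx (h ▸ hwi)
      rw [hED x hx, hmem]
      simp [h1, h2]
    · obtain rfl := eq_base_of_adj hc hb hp hvi hwi hvw
      have hl := load_eq_add_one_of_reachable (p := p) (Reachable.symm (.single h)) (fun x hx hxb => by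
        have h1 : x ≠ v := fun h => hx (h ▸ hvi)
        rw [hmem]
        simp [h1, hxb]) (by rw [hmem]; exact Or.inl rfl) hw
      obtain ⟨E', h1, h2, h3, h4⟩ := canEmit hc hb hp E hEi (fun h => hw ((hED _ hbase).1 h))
        (fun x hx hbx hxE => by
          have := hwfree x ((hED x hx).1 hxE) hbx
          exact hx (this ▸ hvi))
        hmaxE ⟨D', (Reachable.symm hE |>.trans hD).tail h, by omega⟩
      refine ⟨E', hE.trans h1, fun x hx => ?_, hle.trans h4⟩
      by_cases hxb : x = p.base
      · rw [hmem]
        simp [hxb, h3]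
      · have h5 : x ≠ v := fun h => hx (h ▸ hvi)
        rw [h2 x hx hxb, hED x hx, hmem]
        simp [h5, hxb]
    · obtain rfl := eq_base_of_adj hc hb hp hwi hvi hvw.symm
      have hvD' : p.base ∉ D' := by
        rw [hmem]
        simp [hvw.ne]
      have hl := load_eq_add_one_of_reachable (p := p) (.single h) (fun x hx hxb => by
        have h1 : x ≠ w := fun h => hx (h ▸ hwi)
        rw [hmem]
        simp [h1, hxb]) hv hvD'
      -- Entering raises the load of `D'` by one while its capacity is nonnegative. As its value is
      -- at most that of `E`, the set `E` has capacity at least 1 and can absorb.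
      have hcap := capOn_nonneg hc hb hp h.2.1
      obtain ⟨E', h1, h2, h3, h4⟩ := (canClear_and_canAbsorb hc hb hp).2 E hEi
        ((hED _ hbase).2 hv) (by unfold val at hval; omega)
      refine ⟨E', hE.trans h1, fun x hx => ?_, hle.trans h4⟩
      by_cases hxb : x = p.base
      · subst hxb
        exact iff_of_false h3 hvD'
      · have h5 : x ≠ w := fun h => hx (h ▸ hwi)
        rw [h2 x hx hxb, hED x hx, hmem]
        simp [h5, hxb]
    · have hl : load G p D' = load G p D := by
        refine load_congr fun x hx => ?_
        have h1 : x ≠ v := fun h => hvi (h ▸ hx)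
        have h2 : x ≠ w := fun h => hwi (h ▸ hx)
        rw [hmem]
        simp [h1, h2]
      obtain ⟨E₁, h1, h2, h3, h4⟩ : ∃ E₁, Reachable G E E₁ ∧
          (∀ x ∉ inner G p, x ∈ E₁ ↔ x ∈ E) ∧ (∀ x ∈ inner G p, G.Adj w x → x ∉ E₁) ∧
          ValLE G p E E₁ := by
        by_cases hwb : w = p.base
        · subst hwb
          refine (canClear_and_canAbsorb hc hb hp).1 E hEi (fun h => hw ((hED _ hbase).1 h)) ?_
          -- The base is occupied in `D'` and the loads agree, so the capacity of `E` is at least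
          -- that of `D'`, hence at least 1 when `ua` holds.
          intro hua
          have h5 := uaNum_le_capOn hc hb hp h.2.1 (show p.base ∈ D' by rw [hmem]; exact Or.inl rfl)
          rw [uaNum_of_ua hua] at h5
          unfold val at hval
          omega
        · refine ⟨E, .refl, fun _ _ => Iff.rfl, fun x hx hwx _ => ?_, ValLE.refl _ _⟩
          exact hwb (eq_base_of_adj hc hb hp hx hwi hwx.symm)
      have hslide : Slide G E₁ (insert w (E₁.erase v)) := by
        refine slide_insert_erase (h1.indep hEi) ?_ hvw fun y hy hwy => ?_
        · rw [h2 v hvi, hED v hvi]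
          exact hv
        · by_cases hyi : y ∈ inner G p
          · exact absurd hy (h3 y hyi hwy)
          · rw [h2 y hyi, hED y hyi] at hy
            exact hwfree y hy hwy
      refine ⟨_, (hE.trans h1).tail hslide, fun x hx => ?_, (hle.trans h4).trans
        (ValLE.of_agree hc hb hp fun x hx => ?_)⟩
      · rw [hmem, Finset.mem_insert, Finset.mem_erase, h2 x hx, hED x hx]
      · have h5 : x ≠ v := fun h => hvi (h ▸ hx)
        have h6 : x ≠ w := fun h => hwi (h ▸ hx)
        simp [h5, h6]

end Gluing

end TokenSliding

namespace TokenSliding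

/-! ### The potentials are the least nonnegative solution of the update inequalities. -/

section Potentials

variable {V : Type*} [DecidableEq V] [Fintype V] {G : SimpleGraph V}

theorem isPot_iff {C : Finset V} {p : Arc V} {x : ℤ} : IsPot G C p x ↔
    (∃ C', Reachable G C C' ∧ x = val G p C' - load G p C) ∧
      ∀ C', Reachable G C C' → val G p C' - load G p C ≤ x := by
  have key : ∀ C', cap G p (p.verts G ∩ C') + (((p.verts G ∩ C').erase p.base).card : ℤ)
      - (((p.verts G ∩ C).erase p.base).card : ℤ) = val G p C' - load G p C := by
    intro C'
    simp only [val, capOn, load, inner, Finset.erase_inter]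
  simp only [IsPot, IsGreatest, upperBounds, potSet, Set.mem_ofPred_eq, key]
  refine and_congr_right fun _ => ⟨fun h C' hC' => h ⟨C', hC', rfl⟩, ?_⟩
  rintro h _ ⟨C', hC', rfl⟩
  exact h C' hC'

theorem exists_val_max (p : Arc V) (C : Finset V) :
    ∃ D, Reachable G C D ∧ ∀ D', Reachable G C D' → val G p D' ≤ val G p D := by
  obtain ⟨D, hD, h⟩ := Set.exists_max_image {D | Reachable G C D} (val G p) (Set.toFinite _)
    ⟨C, .refl⟩
  exact ⟨D, hD, h⟩

theorem exists_isPot (p : Arc V) (C : Finset V) : ∃ x, IsPot G C p x := by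
  obtain ⟨D, hD, h⟩ := exists_val_max (G := G) p C
  exact ⟨_, isPot_iff.2 ⟨⟨D, hD, rfl⟩, fun C' hC' => sub_le_sub_right (h C' hC') _⟩⟩

theorem IsMax.eq_of_isPot {C E : Finset V} {p : Arc V} {x : ℤ} (h : IsMax G p E)
    (hE : Reachable G C E) (hx : IsPot G C p x) : x = val G p E - load G p C := by
  obtain ⟨⟨C', hC', rfl⟩, hle⟩ := isPot_iff.1 hx
  have h1 := hle E hE
  have h2 := h.val_le (hE.symm.trans hC')
  omega

/-- `y` does not increase in any update of the fixed-point iteration. -/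
structure Closed (G : SimpleGraph V) (C : Finset V) (y : Arc V → ℤ) : Prop where
  toCut : ∀ B u, .toCut B u ∈ treeArcs G →
    (∑ v ∈ kappa G B u, y (.toBlock v B)) + uaNum G (.toCut B u) - ((B.erase u ∩ C).card : ℤ) ≤
      y (.toCut B u)
  toBlock : ∀ u B, .toBlock u B ∈ treeArcs G →
    (∀ B₁ B₂, .toCut B₁ u ∈ treeArcs G → .toCut B₂ u ∈ treeArcs G →
      y (.toCut B₁ u) = 0 → ua G (.toCut B₁ u) → y (.toCut B₂ u) = 0 → ua G (.toCut B₂ u) →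
      B₁ = B₂) →
    (∑ B' ∈ beta G u B, (y (.toCut B' u) - uaNum G (.toCut B' u))) + uaNum G (.toBlock u B) ≤
      y (.toBlock u B)

variable (hc : G.Connected) (hb : IsBlockGraph G)
include hc hb

/-- The branches are glued in one after another. They are disjoint, so a later step leaves the
earlier ones untouched, and loads do not change because the outside and the total are preserved. -/
theorem exists_glue_many {C D : Finset V} (hC : G.IsIndepSet (C : Set V))
    (hD : Reachable G C D) (K : Finset (Arc V)) (hK : ∀ p ∈ K, p ∈ treeArcs G)
    (hdisj : (K : Set (Arc V)).PairwiseDisjoint (inner G))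
    (hmax : ∀ p ∈ K, ∃ Q, Reachable G C Q ∧ IsMax G p Q) :
    ∃ E, Reachable G C E ∧ (∀ x, (∀ p ∈ K, x ∉ inner G p) → (x ∈ E ↔ x ∈ D)) ∧
      ∀ p ∈ K, IsMax G p E ∧ load G p E = load G p D := by
  classical
  induction K using Finset.induction_on with
  | empty => exact ⟨D, hD, by simp, by simp⟩
  | insert p K hpK ih =>
    obtain ⟨E, hE, hED, hEK⟩ := ih (fun q hq => hK q (Finset.mem_insert_of_mem hq))
      (hdisj.subset (by simp)) (fun q hq => hmax q (Finset.mem_insert_of_mem hq))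
    have hp := hK p (Finset.mem_insert_self p K)
    obtain ⟨Q, hQ, hQmax⟩ := hmax p (Finset.mem_insert_self p K)
    obtain ⟨E', hE', hout, hle⟩ := exists_glue hc hb hp (hQ.indep hC) hQmax (hQ.symm.trans hE)
    have hnot : ∀ q ∈ K, ∀ x ∈ inner G q, x ∉ inner G p := fun q hq x hx hx' =>
      Finset.disjoint_left.1 (hdisj (Finset.mem_coe.2 (Finset.mem_insert_of_mem hq))
        (Finset.mem_coe.2 (Finset.mem_insert_self p K)) fun h => hpK (h ▸ hq)) hx hx'
    have hEE' : Reachable G E E' := hE.symm.trans (hQ.trans hE')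
    refine ⟨E', hQ.trans hE', fun x hx => ?_, fun q hq => ?_⟩
    · rw [Finset.forall_mem_insert] at hx
      exact (hout x hx.1).trans (hED x hx.2)
    · rcases Finset.mem_insert.1 hq with rfl | hq
      · exact ⟨hQmax.of_valLE hE' hle, (load_eq_of_reachable hEE' hout).trans
          (load_congr fun x hx => hED x fun q' hq' h => hnot q' hq' x h hx)⟩
      · have hag : ∀ x ∈ inner G q, x ∈ E' ↔ x ∈ E := fun x hx => hout x (hnot q hq x hx)
        exact ⟨(hEK q hq).1.of_valLE hEE' (ValLE.of_agree hc hb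
          (hK q (Finset.mem_insert_of_mem hq)) hag), (load_congr hag).trans (hEK q hq).2⟩

theorem exists_isMax_kappa {C : Finset V} (hC : G.IsIndepSet (C : Set V)) {B : Finset V} {u : V}
    (hp : .toCut B u ∈ treeArcs G)
    (ih : ∀ v ∈ kappa G B u, ∃ Q, Reachable G C Q ∧ IsMax G (.toBlock v B) Q) :
    ∃ E, Reachable G C E ∧ ∀ v ∈ kappa G B u, IsMax G (.toBlock v B) E := by
  classical
  obtain ⟨E, hE, -, hEK⟩ := exists_glue_many hc hb hC (D := C) .refl
    ((kappa G B u).image fun v => Arc.toBlock v B)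
    (by simpa using fun v hv => toBlock_mem_of_kappa hc hb hp hv)
    (by
      rw [Finset.coe_image]
      rintro _ ⟨v, hv, rfl⟩ _ ⟨v', hv', rfl⟩ hne
      exact pairwiseDisjoint_kappa hc hb hp hv hv' fun h => hne (h ▸ rfl))
    (by simpa using ih)
  exact ⟨E, hE, fun v hv => (hEK _ (Finset.mem_image_of_mem _ hv)).1⟩

/-- All branches at `u` in a set `K` of blocks can be made maximal at the same time. -/
theorem exists_isMax_blocks {C D : Finset V} (hC : G.IsIndepSet (C : Set V))
    (hD : Reachable G C D) {u : V} (K : Finset (Finset V))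
    (hK : ∀ B ∈ K, .toCut B u ∈ treeArcs G)
    (ih : ∀ B ∈ K, ∃ Q, Reachable G C Q ∧ IsMax G (.toCut B u) Q) :
    ∃ E, Reachable G C E ∧ ∀ B ∈ K, IsMax G (.toCut B u) E ∧
      load G (.toCut B u) E = load G (.toCut B u) D := by
  classical
  obtain ⟨E, hE, -, hEK⟩ := exists_glue_many hc hb hC hD (K.image fun B => Arc.toCut B u)
    (by simpa using hK)
    (by
      rw [Finset.coe_image]
      rintro _ ⟨D, hD, rfl⟩ _ ⟨D', hD', rfl⟩ hne
      exact pairwiseDisjoint_blocks hc hb u (hK D hD).2 (hK D' hD').2 fun h => hne (h ▸ rfl))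
    (by simpa using ih)
  exact ⟨E, hE, fun v hv => hEK _ (Finset.mem_image_of_mem _ hv)⟩

/-- For `(u, B)`, a set `D` of maximal value is replaced by a glued set `E` with optimal branches
and the same loads. If all branches are open in `D`, their capacities in `E` are at least as large,
and the values compare termwise. If one is closed in `D`, the value of `D` is a mere load and cannot
exceed that of `E`. -/
theorem exists_isMax {C : Finset V} (hC : G.IsIndepSet (C : Set V)) {p : Arc V}
    (hp : p ∈ treeArcs G) : ∃ Q, Reachable G C Q ∧ IsMax G p Q := by
  suffices H : ∀ p ∈ treeArcs G, ∃ Q, Reachable G C Q ∧ IsMax G p Q from H p hp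
  refine treeArcs_induction hc hb (fun B u hp ih => ?_) (fun u B hp ih => ?_)
  · obtain ⟨E, hE, hmax⟩ := exists_isMax_kappa hc hb hC hp ih
    refine ⟨E, hE, fun q hq D hD => ?_⟩
    cases hq with
    | refl =>
      rw [val_toCut hc hb hp, val_toCut hc hb hp]
      have := Finset.sum_le_sum fun v hv => (hmax v hv).val_le hD
      omega
    | kappa hv hq => exact hmax _ hv q hq D hD
  · obtain ⟨D, hD, hDmax⟩ := exists_val_max (G := G) (.toBlock u B) C
    obtain ⟨E, hE, hmax⟩ := exists_isMax_blocks hc hb hC hD (beta G u B)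
      (fun D hD => toCut_mem_of_beta hc hb hp hD) ih
    have hDi := hD.indep hC
    refine ⟨E, hE, fun q hq D' hD' => ?_⟩
    cases hq with
    | refl =>
      refine (hDmax D' (hE.trans hD')).trans ?_
      have hle : ∀ B' ∈ beta G u B, val G (.toCut B' u) D ≤ val G (.toCut B' u) E :=
        fun B' hB' => (hmax B' hB').1.val_le (hE.symm.trans hD)
      by_cases hop : ∀ B' ∈ beta G u B, Open G (.toCut B' u) D
      · refine val_toBlock_le_of_open hc hb hp hop (fun B' hB' => (hop B' hB').mono ?_) hle
        have h1 := hle B' hB'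
        have h2 := (hmax B' hB').2
        unfold val at h1
        omega
      · push Not at hop
        obtain ⟨B', hB', hcl⟩ := hop
        have h1 := load_le_val hc hb hp (hE.indep hC)
        rw [load_toBlock hc hb hp, Finset.sum_congr rfl fun B' hB' => (hmax B' hB').2,
          ← load_toBlock hc hb hp] at h1
        rw [val, capOn_toBlock_of_not_open hc hb hp hDi hB' hcl]
        omega
    | beta hB' hq => exact (hmax _ hB').1 q hq D' hD'

theorem pot_nonneg {C : Finset V} (hC : G.IsIndepSet (C : Set V)) {p : Arc V}
    (hp : p ∈ treeArcs G) {x : ℤ} (hx : IsPot G C p x) : 0 ≤ x := by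
  have h1 := (isPot_iff.1 hx).2 C .refl
  have h2 := load_le_val hc hb hp hC
  omega

theorem pot_le_card {C : Finset V} (hC : G.IsIndepSet (C : Set V)) {p : Arc V}
    (hp : p ∈ treeArcs G) {x : ℤ} (hx : IsPot G C p x) : x ≤ Fintype.card V := by
  obtain ⟨⟨C', hC', rfl⟩, -⟩ := isPot_iff.1 hx
  have h1 := val_le hc hb hp (hC'.indep hC)
  have h2 := load_nonneg (G := G) p C
  have h3 : ((inner G p).card : ℤ) ≤ Fintype.card V := by exact_mod_cast Finset.card_le_univ _
  omega

/-- The potentials are a fixed point. -/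
theorem closed_of_isPot {C : Finset V} (hC : G.IsIndepSet (C : Set V)) {F : Arc V → ℤ}
    (hF : ∀ p ∈ treeArcs G, IsPot G C p (F p)) : Closed G C F := by
  classical
  constructor
  · intro B u hp
    obtain ⟨E, hE, hmax⟩ := exists_isMax_kappa hc hb hC hp fun v hv =>
      exists_isMax hc hb hC (toBlock_mem_of_kappa hc hb hp hv)
    have h1 := (isPot_iff.1 (hF _ hp)).2 E hE
    rw [Finset.sum_congr rfl fun v hv =>
      (hmax v hv).eq_of_isPot hE (hF _ (toBlock_mem_of_kappa hc hb hp hv)),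
      Finset.sum_sub_distrib]
    rw [val_toCut hc hb hp, load_toCut hc hb hp] at h1
    omega
  · intro u B hp hzero
    -- All blocks through `u` are optimised, including `B`. The hypothesis on zeros concerns them
    -- all, and `B` must also be cleared when a token moves to `u`.
    set K := (blocks G Finset.univ).filter (u ∈ ·) with hKdef
    have hK : ∀ D, D ∈ K ↔ .toCut D u ∈ treeArcs G := by
      intro D
      rw [hKdef, Finset.mem_filter, mem_treeArcs_toCut]
      exact ⟨fun h => ⟨hp.1, h⟩, fun h => h.2⟩
    have hβK : ∀ D ∈ beta G u B, D ∈ K := fun D hD =>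
      (hK D).2 (toCut_mem_of_beta hc hb hp hD)
    obtain ⟨E, hE, hmax⟩ := exists_isMax_blocks hc hb hC (D := C) .refl K
      (fun D hD => (hK D).1 hD) fun D hD => exists_isMax hc hb hC ((hK D).1 hD)
    have hEi := hE.indep hC
    have hFD : ∀ D ∈ K, F (.toCut D u) = val G (.toCut D u) E - load G (.toCut D u) C :=
      fun D hD => (hmax D hD).1.eq_of_isPot hE (hF _ ((hK D).1 hD))
    -- Each branch has the same load in `E` as in `C`, so its potential equals its capacity in `E`.
    -- A closed branch thus has potential zero with true `ua`, and the hypothesis allows only one.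
    have huniq : ∀ B₁ ∈ K, ∀ B₂ ∈ K, ¬ Open G (.toCut B₁ u) E → ¬ Open G (.toCut B₂ u) E →
        B₁ = B₂ := by
      intro B₁ h₁ B₂ h₂ hcl₁ hcl₂
      have hz : ∀ D ∈ K, ¬ Open G (.toCut D u) E → F (.toCut D u) = 0 ∧ ua G (.toCut D u) := by
        intro D hD hcl
        obtain ⟨h3, h4⟩ := (not_open_iff hc hb ((hK D).1 hD) hEi).1 hcl
        refine ⟨?_, h4⟩
        rw [hFD D hD, val, (hmax D hD).2]
        omega
      exact hzero B₁ B₂ ((hK _).1 h₁) ((hK _).1 h₂) (hz B₁ h₁ hcl₁).1 (hz B₁ h₁ hcl₁).2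
        (hz B₂ h₂ hcl₂).1 (hz B₂ h₂ hcl₂).2
    -- If one branch in `β` is closed, moving its token to `u` makes every branch open without
    -- lowering a value.
    obtain ⟨Q, hQ, hop, hle⟩ : ∃ Q, Reachable G C Q ∧ (∀ D ∈ beta G u B, Open G (.toCut D u) Q) ∧
        ∀ D ∈ beta G u B, val G (.toCut D u) E ≤ val G (.toCut D u) Q := by
      by_cases hex : ∃ B₁ ∈ beta G u B, ¬ Open G (.toCut B₁ u) E
      · obtain ⟨B₁, hB₁, hcl⟩ := hex
        have hB₁K := hβK B₁ hB₁
        obtain ⟨Q, h1, h2, -, h3, h4⟩ := exists_move_to_cut hc hb ((hK B₁).1 hB₁K) hEi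
          (fun h => hcl (open_of_base_mem hc hb ((hK B₁).1 hB₁K) hEi h)) hcl (K.erase B₁)
          (fun D hD => (hK D).1 (Finset.mem_of_mem_erase hD)) (by simp)
          (fun D hD => by
            rw [Finset.mem_erase] at hD
            by_contra hcl'
            exact hD.1 (huniq D hD.2 B₁ hB₁K hcl' hcl))
          (fun D hD hne hDK => absurd (Finset.mem_erase.2 ⟨hne, (hK D).2 hD⟩) hDK)
        refine ⟨Q, hE.trans h1, fun D hD => open_of_base_mem hc hb ((hK D).1 (hβK D hD))
          (h1.indep hEi) h2, fun D hD => ?_⟩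
        by_cases hne : D = B₁
        · exact hne ▸ h3.val_le
        · exact (h4 D (Finset.mem_erase.2 ⟨hne, hβK D hD⟩)).val_le
      · push Not at hex
        exact ⟨E, hE, hex, fun D _ => le_rfl⟩
    have h1 := (isPot_iff.1 (hF _ hp)).2 Q hQ
    rw [val_toBlock_of_open hc hb hp hop, load_toBlock hc hb hp] at h1
    have h2 : ∑ D ∈ beta G u B, (F (.toCut D u) - uaNum G (.toCut D u)) ≤
        ∑ D ∈ beta G u B, (val G (.toCut D u) Q - uaNum G (.toCut D u) - load G (.toCut D u) C) := by
      refine Finset.sum_le_sum fun D hD => ?_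
      rw [hFD D (hβK D hD)]
      have := hle D hD
      omega
    simp only [Finset.sum_sub_distrib] at h1 h2 ⊢
    omega

omit hc hb in
theorem inter_eq_empty_of_forall {B C : Finset V} {u : V} (h : ∀ x ∈ B, x ≠ u → x ∉ C) :
    B.erase u ∩ C = ∅ := by
  ext x
  simp only [Finset.mem_inter, Finset.mem_erase, Finset.notMem_empty, iff_false]
  rintro ⟨⟨h1, h2⟩, h3⟩
  exact h x h2 h1 h3

theorem Closed.uaNum_le {C : Finset V} {y : Arc V → ℤ} (hy : Closed G C y)
    (hy0 : ∀ p ∈ treeArcs G, 0 ≤ y p) {B : Finset V} {u : V} (hp : .toCut B u ∈ treeArcs G)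
    (h : ∀ x ∈ B, x ≠ u → x ∉ C) :
    (∑ v ∈ kappa G B u, y (.toBlock v B)) + uaNum G (.toCut B u) ≤ y (.toCut B u) ∧
      uaNum G (.toCut B u) ≤ y (.toCut B u) := by
  have h1 := hy.toCut B u hp
  rw [inter_eq_empty_of_forall h] at h1
  have h2 : 0 ≤ ∑ v ∈ kappa G B u, y (.toBlock v B) :=
    Finset.sum_nonneg fun v hv => hy0 _ (toBlock_mem_of_kappa hc hb hp hv)
  simp only [Finset.card_empty, Nat.cast_zero] at h1
  exact ⟨by omega, by omega⟩

/-- If some branch of `(u, B)` is closed, its capacity is 0 and nonnegativity suffices. If all are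
open, then `y ≥ capacity ≥ 1` on each branch other than `B` with true `ua`. Only `B` can be a
harmful zero, so the second inequality of `Closed` is available. -/
theorem Closed.capOn_le {C : Finset V} {y : Arc V → ℤ} (hy : Closed G C y)
    (hC : G.IsIndepSet (C : Set V)) (hy0 : ∀ p ∈ treeArcs G, 0 ≤ y p) {p : Arc V}
    (hp : p ∈ treeArcs G) : capOn G p C ≤ y p := by
  suffices H : ∀ p ∈ treeArcs G, capOn G p C ≤ y p from H p hp
  refine treeArcs_induction hc hb (fun B u hp ih => ?_) (fun u B hp ih => ?_)
  · refine le_trans ?_ (hy.toCut B u hp)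
    rw [capOn_toCut hc hb hp]
    have := Finset.sum_le_sum ih
    omega
  · by_cases hop : ∀ B' ∈ beta G u B, Open G (.toCut B' u) C
    · have hz : ∀ D, .toCut D u ∈ treeArcs G → y (.toCut D u) = 0 → ua G (.toCut D u) →
          D = B := by
        intro D hD h0 hua
        by_contra hne
        have hDb : D ∈ beta G u B := (mem_beta hc hb hp).2 ⟨hD.2.1, hD.2.2, hne⟩
        have h1 := ih D hDb
        have h2 := hop D hDb hua
        omega
      refine le_trans ?_ (hy.toBlock u B hp fun B₁ B₂ h₁ h₂ hz₁ hu₁ hz₂ hu₂ =>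
        (hz B₁ h₁ hz₁ hu₁).trans (hz B₂ h₂ hz₂ hu₂).symm)
      rw [capOn_toBlock_of_open hc hb hp hop]
      have := Finset.sum_le_sum fun D hD => sub_le_sub_right (ih D hD) (uaNum G (.toCut D u))
      omega
    · push Not at hop
      obtain ⟨B', hB', hcl⟩ := hop
      rw [capOn_toBlock_of_not_open hc hb hp hC hB' hcl]
      exact hy0 _ hp

/-- If a token on the base can slide into `G[p]`, the value of `p` is positive. -/
theorem Closed.one_le {C : Finset V} {y : Arc V → ℤ} (hy : Closed G C y)
    (hC : G.IsIndepSet (C : Set V)) (hy0 : ∀ p ∈ treeArcs G, 0 ≤ y p) {p : Arc V}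
    (hp : p ∈ treeArcs G) {w : V} (hbase : p.base ∈ C) (hwp : w ∈ inner G p)
    (hadj : G.Adj p.base w) (hfree : ∀ x ∈ C, G.Adj w x → x = p.base) : 1 ≤ y p := by
  have hwC : w ∉ C := fun h => hC hbase h hadj.ne hadj
  have hfreev : ∀ D v, .toCut D v ∈ treeArcs G → v ∈ C → ∀ x ∈ D, x ≠ v → x ∉ C :=
    fun D v hD hv x hx hxv hxC => hC hv hxC hxv.symm
      (adj_of_mem_block hb hD.2.1 hD.2.2 hx hxv.symm)
  have hcut : ∀ B v, .toCut B v ∈ treeArcs G → v ∈ C → w ∈ inner G (.toCut B v) → G.Adj v w →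
      (∀ x ∈ C, G.Adj w x → x = v) → 1 ≤ y (.toCut B v) := by
    intro B v hp hv hwi hvw hfree
    have hwB := mem_block_of_adj_base hc hb hp hwi hvw
    obtain ⟨h1, h2⟩ := hy.uaNum_le hc hb hy0 hp (hfreev B v hp hv)
    by_cases hua : ua G (.toCut B v)
    · rwa [uaNum_of_ua hua] at h2
    -- With `ua(B, v)` false, `w` is a cut-vertex with `ua(w, B)` true. No neighbour of `w` except
    -- `v` carries a token, so the blocks at `w` other than `B` are free of tokens apart from `w`.
    -- Their `y` is at least `ua`, which gives `y(w, B) ≥ 1` and then `y(B, v) ≥ 1`.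
    have hua' := hua
    rw [ua_toCut_iff hc hb hp, not_not] at hua
    obtain ⟨hwcut, hwua⟩ := hua w hwB hvw.ne'
    have hwk : w ∈ kappa G B v := (mem_kappa hc hb hp).2 ⟨hwB, hvw.ne', hwcut⟩
    have hwarc := toBlock_mem_of_kappa hc hb hp hwk
    have hD : ∀ D, .toCut D w ∈ treeArcs G → D ≠ B → uaNum G (.toCut D w) ≤ y (.toCut D w) := by
      intro D hD hne
      refine (hy.uaNum_le hc hb hy0 hD fun x hx hxw hxC => hne ?_).2
      have := hfree x hxC (adj_of_mem_block hb hD.2.1 hD.2.2 hx hxw.symm)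
      subst this
      exact block_eq_of_two_mem hb hD.2.1 hp.2.1 hx hp.2.2 hD.2.2 hwB hvw.ne
    have hz : ∀ D, .toCut D w ∈ treeArcs G → y (.toCut D w) = 0 → ua G (.toCut D w) →
        D = B := by
      intro D hDa h0 hua
      by_contra hne
      have := hD D hDa hne
      rw [uaNum_of_ua hua] at this
      omega
    have h3 := hy.toBlock w B hwarc fun B₁ B₂ h₁ h₂ hz₁ hu₁ hz₂ hu₂ =>
      (hz B₁ h₁ hz₁ hu₁).trans (hz B₂ h₂ hz₂ hu₂).symm
    have h4 : 0 ≤ ∑ D ∈ beta G w B, (y (.toCut D w) - uaNum G (.toCut D w)) :=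
      Finset.sum_nonneg fun D hDb => by
        have := hD D (toCut_mem_of_beta hc hb hwarc hDb) ((mem_beta hc hb hwarc).1 hDb).2.2
        omega
    have h5 := Finset.single_le_sum (f := fun v => y (.toBlock v B))
      (fun z hz => hy0 _ (toBlock_mem_of_kappa hc hb hp hz)) hwk
    rw [uaNum_of_ua hwua] at h3
    rw [uaNum_of_not_ua hua'] at h1
    omega
  cases p with
  | toCut B v => exact hcut B v hp hbase hwp hadj hfree
  | toBlock v B =>
    obtain ⟨D, hDb, hwD⟩ := (mem_inner_toBlock_iff' hc hb hp).1 hwp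
    have hDarc := toCut_mem_of_beta hc hb hp hDb
    have h1 := hcut D v hDarc hbase hwD hadj hfree
    have hua : ∀ D, .toCut D v ∈ treeArcs G → uaNum G (.toCut D v) ≤ y (.toCut D v) :=
      fun D hD => (hy.uaNum_le hc hb hy0 hD (hfreev D v hD hbase)).2
    have h2 := hy.toBlock v B hp fun B₁ B₂ h₁ _ hz₁ hu₁ _ _ => by
      have := hua B₁ h₁
      rw [uaNum_of_ua hu₁] at this
      omega
    have h3 := Finset.single_le_sum (f := fun D => y (.toCut D v) - uaNum G (.toCut D v))
      (fun D hD => sub_nonneg.2 (hua D (toCut_mem_of_beta hc hb hp hD))) hDb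
    have h4 := uaNum_nonneg (G := G) (.toBlock v B)
    by_cases huaD : ua G (.toCut D v)
    · rw [uaNum_of_ua ((ua_toBlock_iff hc hb hp).2 ⟨D, hDb, huaD⟩)] at h2
      rw [uaNum_of_ua huaD] at h3
      omega
    · rw [uaNum_of_not_ua huaD] at h3
      omega

/-- A fixed point remains one along a slide, after accounting for the changed loads. -/
theorem Closed.slide {C C' : Finset V} {y : Arc V → ℤ} (hy : Closed G C y)
    (hy0 : ∀ p ∈ treeArcs G, 0 ≤ y p) (h : Slide G C C') :
    Closed G C' (fun p => y p + load G p C - load G p C') ∧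
      ∀ p ∈ treeArcs G, 0 ≤ y p + load G p C - load G p C' := by
  have hC := h.1
  rcases h.cases with rfl | ⟨v, w, hv, hw, hvw, hC', hfree⟩
  · simpa using ⟨hy, hy0⟩
  have hmem : ∀ x, x ∈ C' ↔ x = w ∨ (x ≠ v ∧ x ∈ C) := fun x => by
    rw [hC', Finset.mem_insert, Finset.mem_erase]
  have hocc : ∀ D u, .toCut D u ∈ treeArcs G → u ∈ C → uaNum G (.toCut D u) ≤ y (.toCut D u) :=
    fun D u hD hu => (hy.uaNum_le hc hb hy0 hD fun x hx hxu hxC => hC hu hxC hxu.symm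
      (adj_of_mem_block hb hD.2.1 hD.2.2 hx hxu.symm)).2
  refine ⟨⟨fun B u hp => ?_, fun u B hp hz => ?_⟩, fun p hp => ?_⟩
  -- The load of `(B, u)` is the sum of the loads of its branches plus the tokens in `B` off `u`, so
  -- the shift changes both sides by the same amount.
  · have h1 := hy.toCut B u hp
    rw [load_toCut hc hb hp, load_toCut hc hb hp, Finset.sum_sub_distrib, Finset.sum_add_distrib]
    omega
  -- Two harmful zeros of `y` at `u` would survive the shift. An occupied `u` forces `y ≥ ua` at
  -- each block, so `u` is not in `C`. If `u` were the target of the slide, the moved token would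
  -- have to lie in both blocks. Hence `u` is empty before and after, and no load at `u` changes.
  · have h1 := hy.toBlock u B hp fun B₁ B₂ h₁ h₂ hz₁ hu₁ hz₂ hu₂ => by
      by_contra hne
      have huC : u ∉ C := by
        intro huC
        have := hocc B₁ u h₁ huC
        rw [uaNum_of_ua hu₁] at this
        omega
      have huC' : u ∉ C' := by
        rw [hmem]
        rintro (rfl | h)
        · have key : ∀ D, .toCut D u ∈ treeArcs G → y (.toCut D u) = 0 → ua G (.toCut D u) →
              v ∈ D := by
            intro D hD h0 hua
            by_contra hvD
            have := (hy.uaNum_le hc hb hy0 hD fun x hx hxu hxC => hvD ?_).2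
            · rw [uaNum_of_ua hua] at this
              omega
            · exact hfree x hxC (adj_of_mem_block hb hD.2.1 hD.2.2 hx hxu.symm) ▸ hx
          exact hne (block_eq_of_two_mem hb h₁.2.1 h₂.2.1 h₁.2.2 h₂.2.2 (key B₁ h₁ hz₁ hu₁)
            (key B₂ h₂ hz₂ hu₂) hvw.ne')
        · exact huC h.2
      refine hne (hz B₁ B₂ h₁ h₂ ?_ hu₁ ?_ hu₂)
      · rw [load_eq_of_slide hc hb h₁ h huC huC', hz₁]; ring
      · rw [load_eq_of_slide hc hb h₂ h huC huC', hz₂]; ring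
    have h2 : ∀ D, y (Arc.toCut D u) + load G (.toCut D u) C - load G (.toCut D u) C' -
        uaNum G (.toCut D u) = (y (Arc.toCut D u) - uaNum G (.toCut D u)) +
        (load G (.toCut D u) C - load G (.toCut D u) C') := fun D => by ring
    rw [load_toBlock hc hb hp, load_toBlock hc hb hp]
    simp only [h2]
    simp only [Finset.sum_sub_distrib, Finset.sum_add_distrib] at h1 ⊢
    omega
  · have h0 := hy0 p hp
    -- The shift lowers `y p` only when a token enters `G[p]`. It then comes from the base, and
    -- `Closed.one_le` supplies the missing unit.
    by_cases hwi : w ∈ inner G p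
    · by_cases hvi : v ∈ inner G p
      · rw [load_eq_of_reachable (.single h) fun x hx => ?_]
        · omega
        · have h1 : x ≠ v := fun h => hx (h ▸ hvi)
          have h2 : x ≠ w := fun h => hx (h ▸ hwi)
          rw [hmem]
          simp [h1, h2]
      · obtain rfl := eq_base_of_adj hc hb hp hwi hvi hvw.symm
        have h1 := hy.one_le hc hb hC hy0 hp hv hwi hvw hfree
        rw [load_eq_add_one_of_reachable (.single h) (fun x hx hxb => ?_) hv
          (by rw [hmem]; simp [hvw.ne])]
        · omega
        · have h2 : x ≠ w := fun h => hx (h ▸ hwi)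
          rw [hmem]
          simp [hxb, h2]
    · have : load G p C' ≤ load G p C := by
        unfold load
        norm_cast
        refine Finset.card_le_card fun x hx => ?_
        rw [Finset.mem_inter, hmem] at hx
        rcases hx.2 with rfl | h
        · exact absurd hx.1 hwi
        · exact Finset.mem_inter.2 ⟨hx.1, h.2⟩
      omega

/-- The potentials are the least fixed point. -/
theorem Closed.val_sub_load_le {C C' : Finset V} {y : Arc V → ℤ} (hy : Closed G C y)
    (hC : G.IsIndepSet (C : Set V)) (hy0 : ∀ p ∈ treeArcs G, 0 ≤ y p)
    (h : Reachable G C C') {p : Arc V} (hp : p ∈ treeArcs G) :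
    val G p C' - load G p C ≤ y p := by
  -- The induction peels off the first slide with `y` generalised. The shift of `y` is exactly the
  -- change of the load that is subtracted, so the differences telescope.
  induction h using Relation.ReflTransGen.head_induction_on generalizing y with
  | refl =>
    have := hy.capOn_le hc hb hC hy0 hp
    unfold val
    omega
  | @head C D hs _ ih =>
    obtain ⟨h1, h2⟩ := hy.slide hc hb hy0 hs
    have := ih h1 hs.2.1 h2
    omega

theorem Closed.pot_le {C : Finset V} {y : Arc V → ℤ} (hy : Closed G C y)
    (hC : G.IsIndepSet (C : Set V)) (hy0 : ∀ p ∈ treeArcs G, 0 ≤ y p) {p : Arc V}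
    (hp : p ∈ treeArcs G) {x : ℤ} (hx : IsPot G C p x) : x ≤ y p := by
  obtain ⟨⟨C', hC', rfl⟩, -⟩ := isPot_iff.1 hx
  exact hy.val_sub_load_le hc hb hC hy0 hC' hp

end Potentials

end TokenSliding

namespace TokenSliding

/-! ### Rules for bounding the running time of programs. -/

section Machine

/-- Started in `s`, the command `c` halts after at most `T` steps in a store satisfying `Q`. -/
def Run (c : Cmd) (s : Store) (T : ℕ) (Q : Store → Prop) : Prop :=
  ∃ t s', Exec c s t s' ∧ t ≤ T ∧ Q s'

theorem Run.mono {c : Cmd} {s : Store} {T T' : ℕ} {Q Q' : Store → Prop} (h : Run c s T Q)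
    (hT : T ≤ T') (hQ : ∀ s', Q s' → Q' s') : Run c s T' Q' := by
  obtain ⟨t, s', h1, h2, h3⟩ := h
  exact ⟨t, s', h1, h2.trans hT, hQ s' h3⟩

theorem Run.seq (T T' : ℕ) {c d : Cmd} {s : Store} {T₀ : ℕ} {Q : Store → Prop}
    (hT : T + T' ≤ T₀) (h : Run c s T fun s' => Run d s' T' Q) : Run (.seq c d) s T₀ Q := by
  obtain ⟨t, s', h1, h2, t', s'', h3, h4, h5⟩ := h
  exact ⟨t + t', s'', .seq h1 h3, by omega, h5⟩

theorem Run.when {e : Expr} {c : Cmd} {s : Store} {T : ℕ} {Q : Store → Prop}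
    (h : e.eval s ≠ 0 → Run c s T Q) (h' : e.eval s = 0 → Q s) :
    Run (.when e c) s (e.cost + 2 + if e.eval s = 0 then 0 else T) Q := by
  by_cases he : e.eval s = 0
  · rw [if_pos he]
    exact ⟨_, s, .condFalse he (.skip s), by omega, h' he⟩
  · obtain ⟨t, s', h1, h2, h3⟩ := h he
    rw [if_neg he]
    exact ⟨_, s', .condTrue he h1, by omega, h3⟩

theorem Run.when_le (T : ℕ) {e : Expr} {c : Cmd} {s : Store} {T₀ : ℕ} {Q : Store → Prop}
    (hT : T + (e.cost + 2) ≤ T₀) (h : e.eval s ≠ 0 → Run c s T Q) (h' : e.eval s = 0 → Q s) :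
    Run (.when e c) s T₀ Q :=
  (Run.when h h').mono (by split_ifs <;> omega) fun _ hs => hs

/-- Commands without loops. -/
def Cmd.LoopFree : Cmd → Bool
  | .skip => true
  | .set _ _ => true
  | .put _ _ _ _ => true
  | .seq c d => c.LoopFree && d.LoopFree
  | .cond _ c d => c.LoopFree && d.LoopFree
  | .loop _ _ => false

/-- The final store of a command without loops. -/
def Cmd.result : Cmd → Store → Store
  | .skip, s => s
  | .set x e, s => s.setReg x (e.eval s)
  | .put a e f g, s => s.setArr a (e.eval s) (f.eval s) (g.eval s)
  | .seq c d, s => d.result (c.result s)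
  | .cond e c d, s => if e.eval s = 0 then d.result s else c.result s
  | .loop _ _, s => s

/-- An upper bound for the number of steps of a command without loops. -/
def Cmd.maxCost : Cmd → ℕ
  | .skip => 1
  | .set _ e => e.cost + 1
  | .put _ e f g => e.cost + f.cost + g.cost + 1
  | .seq c d => c.maxCost + d.maxCost
  | .cond e c d => e.cost + 1 + (c.maxCost + d.maxCost)
  | .loop _ _ => 0

/-- Straight-line code is executed by evaluation: its result is a computable store and its cost a
numeral, so correctness reduces to simplification and the time bound to a decision. -/
theorem run_of_loopFree {c : Cmd} {s : Store} {T : ℕ} {Q : Store → Prop}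
    (hc : c.LoopFree = true) (hT : c.maxCost ≤ T) (h : Q (c.result s)) : Run c s T Q := by
  suffices H : ∃ t, Exec c s t (c.result s) ∧ t ≤ c.maxCost by
    obtain ⟨t, h1, h2⟩ := H
    exact ⟨t, _, h1, h2.trans hT, h⟩
  clear h hT
  induction c generalizing s with
  | skip => exact ⟨_, .skip s, le_rfl⟩
  | set x e => exact ⟨_, .set x e s, le_rfl⟩
  | put a e f g => exact ⟨_, .put a e f g s, le_rfl⟩
  | seq c d ihc ihd =>
    simp only [Cmd.LoopFree, Bool.and_eq_true] at hc
    obtain ⟨t, h1, h2⟩ := ihc hc.1 (s := s)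
    obtain ⟨t', h3, h4⟩ := ihd hc.2 (s := c.result s)
    exact ⟨_, .seq h1 h3, by simp only [Cmd.maxCost]; omega⟩
  | cond e c d ihc ihd =>
    simp only [Cmd.LoopFree, Bool.and_eq_true] at hc
    by_cases he : e.eval s = 0
    · obtain ⟨t', h3, h4⟩ := ihd hc.2 (s := s)
      refine ⟨e.cost + 1 + t', ?_, by simp only [Cmd.maxCost]; omega⟩
      simp only [Cmd.result, if_pos he]
      exact .condFalse he h3
    · obtain ⟨t', h3, h4⟩ := ihc hc.1 (s := s)
      refine ⟨e.cost + 1 + t', ?_, by simp only [Cmd.maxCost]; omega⟩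
      simp only [Cmd.result, if_neg he]
      exact .condTrue he h3
  | loop => simp [Cmd.LoopFree] at hc

/-- The number of steps of a `for` loop, where `T k` bounds the `k`-th run of the body. -/
def forCost (N : ℕ) (e : Expr) (T : ℕ → ℕ) : ℕ :=
  (∑ k ∈ Finset.range N, (T k + e.cost + 7)) + e.cost + 5

theorem forCost_le {N : ℕ} {e : Expr} {T : ℕ → ℕ} {t : ℕ} (h : ∀ k < N, T k ≤ t) :
    forCost N e T ≤ N * (t + e.cost + 7) + e.cost + 5 := by
  unfold forCost
  have : ∑ k ∈ Finset.range N, (T k + e.cost + 7) ≤ ∑ _k ∈ Finset.range N, (t + e.cost + 7) :=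
    Finset.sum_le_sum fun k hk => by
      have := h k (Finset.mem_range.1 hk)
      omega
  rw [Finset.sum_const, Finset.card_range, smul_eq_mul] at this
  omega

/-- An invariant rule with a cost for each round. The test costs `e.cost + 3` and the increment 4,
which gives the 7. The initial assignment costs 2 and the last failing test `e.cost + 3`, which
gives the 5. The hypothesis `hx` keeps the body from disturbing the loop variable or the bound. -/
theorem run_for {x : Reg} {e : Expr} {c : Cmd} {s : Store} {N : ℕ} {T : ℕ → ℕ}
    (I : ℕ → Store → Prop) (h0 : I 0 (s.setReg x 0))
    (hx : ∀ k s, k ≤ N → I k s → s.reg x = k ∧ e.eval s = N)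
    (hstep : ∀ k s, k < N → I k s →
      Run c s (T k) fun s' => I (k + 1) (s'.setReg x (s'.reg x + 1))) :
    Run (.for x e c) s (forCost N e T) (I N) := by
  have key : ∀ d k s, k + d = N → I k s →
      Run (.loop (.lt x e) (.list [c, .set x (x + 1)])) s
        ((∑ i ∈ Finset.range d, (T (k + i) + e.cost + 7)) + e.cost + 3) (I N) := by
    intro d
    induction d with
    | zero =>
      intro k s hk hI
      obtain rfl : k = N := by omega
      obtain ⟨h1, h2⟩ := hx k s le_rfl hI
      refine ⟨_, s, .loopFalse ?_, ?_, hI⟩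
      · simp [Expr.eval, h1, h2]
      · simp [Expr.cost]; omega
    | succ d ih =>
      intro k s hk hI
      obtain ⟨h1, h2⟩ := hx k s (by omega) hI
      obtain ⟨t, s', h3, h4, h5⟩ := hstep k s (by omega) hI
      obtain ⟨t', s'', h6, h7, h8⟩ := ih (k + 1) _ (by omega) h5
      have h9 : Exec (.list [c, .set x (x + 1)]) s (t + 4) (s'.setReg x (s'.reg x + 1)) :=
        .seq h3 (.set x (x + 1) s')
      refine ⟨_, s'', .loopTrue ?_ h9 h6, ?_, h8⟩
      · have : (k : ℤ) < N := by omega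
        simp [Expr.eval, h1, h2, this]
      · rw [Finset.sum_range_succ']
        have h10 : ∀ i, T (k + 1 + i) = T (k + (i + 1)) := fun i => by rw [Nat.add_assoc, Nat.add_comm 1 i]
        simp only [h10] at h7
        simp only [Expr.cost, Nat.add_zero]
        omega
  obtain ⟨t, s', h1, h2, h3⟩ := key N 0 _ (by omega) h0
  refine ⟨_, s', .seq (.set x 0 s) h1, ?_, h3⟩
  simp only [Nat.zero_add] at h2
  have : (0 : Expr).cost = 1 := rfl
  unfold forCost
  omega

theorem run_for_const (N T : ℕ) {x : Reg} {e : Expr} {c : Cmd} {s : Store} {T₀ : ℕ}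
    {Q : Store → Prop} (I : ℕ → Store → Prop) (hT : (N + 1) * (T + e.cost + 7) ≤ T₀) (h0 : I 0 (s.setReg x 0))
    (hx : ∀ k s, k ≤ N → I k s → s.reg x = k ∧ e.eval s = N)
    (hstep : ∀ k s, k < N → I k s →
      Run c s T fun s' => I (k + 1) (s'.setReg x (s'.reg x + 1)))
    (hQ : ∀ s, I N s → Q s) : Run (.for x e c) s T₀ Q := by
  refine (run_for (T := fun _ => T) I h0 hx hstep).mono
    ((forCost_le fun _ _ => le_rfl).trans ?_) hQ
  rw [Nat.add_mul] at hT
  omega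

/-- A `for` loop with a loop-free body, with explicit intermediate stores. -/
theorem run_for_states {x : Reg} {e : Expr} {c : Cmd} {s : Store} {N : ℕ} {Q : Store → Prop}
    (T : ℕ) (hc : c.LoopFree = true) (hT : c.maxCost + e.cost + 7 ≤ T) (St : ℕ → Store) (h0 : s.setReg x 0 = St 0)
    (hx : ∀ k, (St k).reg x = k) (he : ∀ k, e.eval (St k) = N)
    (hstep : ∀ k < N, (c.result (St k)).setReg x ((c.result (St k)).reg x + 1) = St (k + 1))
    (hQ : Q (St N)) :
    Run (.for x e c) s ((N + 1) * T) Q := by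
  refine (run_for (T := fun _ => c.maxCost) (fun k s' => s' = St k) h0 ?_ ?_).mono
    ((forCost_le fun _ _ => le_rfl).trans ?_) fun s' h => h ▸ hQ
  · rintro k _ _ rfl
    exact ⟨hx k, he k⟩
  · rintro k _ hk rfl
    exact run_of_loopFree hc le_rfl (hstep k hk)
  · have := Nat.mul_le_mul_left N hT
    rw [Nat.add_mul]
    omega

@[simp] theorem Store.setReg_reg (s : Store) (x y : Reg) (k : ℤ) :
    (s.setReg x k).reg y = if y = x then k else s.reg y := by
  simp [Store.setReg, Function.update_apply]

@[simp] theorem Store.setReg_arr (s : Store) (x : Reg) (k : ℤ) : (s.setReg x k).arr = s.arr := rfl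

@[simp] theorem Store.setArr_reg (s : Store) (a : Arr) (i j k : ℤ) :
    (s.setArr a i j k).reg = s.reg := rfl

@[simp] theorem Store.setArr_arr (s : Store) (a a' : Arr) (i j k i' j' : ℤ) :
    (s.setArr a i j k).arr a' i' j' = if a' = a ∧ i' = i ∧ j' = j then k else s.arr a' i' j' := by
  unfold Store.setArr
  by_cases h1 : a' = a
  · subst h1
    by_cases h2 : i' = i
    · subst h2
      by_cases h3 : j' = j
      · subst h3; simp
      · simp [h3]
    · simp [h2]
  · simp [h1]

theorem Store.ext_reg_arr {s s' : Store} (h : ∀ x, s.reg x = s'.reg x)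
    (h' : ∀ a i j, s.arr a i j = s'.arr a i j) : s = s' := by
  cases s
  cases s'
  simp only [Store.mk.injEq]
  exact ⟨funext h, by funext a i j; exact h' a i j⟩

/-- The store `s` with `a` in the register `z` and `k` in the register `x`. -/
def Store.set2 (s : Store) (z : Reg) (a : ℤ) (x : Reg) (k : ℤ) : Store :=
  (s.setReg z a).setReg x k

theorem Store.set2_reg (s : Store) (z x y : Reg) (a k : ℤ) :
    (s.set2 z a x k).reg y = if y = x then k else if y = z then a else s.reg y := by
  simp [Store.set2]

theorem Store.set2_arr (s : Store) (z x : Reg) (a k : ℤ) : (s.set2 z a x k).arr = s.arr := rfl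

/-- A `for` loop that changes a single register `z` besides the loop variable. -/
theorem run_for_acc {x z : Reg} {e : Expr} {c : Cmd} {s : Store} {N : ℕ} {Q : Store → Prop}
    (T : ℕ) (hc : c.LoopFree = true) (hT : c.maxCost + e.cost + 7 ≤ T) (hxz : x ≠ z) (A : ℕ → ℤ) (h0 : s.reg z = A 0)
    (he : ∀ k, e.eval (s.set2 z (A k) x k) = N)
    (hstep : ∀ k < N, c.result (s.set2 z (A k) x k) = s.set2 z (A (k + 1)) x k)
    (hQ : Q (s.set2 z (A N) x N)) :
    Run (.for x e c) s ((N + 1) * T) Q := by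
  refine run_for_states T hc hT (fun k => s.set2 z (A k) x k) ?_ ?_ he ?_ hQ
  · refine Store.ext_reg_arr (fun y => ?_) fun _ _ _ => rfl
    simp only [Store.setReg_reg, Store.set2_reg]
    split_ifs with h1 h2
    · simp
    · rw [h2, h0]
    · rfl
  · intro k
    simp [Store.set2_reg]
  · intro k hk
    rw [hstep k hk]
    refine Store.ext_reg_arr (fun y => ?_) fun _ _ _ => rfl
    simp only [Store.setReg_reg, Store.set2_reg]
    split_ifs <;> simp_all

theorem Store.set2_setReg {s : Store} {z x : Reg} (h : x ≠ z) (a b k : ℤ) :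
    (s.set2 z a x k).setReg z b = s.set2 z b x k := by
  refine Store.ext_reg_arr (fun y => ?_) fun _ _ _ => rfl
  simp only [Store.setReg_reg, Store.set2_reg]
  split_ifs <;> simp_all

end Machine

/-! ### Partial sums, as accumulated by the loops. -/

section PartialSums

/-- The sum of `f v` over the `v < k`. -/
def psum {n : ℕ} (f : Fin n → ℤ) (k : ℕ) : ℤ :=
  ∑ v ∈ Finset.univ.filter (fun v : Fin n => (v : ℕ) < k), f v

theorem psum_zero {n : ℕ} (f : Fin n → ℤ) : psum f 0 = 0 := by simp [psum]

theorem psum_succ {n : ℕ} (f : Fin n → ℤ) (v : Fin n) : psum f (v + 1) = psum f v + f v := by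
  have : Finset.univ.filter (fun w : Fin n => (w : ℕ) < v + 1) =
      insert v (Finset.univ.filter (fun w : Fin n => (w : ℕ) < v)) := by
    ext w
    simp only [Finset.mem_filter, Finset.mem_univ, true_and, Finset.mem_insert, Fin.ext_iff]
    omega
  rw [psum, this, Finset.sum_insert (by simp), psum, add_comm]

theorem psum_self {n : ℕ} (f : Fin n → ℤ) : psum f n = ∑ v, f v := by
  simp [psum]

end PartialSums

end TokenSliding

namespace TokenSliding

/-! ### Blocks as edges with their common neighbours. -/

section EdgeBlocks

variable {n : ℕ} {G : SimpleGraph (Fin n)}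

open Classical in
/-- The vertices `i`, `j` and their common neighbours. -/
noncomputable def edgeBlock (G : SimpleGraph (Fin n)) (i j : Fin n) : Finset (Fin n) :=
  Finset.univ.filter fun w => w = i ∨ w = j ∨ (G.Adj i w ∧ G.Adj w j)

/-- `ij` is an edge with `i < j`, and `i` and `j` have no common neighbour below `j`. -/
def Leads (G : SimpleGraph (Fin n)) (i j : Fin n) : Prop :=
  i < j ∧ G.Adj i j ∧ ∀ w, w < j → ¬ (G.Adj i w ∧ G.Adj w j)

theorem mem_edgeBlock {i j w : Fin n} :
    w ∈ edgeBlock G i j ↔ w = i ∨ w = j ∨ (G.Adj i w ∧ G.Adj w j) := by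
  simp [edgeBlock]

/-- A common neighbour of `i` and `j` forms a triangle with them. This clique lies in a block that
shares two vertices with `B`, so that block is `B`. -/
theorem edgeBlock_eq (hb : IsBlockGraph G) {B : Finset (Fin n)} (hB : B ∈ blocks G Finset.univ)
    {i j : Fin n} (hi : i ∈ B) (hj : j ∈ B) (hij : i ≠ j) : edgeBlock G i j = B := by
  ext w
  rw [mem_edgeBlock]
  constructor
  · rintro (rfl | rfl | ⟨h1, h2⟩)
    · exact hi
    · exact hj
    · have hclq : G.IsClique (({i, j, w} : Finset (Fin n)) : Set (Fin n)) := by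
        have h3 := adj_of_mem_block hb hB hi hj hij
        intro a ha b hb' hne
        simp only [Finset.coe_insert, Finset.coe_singleton, Set.mem_insert_iff,
          Set.mem_singleton_iff] at ha hb'
        rcases ha with rfl | rfl | rfl <;> rcases hb' with rfl | rfl | rfl <;>
          first | exact absurd rfl hne | assumption | (apply SimpleGraph.Adj.symm; assumption)
      obtain ⟨B', hB', hs⟩ := exists_block_of_isClique ⟨i, by simp⟩ hclq
      rw [block_eq_of_two_mem hb hB hB' hi (hs (by simp)) hj (hs (by simp)) hij]
      exact hs (by simp)
  · intro hw
    by_cases h1 : w = i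
    · exact .inl h1
    by_cases h2 : w = j
    · exact .inr (.inl h2)
    exact .inr (.inr ⟨adj_of_mem_block hb hB hi hw (Ne.symm h1), adj_of_mem_block hb hB hw hj h2⟩)

theorem edgeBlock_mem_blocks (hb : IsBlockGraph G) {i j : Fin n} (h : G.Adj i j) :
    edgeBlock G i j ∈ blocks G Finset.univ := by
  obtain ⟨B, hB, hi, hj⟩ := exists_block_of_adj h
  rwa [edgeBlock_eq hb hB hi hj h.ne]

theorem Leads.le_of_mem {i j w : Fin n} (h : Leads G i j) (hw : w ∈ edgeBlock G i j) :
    w = i ∨ j ≤ w := by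
  rcases mem_edgeBlock.1 hw with h1 | h1 | h1
  · exact .inl h1
  · exact .inr h1.ge
  · exact .inr (not_lt.1 fun h2 => h.2.2 w h2 h1)

/-- The pair consists of the two smallest vertices of its block, so the block determines it. Hence
no block is listed twice. -/
theorem Leads.eq_of_edgeBlock_eq {i j i' j' : Fin n} (h : Leads G i j) (h' : Leads G i' j')
    (he : edgeBlock G i j = edgeBlock G i' j') : i = i' ∧ j = j' := by
  have hi : i ∈ edgeBlock G i' j' := he ▸ mem_edgeBlock.2 (.inl rfl)
  have hi' : i' ∈ edgeBlock G i j := he ▸ mem_edgeBlock.2 (.inl rfl)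
  have hj : j ∈ edgeBlock G i' j' := he ▸ mem_edgeBlock.2 (.inr (.inl rfl))
  have hj' : j' ∈ edgeBlock G i j := he ▸ mem_edgeBlock.2 (.inr (.inl rfl))
  have h1 := h.1
  have h1' := h'.1
  have h2 := h'.le_of_mem hi
  have h2' := h.le_of_mem hi'
  have h3 := h'.le_of_mem hj
  have h3' := h.le_of_mem hj'
  simp only [Fin.ext_iff, Fin.lt_def, Fin.le_def] at *
  omega

/-- The two smallest vertices of the block form the required pair. -/
theorem exists_leads_of_mem_blocks (hb : IsBlockGraph G) {B : Finset (Fin n)}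
    (hB : B ∈ blocks G Finset.univ) {a b : Fin n} (ha : a ∈ B) (hb' : b ∈ B) (hab : a ≠ b) :
    ∃ i j, Leads G i j ∧ edgeBlock G i j = B := by
  have hne : B.Nonempty := ⟨a, ha⟩
  set i := B.min' hne with hi
  have hiB : i ∈ B := B.min'_mem hne
  have hne' : (B.erase i).Nonempty := by
    by_cases h : a = i
    · exact ⟨b, Finset.mem_erase.2 ⟨fun h' => hab (h.trans h'.symm), hb'⟩⟩
    · exact ⟨a, Finset.mem_erase.2 ⟨h, ha⟩⟩
  set j := (B.erase i).min' hne' with hj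
  have hjB := Finset.mem_erase.1 ((B.erase i).min'_mem hne')
  rw [← hj] at hjB
  have heq := edgeBlock_eq hb hB hiB hjB.2 hjB.1.symm
  refine ⟨i, j, ⟨lt_of_le_of_ne (B.min'_le _ hjB.2) hjB.1.symm,
    adj_of_mem_block hb hB hiB hjB.2 hjB.1.symm, fun w hw h => ?_⟩, heq⟩
  have hwB : w ∈ B := heq ▸ mem_edgeBlock.2 (.inr (.inr h))
  exact absurd ((B.erase i).min'_le w (Finset.mem_erase.2 ⟨h.1.ne', hwB⟩)) (not_le.2 hw)

/-- In a connected graph with at least two vertices each vertex has a neighbour, so a one-vertex set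
is never maximal. -/
theorem exists_ne_of_mem_blocks (hc : G.Connected) (hn : n ≠ 1) {B : Finset (Fin n)}
    (hB : B ∈ blocks G Finset.univ) : ∃ a ∈ B, ∃ b ∈ B, a ≠ b := by
  obtain ⟨a, ha⟩ := block_nonempty hB
  by_contra! hall
  have hnt : Nontrivial (Fin n) := by
    have := a.pos
    exact Fin.nontrivial_iff_two_le.2 (by omega)
  obtain ⟨x, hx⟩ := hc.preconnected.exists_adj_of_nontrivial a
  obtain ⟨B', hB', ha', hx'⟩ := exists_block_of_adj hx
  have : B ⊆ B' := fun y hy => (hall a ha y hy) ▸ ha'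
  rw [← block_eq_of_subset hB (mem_blocks_iff.1 hB').2.1 this] at hall
  exact hx.ne (hall a ha' x hx')

theorem mem_blocks_iff_leads (hc : G.Connected) (hb : IsBlockGraph G) {B : Finset (Fin n)} :
    B ∈ blocks G Finset.univ ↔
      (n = 1 ∧ B = Finset.univ) ∨ ∃ i j, Leads G i j ∧ edgeBlock G i j = B := by
  constructor
  · intro hB
    by_cases hn : n = 1
    · subst hn
      obtain ⟨a, ha⟩ := block_nonempty hB
      exact .inl ⟨rfl, Finset.eq_univ_iff_forall.2 fun x => (Subsingleton.elim a x) ▸ ha⟩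
    · obtain ⟨a, ha, b, hb', hab⟩ := exists_ne_of_mem_blocks hc hn hB
      exact .inr (exists_leads_of_mem_blocks hb hB ha hb' hab)
  · rintro (⟨hn, rfl⟩ | ⟨i, j, h, rfl⟩)
    · subst hn
      obtain ⟨B, hB, hs⟩ := exists_block_of_isClique (G := G) (T := {0}) ⟨0, by simp⟩ (by simp)
      have : B = Finset.univ :=
        Finset.eq_univ_iff_forall.2 fun x => (Subsingleton.elim 0 x) ▸ hs (by simp)
      exact this ▸ hB
    · exact edgeBlock_mem_blocks hb h.2.1

end EdgeBlocks

open Reg Arr TokenSliding.Expr in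
/-- The part of `findBlocks` that examines a pair of vertices. -/
def examinePair : Cmd :=
  .when (and (lt i j) (get adj i j)) (.list [
    .set ok 1,
    .for w n (.when (and (lt w j) (and (get adj i w) (get adj w j))) (.set ok 0)),
    .when ok (.list [
      .for w n (.when (or (or (eq w i) (eq w j)) (and (get adj i w) (get adj w j)))
        (.put inB m w 1)),
      .set m (m + 1)])])

@[simp] theorem Expr.eval_zero (s : Store) : (0 : Expr).eval s = 0 := rfl

@[simp] theorem Expr.eval_one (s : Store) : (1 : Expr).eval s = 1 := rfl

theorem exists_lt_succ_iff {n k : ℕ} (hk : k < n) {p : Fin n → Prop} :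
    (∃ w : Fin n, (w : ℕ) < k + 1 ∧ p w) ↔ (∃ w : Fin n, (w : ℕ) < k ∧ p w) ∨ p ⟨k, hk⟩ := by
  constructor
  · rintro ⟨w, h1, h2⟩
    rcases Nat.lt_succ_iff_lt_or_eq.1 h1 with h3 | h3
    · exact .inl ⟨w, h3, h2⟩
    · exact .inr (by rwa [show (⟨k, hk⟩ : Fin n) = w from Fin.ext h3.symm])
  · rintro (⟨w, h1, h2⟩ | h)
    · exact ⟨w, by omega, h2⟩
    · exact ⟨⟨k, hk⟩, Nat.lt_succ_self k, h⟩

/-! ### Correctness and running time of the search for blocks. -/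

section FindBlocks

variable {n : ℕ} {G : SimpleGraph (Fin n)} {C : Finset (Fin n)}

open Classical in
/-- The store lists the blocks of the edges `ij` with `P i j` and `Leads G i j`. -/
structure Listing (G : SimpleGraph (Fin n)) (C : Finset (Fin n)) (P : Fin n → Fin n → Prop)
    (m : ℕ) (blk : ℕ → Finset (Fin n)) (s : Store) : Prop where
  reg_n : s.reg .n = n
  reg_m : s.reg .m = m
  adj : ∀ v w : Fin n, s.arr .adj v w = if G.Adj v w then 1 else 0
  tok : ∀ v : Fin n, s.arr .tok v 0 = if v ∈ C then 1 else 0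
  cut : ∀ v : Fin n, s.arr .cut v 0 = 0
  inB : ∀ (b : ℕ) (v : Fin n), s.arr .inB b v = if b < m ∧ v ∈ blk b then 1 else 0
  inj : ∀ b < m, ∀ b' < m, blk b = blk b' → b = b'
  mem : ∀ B, (∃ b < m, blk b = B) ↔
    (n = 1 ∧ B = Finset.univ) ∨ ∃ i j, P i j ∧ Leads G i j ∧ edgeBlock G i j = B

theorem Listing.congr {P P' : Fin n → Fin n → Prop} {m : ℕ} {blk : ℕ → Finset (Fin n)}
    {s s' : Store} (h : Listing G C P m blk s) (hn : s'.reg .n = s.reg .n)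
    (hm : s'.reg .m = s.reg .m) (harr : s'.arr = s.arr)
    (hP : ∀ i j, Leads G i j → (P' i j ↔ P i j)) : Listing G C P' m blk s' where
  reg_n := hn.trans h.reg_n
  reg_m := hm.trans h.reg_m
  adj := by rw [harr]; exact h.adj
  tok := by rw [harr]; exact h.tok
  cut := by rw [harr]; exact h.cut
  inB := by rw [harr]; exact h.inB
  inj := h.inj
  mem := fun B => by
    rw [h.mem]
    refine or_congr_right (exists_congr fun i => exists_congr fun j => ?_)
    constructor
    · rintro ⟨h1, h2, h3⟩; exact ⟨(hP i j h2).2 h1, h2, h3⟩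
    · rintro ⟨h1, h2, h3⟩; exact ⟨(hP i j h2).1 h1, h2, h3⟩

/-- The added block is new because a leading pair is determined by its block and `ij` has not been
visited. The special block for `n = 1` cannot interfere, as `i < j` needs two vertices. -/
theorem Listing.snoc {P P' : Fin n → Fin n → Prop} {m : ℕ} {blk : ℕ → Finset (Fin n)}
    {s s' : Store} (h : Listing G C P m blk s) {i j : Fin n} (hij : Leads G i j) (hnP : ¬ P i j)
    (hP : ∀ a b, P' a b ↔ P a b ∨ (a = i ∧ b = j)) (hn : s'.reg .n = s.reg .n)
    (hm : s'.reg .m = m + 1) (harr : ∀ a, a ≠ .inB → s'.arr a = s.arr a)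
    (hinB : ∀ (b : ℕ) (v : Fin n), s'.arr .inB b v =
      if b = m ∧ v ∈ edgeBlock G i j then 1 else s.arr .inB b v) :
    Listing G C P' (m + 1) (fun b => if b = m then edgeBlock G i j else blk b) s' where
  reg_n := hn.trans h.reg_n
  reg_m := by rw [hm]; push_cast; rfl
  adj := by rw [harr _ (by decide)]; exact h.adj
  tok := by rw [harr _ (by decide)]; exact h.tok
  cut := by rw [harr _ (by decide)]; exact h.cut
  inB := fun b v => by
    rw [hinB, h.inB]
    by_cases h1 : b = m
    · subst h1; simp
    · have : b < m + 1 ↔ b < m := by omega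
      simp [h1, this]
  inj := by
    have key : ∀ b < m, blk b ≠ edgeBlock G i j := by
      intro b hb he
      rcases (h.mem _).1 ⟨b, hb, he⟩ with ⟨h1, -⟩ | ⟨a, c, h1, h2, h3⟩
      · have := hij.1
        omega
      · obtain ⟨rfl, rfl⟩ := h2.eq_of_edgeBlock_eq hij h3
        exact hnP h1
    intro b hb b' hb' he
    by_cases h1 : b = m <;> by_cases h2 : b' = m
    · omega
    · simp only [h1, h2, if_true, if_false] at he
      exact absurd he.symm (key b' (by omega))
    · simp only [h1, h2, if_true, if_false] at he
      exact absurd he (key b (by omega))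
    · simp only [h1, h2, if_false] at he
      exact h.inj b (by omega) b' (by omega) he
  mem := fun B => by
    constructor
    · rintro ⟨b, hb, he⟩
      by_cases h1 : b = m
      · simp only [h1, if_true] at he
        exact .inr ⟨i, j, (hP i j).2 (.inr ⟨rfl, rfl⟩), hij, he⟩
      · simp only [h1, if_false] at he
        rcases (h.mem B).1 ⟨b, by omega, he⟩ with h2 | ⟨a, c, h2, h3⟩
        · exact .inl h2
        · exact .inr ⟨a, c, (hP a c).2 (.inl h2), h3⟩
    · have old : (∃ b < m, blk b = B) →
          ∃ b < m + 1, (if b = m then edgeBlock G i j else blk b) = B := by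
        rintro ⟨b, hb, he⟩
        exact ⟨b, by omega, by rw [if_neg (by omega)]; exact he⟩
      rintro (h2 | ⟨a, c, h2, h3, h4⟩)
      · exact old ((h.mem B).2 (.inl h2))
      · rcases (hP a c).1 h2 with h5 | ⟨rfl, rfl⟩
        · exact old ((h.mem B).2 (.inr ⟨a, c, h5, h3, h4⟩))
        · exact ⟨m, by omega, by simpa using h4⟩

open Classical in
theorem run_examinePair {P P' : Fin n → Fin n → Prop} {m : ℕ} {blk : ℕ → Finset (Fin n)}
    {s : Store} (h : Listing G C P m blk s) {i j : Fin n} (hnP : ¬ P i j)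
    (hP : ∀ a b, P' a b ↔ P a b ∨ (a = i ∧ b = j)) (hi : s.reg .i = i) (hj : s.reg .j = j) :
    Run examinePair s (80 * (n + 1)) fun s' =>
      (∃ m' blk', Listing G C P' m' blk' s') ∧ s'.reg .i = i ∧ s'.reg .j = j := by
  have hcond : ∀ s' : Store, s'.reg .i = i → s'.reg .j = j → s'.arr = s.arr →
      ((Expr.and (.lt (.reg .i) (.reg .j)) (.get .adj (.reg .i) (.reg .j))).eval s' ≠ 0 ↔ i < j ∧ G.Adj i j) := by
    intro s' h1 h2 h3
    simp [Expr.eval, h1, h2, h3, h.adj]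
  unfold examinePair
  refine Run.when_le (72 * (n + 1)) (by simp only [Expr.cost]; omega) (fun he => ?_) fun he => ?_
  · obtain ⟨hlt, hadj⟩ := (hcond s hi hj rfl).1 he
    refine Run.seq 2 (70 * (n + 1)) (by omega) (run_of_loopFree rfl (by decide) ?_)
    set s₁ : Store := s.setReg .ok 1 with hs₁
    have hs1i : s₁.reg .i = i := by simp [hs₁, hi]
    have hs1j : s₁.reg .j = j := by simp [hs₁, hj]
    have hs1n : s₁.reg .n = n := by simp [hs₁, h.reg_n]
    change Run _ s₁ _ _
    have hadjA : ∀ (v w : Fin n), s₁.arr .adj v w = if G.Adj v w then 1 else 0 := h.adj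
    refine Run.seq ((n + 1) * 25) (45 * (n + 1)) (by omega) (run_for_acc (z := .ok) 25 rfl
      (by decide) (by decide)
      (fun k => if ∃ w : Fin n, (w : ℕ) < k ∧ w < j ∧ G.Adj i w ∧ G.Adj w j then 0 else 1)
      ?_ ?_ ?_ ?_)
    · simp [hs₁]
    · intro k
      simp [Expr.eval, Store.set2_reg, hs1n]
    · intro k hk
      have e1 := hadjA i ⟨k, hk⟩
      have e2 := hadjA ⟨k, hk⟩ j
      simp only at e1 e2
      have hsucc : (∃ w : Fin n, (w : ℕ) < k + 1 ∧ w < j ∧ G.Adj i w ∧ G.Adj w j) ↔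
          ((∃ w : Fin n, (w : ℕ) < k ∧ w < j ∧ G.Adj i w ∧ G.Adj w j) ∨
            (k < (j : ℕ) ∧ G.Adj i ⟨k, hk⟩ ∧ G.Adj ⟨k, hk⟩ j)) := exists_lt_succ_iff hk
      have heval : (Expr.and (.lt (.reg .w) (.reg .j))
          (.and (.get .adj (.reg .i) (.reg .w)) (.get .adj (.reg .w) (.reg .j)))).eval
            (s₁.set2 .ok (if ∃ w : Fin n, (w : ℕ) < k ∧ w < j ∧ G.Adj i w ∧ G.Adj w j
              then 0 else 1) .w k) =
          if k < (j : ℕ) ∧ G.Adj i ⟨k, hk⟩ ∧ G.Adj ⟨k, hk⟩ j then 1 else 0 := by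
        simp [Expr.eval, Store.set2_reg, Store.set2_arr, hs1i, hs1j, e1, e2]
      simp only [Cmd.result, Cmd.when, heval, Expr.eval_zero, Store.set2_setReg (show Reg.w ≠ Reg.ok by decide), hsucc]
      by_cases h1 : k < (j : ℕ) ∧ G.Adj i ⟨k, hk⟩ ∧ G.Adj ⟨k, hk⟩ j <;> simp [h1]
    · set t : Store := s₁.set2 .ok (if ∃ w : Fin n, (w : ℕ) < n ∧ w < j ∧ G.Adj i w ∧ G.Adj w j
        then 0 else 1) .w n with ht
      have hti : t.reg .i = i := by simp [ht, Store.set2_reg, hs1i]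
      have htj : t.reg .j = j := by simp [ht, Store.set2_reg, hs1j]
      have htn : t.reg .n = n := by simp [ht, Store.set2_reg, hs1n]
      have htm : t.reg .m = m := by simp [ht, Store.set2_reg, hs₁, h.reg_m]
      have htl : Listing G C P m blk t :=
        h.congr (by rw [htn, h.reg_n]) (by rw [htm, h.reg_m]) rfl fun _ _ _ => Iff.rfl
      have htok : t.reg .ok = if Leads G i j then 1 else 0 := by
        have : Leads G i j ↔ ¬ ∃ w : Fin n, (w : ℕ) < n ∧ w < j ∧ G.Adj i w ∧ G.Adj w j := by
          simp [Leads, hlt, hadj]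
        simp only [ht, Store.set2_reg, this, reduceCtorEq, if_false, if_true]
        by_cases h1 : ∃ w : Fin n, (w : ℕ) < n ∧ w < j ∧ G.Adj i w ∧ G.Adj w j
        · rw [if_pos h1, if_neg (not_not.2 h1)]
        · rw [if_neg h1, if_pos h1]
      refine Run.when_le (42 * (n + 1)) (by simp only [Expr.cost]; omega) (fun hok => ?_)
        fun hok => ?_
      · have hl : Leads G i j := by
          by_contra hl
          exact hok (by simp [Expr.eval, htok, hl])
        -- The intermediate store after `k` rounds is written down explicitly: row `m` of `inB` is
        -- marked at those members of the new block that are below `k`.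
        refine Run.seq ((n + 1) * 30) 4 (by omega) (run_for_states 30 rfl (by decide)
          (fun k => ⟨(t.setReg .w k).reg, fun a x y => if a = .inB ∧ x = m ∧
            (∃ w : Fin n, (w : ℕ) < k ∧ y = w ∧ w ∈ edgeBlock G i j) then 1 else t.arr a x y⟩)
          ?_ ?_ ?_ ?_ ?_)
        · refine Store.ext_reg_arr (fun y => by simp) fun a x y => by simp
        · intro k
          simp
        · intro k
          simp [Expr.eval, htn]
        · intro k hk
          have e1 := htl.adj i ⟨k, hk⟩
          have e2 := htl.adj ⟨k, hk⟩ j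
          simp only at e1 e2
          set t' : Store := ⟨(t.setReg .w k).reg, fun a x y => if a = .inB ∧ x = m ∧
            (∃ w : Fin n, (w : ℕ) < k ∧ y = w ∧ w ∈ edgeBlock G i j) then 1 else t.arr a x y⟩
            with ht'
          have hr : t'.reg = (t.setReg .w k).reg := rfl
          have ha : ∀ x y, t'.arr .adj x y = t.arr .adj x y := fun x y => by simp [ht']
          have hmem : (⟨k, hk⟩ : Fin n) ∈ edgeBlock G i j ↔ (k = (i : ℕ) ∨ k = (j : ℕ)) ∨
              (G.Adj i ⟨k, hk⟩ ∧ G.Adj ⟨k, hk⟩ j) := by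
            simp only [mem_edgeBlock, Fin.ext_iff, or_assoc]
          have heval : (Expr.or (.or (.eq (.reg .w) (.reg .i)) (.eq (.reg .w) (.reg .j)))
              (.and (.get .adj (.reg .i) (.reg .w)) (.get .adj (.reg .w) (.reg .j)))).eval t' =
              if (⟨k, hk⟩ : Fin n) ∈ edgeBlock G i j then 1 else 0 := by
            simp only [hmem]
            by_cases h1 : k = (i : ℕ) <;> simp [Expr.eval, hr, ha, hti, htj, e1, e2, h1]
          have hput : (Cmd.put .inB (.reg .m) (.reg .w) 1).result t' = t'.setArr .inB m k 1 := by
            simp [Cmd.result, Expr.eval, hr, htm]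
          have hsucc : ∀ y : ℤ, (∃ w : Fin n, (w : ℕ) < k + 1 ∧ y = w ∧ w ∈ edgeBlock G i j) ↔
              ((∃ w : Fin n, (w : ℕ) < k ∧ y = w ∧ w ∈ edgeBlock G i j) ∨
                (y = k ∧ ⟨k, hk⟩ ∈ edgeBlock G i j)) := fun y => exists_lt_succ_iff hk
          refine Store.ext_reg_arr (fun y => ?_) fun a x y => ?_
          · simp only [Cmd.when, Cmd.result, heval]
            split_ifs <;> simp [Cmd.result, hr, Expr.eval] <;> split_ifs <;> rfl
          · simp only [Cmd.when]
            rw [Cmd.result, heval]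
            by_cases h1 : (⟨k, hk⟩ : Fin n) ∈ edgeBlock G i j
            · rw [if_pos h1, if_neg one_ne_zero, hput]
              simp only [Store.setReg_arr, Store.setArr_arr, hsucc, h1, and_true]
              by_cases h2 : a = .inB <;> by_cases h3 : x = m <;> by_cases h4 : y = k <;>
                simp [h2, h3, h4, ht']
            · rw [if_neg h1, if_pos rfl]
              simp only [Cmd.result, Store.setReg_arr, hsucc, h1, and_false, or_false, ht']
        · refine run_of_loopFree rfl (by decide) ⟨⟨m + 1, _, htl.snoc hl hnP hP ?_ ?_ ?_ ?_⟩, ?_, ?_⟩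
          · simp [Cmd.list, Cmd.result]
          · simp [Cmd.list, Cmd.result, Expr.eval, htm]
          · intro a ha
            simp [Cmd.list, Cmd.result, ha]
          · intro b v
            simp [Cmd.list, Cmd.result, ← Fin.ext_iff]
          · simp [Cmd.list, Cmd.result, hti]
          · simp [Cmd.list, Cmd.result, htj]
      · refine ⟨⟨m, blk, htl.congr rfl rfl rfl fun a b hab => ?_⟩, hti, htj⟩
        rw [hP]
        refine ⟨fun h1 => h1.resolve_right ?_, .inl⟩
        rintro ⟨rfl, rfl⟩
        simp [Expr.eval, htok, hab] at hok
  · refine ⟨⟨m, blk, h.congr rfl rfl rfl fun a b hab => ?_⟩, hi, hj⟩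
    rw [hP]
    refine ⟨fun h1 => h1.resolve_right ?_, .inl⟩
    rintro ⟨rfl, rfl⟩
    exact (hcond s hi hj rfl).2 ⟨hab.1, hab.2.1⟩ he

theorem run_findBlocks (hc : G.Connected) :
    Run findBlocks (inputStore G C) (100 * (n + 1) ^ 3) fun s =>
      ∃ m blk, Listing G C (fun _ _ => True) m blk s := by
  classical
  have hpos : 0 < n := by
    obtain ⟨a⟩ := hc.nonempty
    exact a.pos
  have h0 : ∀ B : Finset (Fin n), ¬ ∃ i j, False ∧ Leads G i j ∧ edgeBlock G i j = B := by
    simp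
  have hadj : ∀ v w : Fin n, (inputStore G C).arr .adj v w = if G.Adj v w then 1 else 0 := by
    intro v w
    simp only [inputStore, Nat.cast_inj, Fin.val_inj]
    by_cases h : G.Adj v w
    · rw [if_pos h, if_pos ⟨v, w, rfl, rfl, h⟩]
    · rw [if_neg h, if_neg]
      rintro ⟨_, _, rfl, rfl, h1⟩
      exact h h1
  have htok : ∀ v : Fin n, (inputStore G C).arr .tok v 0 = if v ∈ C then 1 else 0 := by
    intro v
    simp only [inputStore, Nat.cast_inj, Fin.val_inj]
    by_cases h : v ∈ C
    · rw [if_pos h, if_pos ⟨v, h, rfl, trivial⟩]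
    · rw [if_neg h, if_neg]
      rintro ⟨_, h1, rfl, -⟩
      exact h h1
  -- Two steps go to the initial assignment and eleven to the case `n = 1`. Each loop adds 8 per
  -- round to the cost of its body.
  have hT : 8 + (n + 1) * ((n + 1) * (80 * (n + 1) + 8) + 8) ≤ 100 * (n + 1) ^ 3 - 11 := by
    have h1 : 8 ≤ 8 * (n + 1) := by omega
    have h2 : (n + 1) ≤ (n + 1) ^ 2 := Nat.le_self_pow (by norm_num) _
    have h3 : (n + 1) ^ 2 ≤ (n + 1) ^ 3 := Nat.pow_le_pow_right (by omega) (by norm_num)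
    have h4 : (n + 1) * ((n + 1) * (80 * (n + 1) + 8) + 8) =
      80 * (n + 1) ^ 3 + 8 * (n + 1) ^ 2 + 8 * (n + 1) := by ring
    have h5 : 2 ^ 3 ≤ (n + 1) ^ 3 := Nat.pow_le_pow_left (by omega) 3
    omega
  unfold findBlocks
  refine Run.seq 2 (100 * (n + 1) ^ 3 - 2) (by omega) (run_of_loopFree rfl (by decide) ?_)
  refine Run.seq 11 (100 * (n + 1) ^ 3 - 13) (by omega) (run_of_loopFree rfl (by decide) ?_)
  set t := Cmd.result _ _ with ht
  have hl : ∃ m blk, Listing G C (fun _ _ => False) m blk t := by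
    by_cases hn : n = 1
    · subst hn
      have he : (Expr.eq (.reg .n) 1).eval ((inputStore G C).setReg .m 0) = 1 := by
        simp [Expr.eval, inputStore]
      refine ⟨1, fun _ => Finset.univ, ?_, ?_, ?_, ?_, ?_, ?_, ?_, ?_⟩
      all_goals simp only [ht, Cmd.result, Cmd.when, Cmd.list, Expr.eval_zero, he, Expr.eval_one]
      · simp [inputStore]
      · simp
      · simpa using hadj
      · simpa using htok
      · simp [inputStore]
      · intro b v
        simp [Subsingleton.elim v 0, inputStore]
      · omega
      · intro B
        constructor
        · rintro ⟨b, -, rfl⟩; simp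
        · rintro (⟨-, rfl⟩ | h1)
          · exact ⟨0, by simp, rfl⟩
          · exact absurd h1 (h0 B)
    · have he : (Expr.eq (.reg .n) 1).eval ((inputStore G C).setReg .m 0) = 0 := by
        simp [Expr.eval, inputStore, hn]
      refine ⟨0, fun _ => ∅, ?_, ?_, ?_, ?_, ?_, ?_, ?_, ?_⟩
      all_goals try simp only [ht, Cmd.result, Cmd.when, Cmd.list, Expr.eval_zero, he, Expr.eval_one]
      · simp [inputStore]
      · simp
      · simpa using hadj
      · simpa using htok
      · simp [inputStore]
      · simp [inputStore]
      · omega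
      · simp [hn]
  refine run_for_const n ((n + 1) * (80 * (n + 1) + 8))
    (fun k s => (∃ m blk, Listing G C (fun a _ => (a : ℕ) < k) m blk s) ∧ s.reg .i = k)
    (show (n + 1) * ((n + 1) * (80 * (n + 1) + 8) + 8) ≤ _ by omega) ?_ ?_ ?_ fun s hs => ?_
  · obtain ⟨m, blk, h⟩ := hl
    exact ⟨⟨m, blk, h.congr (by simp) (by simp) rfl (by simp)⟩, by simp⟩
  · rintro k s - ⟨⟨m, blk, h⟩, hi⟩
    exact ⟨hi, h.reg_n⟩
  · rintro k s hk ⟨⟨m, blk, h⟩, hi⟩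
    -- The pairs already examined are those lexicographically before `(k, l)`.
    refine run_for_const n (80 * (n + 1)) (fun l s => (∃ m blk, Listing G C
      (fun a b => (a : ℕ) < k ∨ ((a : ℕ) = k ∧ (b : ℕ) < l)) m blk s) ∧ s.reg .i = k ∧ s.reg .j = l)
      le_rfl ?_ ?_ ?_ fun s hs => ?_
    · exact ⟨⟨m, blk, h.congr (by simp) (by simp) rfl (by simp)⟩, by simpa using hi, by simp⟩
    · rintro l s - ⟨⟨m, blk, h⟩, hi, hj⟩
      exact ⟨hj, h.reg_n⟩
    · rintro l s hl ⟨⟨m, blk, h⟩, hi, hj⟩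
      refine (run_examinePair (i := ⟨k, hk⟩) (j := ⟨l, hl⟩) (P' := fun a b =>
        (a : ℕ) < k ∨ ((a : ℕ) = k ∧ (b : ℕ) < l + 1)) h (by simp)
        (fun a b => ?_) hi hj).mono le_rfl ?_
      · simp only [Fin.ext_iff]
        omega
      · rintro s' ⟨⟨m', blk', h'⟩, hi', hj'⟩
        refine ⟨⟨m', blk', h'.congr (by simp) (by simp) rfl fun _ _ _ => Iff.rfl⟩,
          by simpa using hi', by simp [hj']⟩
    · obtain ⟨⟨m, blk, h⟩, hi, hj⟩ := hs
      refine ⟨⟨m, blk, h.congr (by simp) (by simp) rfl fun a b _ => ?_⟩, by simp [hi]⟩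
      omega
  · obtain ⟨⟨m, blk, h⟩, -⟩ := hs
    exact ⟨m, blk, h.congr rfl rfl rfl (by simp)⟩

end FindBlocks

end TokenSliding

namespace TokenSliding

/-! ### The table of cut-vertices, and loops over the block-tree. -/

section Tables

variable {n m : ℕ} {G : SimpleGraph (Fin n)} {C : Finset (Fin n)} {blk : Fin m → Finset (Fin n)}

/-- A numbering of the blocks of `G` by `0, …, m - 1`. -/
structure Numbering (G : SimpleGraph (Fin n)) (blk : Fin m → Finset (Fin n)) : Prop where
  inj : Function.Injective blk
  mem : ∀ B, B ∈ blocks G Finset.univ ↔ ∃ b, blk b = B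

open Classical in
/-- The store holds the numbering `blk`, the token set `C` and the table of cut-vertices below `k`. -/
structure Table (G : SimpleGraph (Fin n)) (C : Finset (Fin n)) (blk : Fin m → Finset (Fin n))
    (k : ℕ) (s : Store) : Prop where
  reg_n : s.reg .n = n
  reg_m : s.reg .m = m
  tok : ∀ v : Fin n, s.arr .tok v 0 = if v ∈ C then 1 else 0
  inB : ∀ (b : Fin m) (v : Fin n), s.arr .inB b v = if v ∈ blk b then 1 else 0
  cut : ∀ v : Fin n, s.arr .cut v 0 =
    if (v : ℕ) < k ∧ v ∈ cutVerts G Finset.univ then 1 else 0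

theorem Table.congr {k : ℕ} {s s' : Store} (h : Table G C blk k s) (hn : s'.reg .n = s.reg .n)
    (hm : s'.reg .m = s.reg .m) (htok : s'.arr .tok = s.arr .tok)
    (hinB : s'.arr .inB = s.arr .inB) (hcut : s'.arr .cut = s.arr .cut) :
    Table G C blk k s' where
  reg_n := hn.trans h.reg_n
  reg_m := hm.trans h.reg_m
  tok := by rw [htok]; exact h.tok
  inB := by rw [hinB]; exact h.inB
  cut := by rw [hcut]; exact h.cut

theorem Listing.exists_table (hc : G.Connected) (hb : IsBlockGraph G) {m : ℕ}
    {blk : ℕ → Finset (Fin n)} {s : Store} (h : Listing G C (fun _ _ => True) m blk s) :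
    ∃ blk' : Fin m → Finset (Fin n), Numbering G blk' ∧ Table G C blk' 0 s := by
  refine ⟨fun b => blk b, ⟨fun b b' he => Fin.ext (h.inj b b.2 b' b'.2 he), fun B => ?_⟩,
    h.reg_n, h.reg_m, h.tok, fun b v => ?_, fun v => ?_⟩
  · rw [mem_blocks_iff_leads hc hb]
    have := h.mem B
    simp only [true_and] at this
    rw [← this]
    exact ⟨fun ⟨b, hb, he⟩ => ⟨⟨b, hb⟩, he⟩, fun ⟨b, he⟩ => ⟨b, b.2, he⟩⟩
  · rw [h.inB]
    simp
  · rw [h.cut]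
    simp

theorem mem_cutVerts_iff_card (hc : G.Connected) (hb : IsBlockGraph G) (hblk : Numbering G blk)
    {u : Fin n} : u ∈ cutVerts G Finset.univ ↔
      1 < (Finset.univ.filter fun b => u ∈ blk b).card := by
  rw [mem_cutVerts_univ_iff hb hc, Finset.one_lt_card]
  simp only [Finset.mem_filter, Finset.mem_univ, true_and]
  constructor
  · rintro ⟨B, hB, B', hB', hu, hu', hne⟩
    obtain ⟨b, rfl⟩ := (hblk.mem B).1 hB
    obtain ⟨b', rfl⟩ := (hblk.mem B').1 hB'
    exact ⟨b, hu, b', hu', fun h => hne (h ▸ rfl)⟩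
  · rintro ⟨b, hu, b', hu', hne⟩
    exact ⟨blk b, (hblk.mem _).2 ⟨b, rfl⟩, blk b', (hblk.mem _).2 ⟨b', rfl⟩, hu, hu',
      fun h => hne (hblk.inj h)⟩

theorem run_findCutVerts (hc : G.Connected) (hb : IsBlockGraph G) (hblk : Numbering G blk)
    {s : Store} (h : Table G C blk 0 s) :
    Run findCutVerts s (60 * ((n + 1) * (m + 1))) (Table G C blk n) := by
  classical
  unfold findCutVerts
  refine run_for_const n ((m + 1) * 17 + 16) (fun k s => Table G C blk k s ∧ s.reg .u = k)
    ?_ ?_ ?_ ?_ fun s hs => hs.1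
  · have : (Expr.reg .n).cost = 1 := rfl
    rw [this]
    nlinarith
  · exact ⟨h.congr (by simp) (by simp) rfl rfl rfl, by simp⟩
  · rintro k s - ⟨h, hu⟩
    exact ⟨hu, h.reg_n⟩
  · rintro k s hk ⟨h, hu⟩
    set u : Fin n := ⟨k, hk⟩ with hu'
    refine Run.seq 2 ((m + 1) * 17 + 14) (by omega) (run_of_loopFree rfl (by decide) ?_)
    set s₁ : Store := s.setReg .cnt 0 with hs₁
    change Run _ s₁ _ _
    have hr : ∀ x, x ≠ Reg.cnt → s₁.reg x = s.reg x := fun x hx => by simp [hs₁, hx]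
    have hin : ∀ b : Fin m, s₁.arr .inB b k = if u ∈ blk b then 1 else 0 := fun b => h.inB b u
    refine Run.seq ((m + 1) * 17) 14 (by omega) (run_for_acc (z := .cnt) 17 rfl (by decide)
      (by decide) (fun k => psum (fun b => if u ∈ blk b then 1 else 0) k) ?_ ?_ ?_ ?_)
    · simp [hs₁, psum_zero]
    · intro l
      simp [Expr.eval, Store.set2_reg, hr, h.reg_m]
    · intro l hl
      set a := psum (fun b => if u ∈ blk b then (1 : ℤ) else 0) l with ha
      have hs := psum_succ (fun b => if u ∈ blk b then (1 : ℤ) else 0) ⟨l, hl⟩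
      simp only [← ha] at hs
      have heval : (Expr.get .inB (.reg .b) (.reg .u)).eval (s₁.set2 .cnt a .b l) =
          if u ∈ blk ⟨l, hl⟩ then 1 else 0 := by
        have := hin ⟨l, hl⟩
        simp only at this
        simp [Expr.eval, Store.set2_reg, Store.set2_arr, hr, hu, this]
      simp only [Cmd.when, Cmd.result, heval]
      rw [hs]
      by_cases h1 : u ∈ blk ⟨l, hl⟩
      · simp only [h1, if_true, one_ne_zero, if_false]
        rw [Store.set2_setReg (by decide)]
        rfl
      · simp [h1]
    · set t := s₁.set2 .cnt (psum (fun b => if u ∈ blk b then (1 : ℤ) else 0) m) .b m with ht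
      have htu : t.reg .u = u := by simp [ht, Store.set2_reg, hs₁, hu, hu']
      have hcnt : t.reg .cnt = ((Finset.univ.filter fun b => u ∈ blk b).card : ℤ) := by
        simp [ht, Store.set2_reg, psum_self]
      have heval : (Expr.lt 1 (.reg .cnt)).eval t =
          if u ∈ cutVerts G Finset.univ then 1 else 0 := by
        simp only [mem_cutVerts_iff_card hc hb hblk]
        simp [Expr.eval, hcnt]
      refine run_of_loopFree rfl (by decide) ?_
      have hlt : ∀ v : Fin n, (v : ℕ) < k + 1 ↔ (v : ℕ) < k ∨ v = u := by
        intro v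
        rw [Fin.ext_iff]
        simp only [hu']
        omega
      have htt : Table G C blk k t :=
        h.congr (by simp [ht, Store.set2_reg, hs₁]) (by simp [ht, Store.set2_reg, hs₁]) rfl rfl rfl
      simp only [Cmd.list, Cmd.when, Cmd.result, heval]
      by_cases h1 : u ∈ cutVerts G Finset.univ
      · rw [if_pos h1, if_neg one_ne_zero]
        refine ⟨⟨?_, ?_, ?_, ?_, fun v => ?_⟩, ?_⟩
        · simpa using htt.reg_n
        · simpa using htt.reg_m
        · simpa using htt.tok
        · simpa using htt.inB
        · have := htt.cut v
          simp only [hlt]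
          by_cases h2 : v = u
          · subst h2
            simp [Expr.eval, htu, h1]
          · have h3 : (v : ℕ) ≠ (u : ℕ) := fun h4 => h2 (Fin.ext h4)
            simp [Expr.eval, htu, h2, h3, this]
        · simp [htu, hu']
      · rw [if_neg h1, if_pos rfl]
        refine ⟨⟨?_, ?_, ?_, ?_, fun v => ?_⟩, ?_⟩
        · simpa using htt.reg_n
        · simpa using htt.reg_m
        · simpa using htt.tok
        · simpa using htt.inB
        · have := htt.cut v
          simp only [hlt]
          by_cases h2 : v = u
          · subst h2
            simp [this, h1]
          · simp [h2, this]
        · simp [htu, hu']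

/-- The rule for loops over the pairs of a cut-vertex and a block that contains it; `I b u` holds
when the pairs before `(b, u)` have been visited. -/
theorem run_forTreeEdges {body : Cmd} {s : Store} (T : ℕ) (I : ℕ → ℕ → Store → Prop)
    (htab : ∀ b u s, I b u s → Table G C blk n s)
    (hframe : ∀ b u s x k, x = .b ∨ x = .u → I b u s → I b u (s.setReg x k))
    (hbody : ∀ (b : Fin m) (u : Fin n) s, u ∈ blk b → u ∈ cutVerts G Finset.univ → I b u s →
      s.reg .b = b → s.reg .u = u →
      Run body s T fun s' => I b (u + 1) s' ∧ s'.reg .b = b ∧ s'.reg .u = u)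
    (hskip : ∀ (b : Fin m) (u : Fin n) s, ¬ (u ∈ blk b ∧ u ∈ cutVerts G Finset.univ) → I b u s →
      I b (u + 1) s)
    (hnext : ∀ (b : Fin m) s, I b n s → I (b + 1) 0 s) (h0 : I 0 0 s) :
    Run (forTreeEdges body) s (20 * ((m + 1) * (n + 1)) + (∑ b, (blk b).card) * T) (I m 0) := by
  classical
  -- The body is charged only for vertices of the block, not for all `n`. Summed over the blocks
  -- this gives the total block size times `T`, which is linear in the number of edges. Charging all
  -- `m * n` pairs would lose the fourth-power bound.
  have hcost : ∀ b : Fin m, forCost n (.reg .n) (fun k => 9 + if h : k < n then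
      (if (⟨k, h⟩ : Fin n) ∈ blk b then T else 0) else 0) = 17 * n + 6 + (blk b).card * T := by
    intro b
    unfold forCost
    have h1 : ∀ k ∈ Finset.range n, (9 + if h : k < n then
      (if (⟨k, h⟩ : Fin n) ∈ blk b then T else 0) else 0) + (Expr.reg .n).cost + 7 =
      17 + if h : k < n then (if (⟨k, h⟩ : Fin n) ∈ blk b then T else 0) else 0 := fun k _ => by
        simp only [Expr.cost]
        omega
    rw [Finset.sum_congr rfl h1, Finset.sum_add_distrib, Finset.sum_const, Finset.card_range,
      Finset.sum_range]
    simp only [Fin.is_lt, dite_true, Fin.eta, Finset.sum_ite_mem, Finset.univ_inter,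
      Finset.sum_const, Expr.cost, smul_eq_mul]
    ring
  unfold forTreeEdges
  refine (run_for (N := m) (T := fun k => if h : k < m then 17 * n + 6 + (blk ⟨k, h⟩).card * T else 0)
    (fun k s => I k 0 s ∧ s.reg .b = k) ⟨hframe _ _ _ _ _ (.inl rfl) h0, by simp⟩ ?_ ?_).mono ?_
    fun s hs => hs.1
  · rintro k s - ⟨h, hb⟩
    exact ⟨hb, (htab _ _ _ h).reg_m⟩
  · rintro k s hk ⟨h, hb⟩
    rw [dif_pos hk, ← hcost]
    refine (run_for (N := n) (fun l s => I k l s ∧ s.reg .b = k ∧ s.reg .u = l)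
      ⟨hframe _ _ _ _ _ (.inr rfl) h, by simpa using hb, by simp⟩ ?_ ?_).mono le_rfl ?_
    · rintro l s - ⟨h, hb, hu⟩
      exact ⟨hu, (htab _ _ _ h).reg_n⟩
    · rintro l s hl ⟨h, hb, hu⟩
      have ht := htab _ _ _ h
      have heval : (Expr.and (.get .inB (.reg .b) (.reg .u)) (.get .cut (.reg .u) 0)).eval s =
          if (⟨l, hl⟩ : Fin n) ∈ blk ⟨k, hk⟩ ∧ (⟨l, hl⟩ : Fin n) ∈ cutVerts G Finset.univ
          then 1 else 0 := by
        have h1 := ht.inB ⟨k, hk⟩ ⟨l, hl⟩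
        have h2 := ht.cut ⟨l, hl⟩
        simp only at h1 h2
        simp [Expr.eval, hb, hu, h1, h2, hl]
      have hfin : ∀ s', I k (l + 1) s' ∧ s'.reg .b = k ∧ s'.reg .u = l →
          I k (l + 1) (s'.setReg .u (s'.reg .u + 1)) ∧
          (s'.setReg .u (s'.reg .u + 1)).reg .b = k ∧
          (s'.setReg .u (s'.reg .u + 1)).reg .u = ((l + 1 : ℕ) : ℤ) := by
        rintro s' ⟨h1, h2, h3⟩
        exact ⟨hframe _ _ _ _ _ (.inr rfl) h1, by simpa using h2, by simp [h3]⟩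
      refine (Run.when (T := T) (fun he => ?_) fun he => ?_).mono ?_ hfin
      · rw [heval] at he
        have : (⟨l, hl⟩ : Fin n) ∈ blk ⟨k, hk⟩ ∧ (⟨l, hl⟩ : Fin n) ∈ cutVerts G Finset.univ := by
          by_contra h1
          exact he (if_neg h1)
        exact hbody ⟨k, hk⟩ ⟨l, hl⟩ s this.1 this.2 h hb hu
      · rw [heval] at he
        refine ⟨hskip ⟨k, hk⟩ ⟨l, hl⟩ s (fun h1 => ?_) h, hb, hu⟩
        rw [if_pos h1] at he
        exact one_ne_zero he
      · rw [heval, dif_pos hl]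
        have : (Expr.and (.get .inB (.reg .b) (.reg .u)) (.get .cut (.reg .u) 0)).cost = 7 := rfl
        rw [this]
        by_cases h1 : (⟨l, hl⟩ : Fin n) ∈ blk ⟨k, hk⟩ <;> simp [h1]
        split_ifs <;> simp
    · rintro s' ⟨h1, h2, h3⟩
      exact ⟨hframe _ _ _ _ _ (.inl rfl) (hnext ⟨k, hk⟩ s' h1), by simp [h2]⟩
  · unfold forCost
    rw [Finset.sum_range]
    simp only [Fin.is_lt, dite_true, Fin.eta, Finset.sum_add_distrib, Finset.sum_const,
      Finset.card_univ, Fintype.card_fin, ← Finset.sum_mul, Expr.cost, smul_eq_mul]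
    nlinarith

end Tables

end TokenSliding

/-! ### Computation of `ua`. -/

namespace TokenSliding

open Classical in
/-- A `for` loop that sets the register `z` to `a'` when a condition holds at least once. -/
theorem run_for_flag {x z : Reg} {e : Expr} {c : Cmd} {s : Store} {N T₀ : ℕ} {Q : Store → Prop}
    (T : ℕ) (hc : c.LoopFree = true) (hT : c.maxCost + e.cost + 7 ≤ T) (hT₀ : (N + 1) * T ≤ T₀)
    (hxz : x ≠ z) (p : Fin N → Prop) (a a' : ℤ) (h0 : s.reg z = a)
    (he : ∀ (a : ℤ) (k : ℕ), e.eval (s.set2 z a x k) = N)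
    (hstep : ∀ (k : Fin N) (b : ℤ), c.result (s.set2 z b x k) =
      if p k then (s.set2 z b x k).setReg z a' else s.set2 z b x k)
    (hQ : ∀ r, ((∃ k, p k) → r = a') → ((¬ ∃ k, p k) → r = a) → Q (s.set2 z r x N)) :
    Run (.for x e c) s T₀ Q := by
  refine (run_for_acc T hc hT hxz (fun k => if ∃ w : Fin N, (w : ℕ) < k ∧ p w then a' else a)
    (by simp [h0]) (fun k => he _ k) (fun k hk => ?_)
    (hQ _ (fun h => by simp [h]) fun h => by simp only [Fin.is_lt, true_and]; rw [if_neg h])).mono hT₀ fun _ hs => hs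
  have h1 := hstep ⟨k, hk⟩ (if ∃ w : Fin N, (w : ℕ) < k ∧ p w then a' else a)
  simp only at h1
  rw [h1, Store.set2_setReg hxz]
  simp only [exists_lt_succ_iff hk]
  by_cases h2 : p ⟨k, hk⟩ <;> simp [h2]

open Reg Arr TokenSliding.Expr in
/-- The part of `computeUa` that updates the values of `(B, u)` and `(u, B)`. -/
def updateUa : Cmd :=
  .list [
    .set all 1,
    .for v n (.when (and (get inB b v) (not (eq v u)))
      (.when (not (and (get cut v 0) (get uaVB v b))) (.set all 0))),
    .put uaBV b u (not all),
    .set some 0,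
    .for c m (.when (and (get inB c u) (not (eq c b)))
      (.when (get uaBV c u) (.set some 1))),
    .put uaVB u b some]

section ComputeUa

variable {n m : ℕ} {G : SimpleGraph (Fin n)} {C : Finset (Fin n)} {blk : Fin m → Finset (Fin n)}

open Classical in
theorem run_updateUa {s : Store} (h : Table G C blk n s) {b : Fin m} {u : Fin n}
    (hb : s.reg .b = b) (hu : s.reg .u = u) :
    Run updateUa s (50 * (n + 1) + 50 * (m + 1)) fun s' =>
      Table G C blk n s' ∧ s'.reg .b = b ∧ s'.reg .u = u ∧ s'.reg .r = s.reg .r ∧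
      (∀ (c : Fin m) (v : Fin n), (c ≠ b ∨ v ≠ u) →
        s'.arr .uaBV c v = s.arr .uaBV c v ∧ s'.arr .uaVB v c = s.arr .uaVB v c) ∧
      (s'.arr .uaBV b u = if ∀ v ∈ blk b, v ≠ u → v ∈ cutVerts G Finset.univ ∧
        s.arr .uaVB v b ≠ 0 then 0 else 1) ∧
      (s'.arr .uaVB u b = if ∃ c ≠ b, u ∈ blk c ∧ s.arr .uaBV c u ≠ 0 then 1 else 0) := by
  unfold updateUa
  refine Run.seq 2 (50 * (n + 1) + 50 * (m + 1) - 2) (by omega)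
    (run_of_loopFree rfl (by decide) ?_)
  set s₀ : Store := s.setReg .all 1 with hs₀
  have hr₀ : ∀ x, x ≠ Reg.all → s₀.reg x = s.reg x := fun x hx => by simp [hs₀, hx]
  change Run _ s₀ _ _
  refine Run.seq (50 * (n + 1) - 20) (50 * (m + 1) + 18) (by omega)
    (run_for_flag (z := .all) 30 rfl (by decide) (by omega) (by decide)
      (fun v => (v ∈ blk b ∧ v ≠ u) ∧ ¬ (v ∈ cutVerts G Finset.univ ∧ s.arr .uaVB v b ≠ 0)) 1 0
      (by simp [hs₀]) (fun a k => by simp [Expr.eval, Store.set2_reg, hr₀, h.reg_n])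
      (fun k a => ?_) ?_)
  · have e1 : (Expr.and (.get .inB (.reg .b) (.reg .v)) (.not (.eq (.reg .v) (.reg .u)))).eval
        (s₀.set2 .all a .v k) = if k ∈ blk b ∧ k ≠ u then 1 else 0 := by
      simp [Expr.eval, Store.set2_reg, Store.set2_arr, hr₀, hb, hu, hs₀, h.inB, Fin.ext_iff]
    have e2 : (Expr.not (.and (.get .cut (.reg .v) 0) (.get .uaVB (.reg .v) (.reg .b)))).eval
        (s₀.set2 .all a .v k) =
        if ¬ (k ∈ cutVerts G Finset.univ ∧ s.arr .uaVB k b ≠ 0) then 1 else 0 := by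
      simp [Expr.eval, Store.set2_reg, Store.set2_arr, hr₀, hb, hu, hs₀, h.cut]
    simp only [Cmd.when, Cmd.result, e1, e2, Expr.eval_zero]
    by_cases h1 : k ∈ blk b ∧ k ≠ u
    · by_cases h2 : ¬ (k ∈ cutVerts G Finset.univ ∧ s.arr .uaVB k b ≠ 0)
      · rw [if_pos h1, if_pos h2, if_neg one_ne_zero, if_neg one_ne_zero, if_pos ⟨h1, h2⟩]
      · rw [if_pos h1, if_neg h2, if_neg one_ne_zero, if_pos rfl, if_neg (fun h => h2 h.2)]
    · rw [if_neg h1, if_pos rfl, if_neg (fun h => h1 h.1)]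
  intro x hx hx'
  set s₁ := s₀.set2 .all x .v (n : ℤ) with hs₁
  have hr₁ : ∀ x, x ≠ Reg.all → x ≠ Reg.v → s₁.reg x = s.reg x := fun x hx hx' => by
    simp [hs₁, Store.set2_reg, hx, hx', hr₀]
  refine Run.seq 6 (50 * (m + 1) + 12) (by omega) (run_of_loopFree rfl (by decide) ?_)
  refine Run.seq 2 (50 * (m + 1) + 10) (by omega) (run_of_loopFree rfl (by decide) ?_)
  set s₂ := Cmd.result _ _ with hs₂
  have hr₂ : ∀ x, x ≠ Reg.all → x ≠ Reg.v → x ≠ Reg.some → s₂.reg x = s.reg x :=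
    fun x hx hx' hx'' => by
    simp [hs₂, Cmd.result, hx'', hr₁ x hx hx']
  have ha₂ : ∀ (a : Arr) (i j : ℤ), s₂.arr a i j =
      if a = .uaBV ∧ i = b ∧ j = u then if x = 0 then 1 else 0 else s.arr a i j := by
    intro a i j
    simp [hs₂, Cmd.result, Expr.eval, hr₁, hb, hu, hs₁, Store.set2_reg, Store.set2_arr, hs₀]
  refine Run.seq (50 * (m + 1)) 10 (by omega)
    (run_for_flag (z := .some) 30 rfl (by decide) (by omega) (by decide)
      (fun c => (u ∈ blk c ∧ c ≠ b) ∧ s.arr .uaBV c u ≠ 0) 0 1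
      (by simp [hs₂, Cmd.result]) (fun a k => by simp [Expr.eval, Store.set2_reg, hr₂, h.reg_m])
      (fun k a => ?_) ?_)
  · have e1 : (Expr.and (.get .inB (.reg .c) (.reg .u)) (.not (.eq (.reg .c) (.reg .b)))).eval
        (s₂.set2 .some a .c k) = if u ∈ blk k ∧ k ≠ b then 1 else 0 := by
      simp [Expr.eval, Store.set2_reg, Store.set2_arr, hr₂, hb, hu, ha₂, h.inB, Fin.ext_iff]
    -- The cell of `(b, u)` has just been overwritten, but the loop skips `k = b`, so the value for
    -- `(u, B)` uses only old entries.
    have e2 : (Expr.get .uaBV (.reg .c) (.reg .u)).eval (s₂.set2 .some a .c k) =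
        if k = b then if x = 0 then 1 else 0 else s.arr .uaBV k u := by
      simp [Expr.eval, Store.set2_reg, Store.set2_arr, hr₂, hb, hu, ha₂, Fin.ext_iff]
    simp only [Cmd.when, Cmd.result, e1, e2, Expr.eval_one]
    by_cases h1 : u ∈ blk k ∧ k ≠ b
    · by_cases h2 : s.arr .uaBV k u = 0 <;> simp [h1, h2]
    · simp [h1]
  intro y hy hy'
  set s₃ := s₂.set2 .some y .c (m : ℤ) with hs₃
  have hr₃ : ∀ x, x ≠ Reg.all → x ≠ Reg.v → x ≠ Reg.some → x ≠ Reg.c → s₃.reg x = s.reg x :=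
    fun x h1 h2 h3 h4 => by simp [hs₃, Store.set2_reg, h3, h4, hr₂ x h1 h2 h3]
  have ha₃ : ∀ (a : Arr) (i j : ℤ), (s₃.setArr .uaVB u b y).arr a i j =
      if a = .uaVB ∧ i = u ∧ j = b then y else
        if a = .uaBV ∧ i = b ∧ j = u then if x = 0 then 1 else 0 else s.arr a i j := by
    intro a i j
    rw [Store.setArr_arr, hs₃, Store.set2_arr, ha₂]
  refine run_of_loopFree rfl (by decide) ?_
  have hres : (Cmd.list [Cmd.put .uaVB (.reg .u) (.reg .b) (.reg .some)]).result s₃ =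
      s₃.setArr .uaVB u b y := by
    simp [Cmd.list, Cmd.result, Expr.eval, hr₂, hb, hu, hs₃, Store.set2_reg]
  rw [hres]
  refine ⟨h.congr ?_ ?_ ?_ ?_ ?_, ?_, ?_, ?_, ?_, ?_, ?_⟩
  · simp [hr₃]
  · simp [hr₃]
  · funext i j
    exact (ha₃ _ _ _).trans (by simp)
  · funext i j
    exact (ha₃ _ _ _).trans (by simp)
  · funext i j
    exact (ha₃ _ _ _).trans (by simp)
  · simp [hr₃, hb]
  · simp [hr₃, hu]
  · simp [hr₃]
  · intro c v hcv
    have h1 : ¬ ((c : ℤ) = b ∧ (v : ℤ) = u) := by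
      simp only [Nat.cast_inj, Fin.val_inj]
      tauto
    have h2 : ¬ ((v : ℤ) = u ∧ (c : ℤ) = b) := fun h2 => h1 ⟨h2.2, h2.1⟩
    constructor
    · exact (ha₃ _ _ _).trans (by rw [if_neg (by simp), if_neg (fun h3 => h1 h3.2)])
    · exact (ha₃ _ _ _).trans (by rw [if_neg (fun h3 => h2 h3.2), if_neg (by simp)])
  · rw [ha₃]
    simp only [reduceCtorEq, false_and, if_false, and_self, if_true]
    have : (∀ v ∈ blk b, v ≠ u → v ∈ cutVerts G Finset.univ ∧ s.arr .uaVB v b ≠ 0) ↔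
        ¬ ∃ v, (v ∈ blk b ∧ v ≠ u) ∧ ¬ (v ∈ cutVerts G Finset.univ ∧ s.arr .uaVB v b ≠ 0) := by
      constructor
      · rintro h1 ⟨v, h2, h3⟩
        exact h3 (h1 v h2.1 h2.2)
      · intro h1 v h2 h3
        by_contra h4
        exact h1 ⟨v, ⟨h2, h3⟩, h4⟩
    by_cases h1 : ∃ v, (v ∈ blk b ∧ v ≠ u) ∧
        ¬ (v ∈ cutVerts G Finset.univ ∧ s.arr .uaVB v b ≠ 0)
    · rw [if_neg (fun h2 => this.1 h2 h1), if_pos (hx h1)]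
    · rw [if_pos (this.2 h1), if_neg]
      rw [hx' h1]
      exact one_ne_zero
  · rw [ha₃]
    simp only [and_self, if_true]
    have : (∃ c ≠ b, u ∈ blk c ∧ s.arr .uaBV c u ≠ 0) ↔
        ∃ c, (u ∈ blk c ∧ c ≠ b) ∧ s.arr .uaBV c u ≠ 0 := exists_congr fun c => by tauto
    by_cases h1 : ∃ c, (u ∈ blk c ∧ c ≠ b) ∧ s.arr .uaBV c u ≠ 0
    · rw [hy h1, if_pos (this.2 h1)]
    · rw [hy' h1, if_neg (fun h2 => h1 (this.1 h2))]

theorem toCut_mem_treeArcs (hblk : Numbering G blk) {b : Fin m} {u : Fin n} (hu : u ∈ blk b)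
    (hc : u ∈ cutVerts G Finset.univ) : .toCut (blk b) u ∈ treeArcs G :=
  ⟨hc, (hblk.mem _).2 ⟨b, rfl⟩, hu⟩

theorem toBlock_mem_treeArcs (hblk : Numbering G blk) {b : Fin m} {u : Fin n} (hu : u ∈ blk b)
    (hc : u ∈ cutVerts G Finset.univ) : .toBlock u (blk b) ∈ treeArcs G :=
  ⟨hc, (hblk.mem _).2 ⟨b, rfl⟩, hu⟩

theorem uaNum_ne_zero_iff {p : Arc (Fin n)} : uaNum G p ≠ 0 ↔ ua G p := by
  by_cases h : ua G p <;> simp [uaNum, h]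

/-- The tables `uaBV` and `uaVB` are right for all directed edges of size less than `K`, which may
depend on the pair of block and cut-vertex. -/
def UaTable (G : SimpleGraph (Fin n)) (blk : Fin m → Finset (Fin n)) (K : Fin m → Fin n → ℕ)
    (s : Store) : Prop :=
  ∀ (b : Fin m) (u : Fin n), u ∈ blk b → u ∈ cutVerts G Finset.univ →
    ((Arc.toCut (blk b) u).size G < K b u → s.arr .uaBV b u = uaNum G (.toCut (blk b) u)) ∧
    ((Arc.toBlock u (blk b)).size G < K b u → s.arr .uaVB u b = uaNum G (.toBlock u (blk b)))

/-- An entry of size at most `k` depends only on entries of size less than `k`, and these are right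
whether or not the present round has already revised them. The bound varies with the pair because
the table is updated in place. -/
theorem run_updateUa_uaTable (hc : G.Connected) (hbg : IsBlockGraph G) (hblk : Numbering G blk)
    {s : Store} (h : Table G C blk n s) {b : Fin m} {u : Fin n} (hub : u ∈ blk b)
    (hcut : u ∈ cutVerts G Finset.univ) (hb : s.reg .b = b) (hu : s.reg .u = u) (k : ℕ)
    {K K' : Fin m → Fin n → ℕ} (hK : ∀ c v, k ≤ K c v)
    (hK' : ∀ c v, (c ≠ b ∨ v ≠ u) → K' c v = K c v) (hKb : K' b u = k + 1)
    (hs : UaTable G blk K s) :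
    Run updateUa s (50 * (n + 1) + 50 * (m + 1)) fun s' =>
      Table G C blk n s' ∧ s'.reg .b = b ∧ s'.reg .u = u ∧ s'.reg .r = s.reg .r ∧
      UaTable G blk K' s' := by
  classical
  refine (run_updateUa h hb hu).mono le_rfl ?_
  rintro s' ⟨h1, h2, h3, h4, h5, h6, h7⟩
  refine ⟨h1, h2, h3, h4, fun c v hv hvc => ?_⟩
  by_cases hcv : c ≠ b ∨ v ≠ u
  · rw [hK' c v hcv, (h5 c v hcv).1, (h5 c v hcv).2]
    exact hs c v hv hvc
  push Not at hcv
  obtain ⟨rfl, rfl⟩ := hcv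
  have hp := toCut_mem_treeArcs hblk hub hcut
  have hq := toBlock_mem_treeArcs hblk hub hcut
  rw [hKb, h6, h7]
  constructor
  · intro hk
    have hval : ∀ w ∈ blk c, w ≠ v → w ∈ cutVerts G Finset.univ →
        (s.arr .uaVB w c ≠ 0 ↔ ua G (.toBlock w (blk c))) := by
      intro w hw hwv hwc
      have := size_kappa hc hbg hp ((mem_kappa hc hbg hp).2 ⟨hw, hwv, hwc⟩)
      have hKw := hK c w
      rw [(hs c w hw hwc).2 (by omega), uaNum_ne_zero_iff]
    have : (∀ w ∈ blk c, w ≠ v → w ∈ cutVerts G Finset.univ ∧ s.arr .uaVB w c ≠ 0) ↔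
        ¬ ua G (.toCut (blk c) v) := by
      rw [ua_toCut_iff hc hbg hp, not_not]
      refine forall_congr' fun w => forall_congr' fun hw => forall_congr' fun hwv => ?_
      exact and_congr_right fun hwc => hval w hw hwv hwc
    by_cases hua : ua G (.toCut (blk c) v)
    · rw [if_neg (fun h => this.1 h hua), uaNum_of_ua hua]
    · rw [if_pos (this.2 hua), uaNum_of_not_ua hua]
  · intro hk
    have hval : ∀ d ≠ c, v ∈ blk d → (s.arr .uaBV d v ≠ 0 ↔ ua G (.toCut (blk d) v)) := by
      intro d hd hvd
      have := size_beta hc hbg hq ((mem_beta hc hbg hq).2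
        ⟨(hblk.mem _).2 ⟨d, rfl⟩, hvd, fun he => hd (hblk.inj he)⟩)
      have hKd := hK d v
      rw [(hs d v hvd hvc).1 (by omega), uaNum_ne_zero_iff]
    have : (∃ d ≠ c, v ∈ blk d ∧ s.arr .uaBV d v ≠ 0) ↔ ua G (.toBlock v (blk c)) := by
      rw [ua_toBlock_iff hc hbg hq]
      constructor
      · rintro ⟨d, hd, hvd, h8⟩
        exact ⟨blk d, (mem_beta hc hbg hq).2
          ⟨(hblk.mem _).2 ⟨d, rfl⟩, hvd, fun he => hd (hblk.inj he)⟩, (hval d hd hvd).1 h8⟩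
      · rintro ⟨B', hB', h8⟩
        obtain ⟨h9, h10, h11⟩ := (mem_beta hc hbg hq).1 hB'
        obtain ⟨d, rfl⟩ := (hblk.mem _).1 h9
        have hd : d ≠ c := fun he => h11 (he ▸ rfl)
        exact ⟨d, hd, h10, (hval d hd h10).2 h8⟩
    by_cases hua : ua G (.toBlock v (blk c))
    · rw [if_pos (this.2 hua), uaNum_of_ua hua]
    · rw [if_neg (fun h => hua (this.1 h)), uaNum_of_not_ua hua]

/-- Round `k` makes all entries of size at most `k` correct, regardless of the order of visits.
Since sizes are at most `2n + 1`, the `2n + 2` rounds suffice. -/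
theorem run_computeUa (hc : G.Connected) (hbg : IsBlockGraph G) (hblk : Numbering G blk)
    {s : Store} (h : Table G C blk n s) :
    Run computeUa s ((2 * n + 3) * (20 * ((m + 1) * (n + 1)) +
        (∑ b, (blk b).card) * (50 * (n + 1) + 50 * (m + 1)) + 12)) fun s' =>
      Table G C blk n s' ∧ UaTable G blk (fun _ _ => 2 * n + 2) s' := by
  unfold computeUa
  refine run_for_const (2 * n + 2) (20 * ((m + 1) * (n + 1)) +
      (∑ b, (blk b).card) * (50 * (n + 1) + 50 * (m + 1)))
    (fun k s => (Table G C blk n s ∧ UaTable G blk (fun _ _ => k) s) ∧ s.reg .r = k)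
    le_rfl ?_ ?_ ?_ fun s hs => hs.1
  · refine ⟨⟨h.congr (by simp) (by simp) rfl rfl rfl, fun b u _ _ => ?_⟩, by simp⟩
    exact ⟨fun h => absurd h (Nat.not_lt_zero _), fun h => absurd h (Nat.not_lt_zero _)⟩
  · rintro k s - ⟨⟨h, -⟩, hr⟩
    refine ⟨hr, ?_⟩
    change s.reg .n + s.reg .n + 2 = _
    rw [h.reg_n]
    push_cast
    ring
  · rintro k s hk ⟨⟨h, hua⟩, hr⟩
    set K : ℕ → ℕ → Fin m → Fin n → ℕ := fun b u c v =>
      if (c : ℕ) < b ∨ ((c : ℕ) = b ∧ (v : ℕ) < u) then k + 1 else k with hKdef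
    refine (run_forTreeEdges (C := C) (50 * (n + 1) + 50 * (m + 1))
      (fun b u s => Table G C blk n s ∧ UaTable G blk (K b u) s ∧ s.reg .r = k)
      (fun b u s h => h.1) ?_ ?_ ?_ ?_ ?_).mono le_rfl ?_
    · rintro b u s x l hx ⟨h1, h2, h3⟩
      refine ⟨h1.congr ?_ ?_ rfl rfl rfl, h2, ?_⟩ <;> rcases hx with rfl | rfl <;> simp [h3]
    · rintro b u s hub hcut ⟨h1, h2, h3⟩ hb hu
      refine (run_updateUa_uaTable hc hbg hblk h1 hub hcut hb hu k (K := K b u)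
        (K' := K b (u + 1)) (fun c v => ?_) (fun c v hcv => ?_) ?_ h2).mono le_rfl ?_
      · simp only [hKdef]
        split_ifs <;> omega
      · have : (c : ℕ) ≠ b ∨ (v : ℕ) ≠ u := by simpa [Fin.val_inj] using hcv
        simp only [hKdef]
        refine if_congr ?_ rfl rfl
        omega
      · simp [hKdef]
      · rintro s' ⟨h4, h5, h6, h7, h8⟩
        exact ⟨⟨h4, h8, h7.trans h3⟩, h5, h6⟩
    · rintro b u s hbu ⟨h1, h2, h3⟩
      refine ⟨h1, fun c v hv hvc => ?_, h3⟩
      have h4 : c ≠ b ∨ v ≠ u := by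
        by_contra h5
        push Not at h5
        obtain ⟨rfl, rfl⟩ := h5
        exact hbu ⟨hv, hvc⟩
      have h5 : (c : ℕ) ≠ b ∨ (v : ℕ) ≠ u := by simpa [Fin.val_inj] using h4
      have h6 : K b (u + 1) c v = K b u c v := by
        simp only [hKdef]
        refine if_congr ?_ rfl rfl
        omega
      rw [h6]
      exact h2 c v hv hvc
    · rintro b s ⟨h1, h2, h3⟩
      refine ⟨h1, fun c v hv hvc => ?_, h3⟩
      have h6 : K (b + 1) 0 c v = K b n c v := by
        have := v.2
        simp only [hKdef]
        refine if_congr ?_ rfl rfl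
        omega
      rw [h6]
      exact h2 c v hv hvc
    · refine ⟨h, fun c v hv hvc => ?_, hr⟩
      have h6 : K 0 0 c v = k := by simp [hKdef]
      rw [h6]
      exact hua c v hv hvc
    · rintro s' ⟨h1, h2, h3⟩
      refine ⟨⟨h1.congr (by simp) (by simp) rfl rfl rfl, fun c v hv hvc => ?_⟩, by simp [h3]⟩
      have h6 : K m 0 c v = k + 1 := by simp [hKdef]
      have := h2 c v hv hvc
      rw [h6] at this
      exact this

theorem UaTable.eq {s : Store} (h : UaTable G blk (fun _ _ => 2 * n + 2) s) {b : Fin m}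
    {u : Fin n} (hu : u ∈ blk b) (hc : u ∈ cutVerts G Finset.univ) :
    s.arr .uaBV b u = uaNum G (.toCut (blk b) u) ∧
      s.arr .uaVB u b = uaNum G (.toBlock u (blk b)) := by
  have h1 : ((Arc.toCut (blk b) u).verts G).card ≤ n := by
    simpa using Finset.card_le_univ ((Arc.toCut (blk b) u).verts G)
  have h2 : ((Arc.toBlock u (blk b)).verts G).card ≤ n := by
    simpa using Finset.card_le_univ ((Arc.toBlock u (blk b)).verts G)
  have h3 := h b u hu hc
  simp only [Arc.size] at h3
  exact ⟨h3.1 (by omega), h3.2 (by omega)⟩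

end ComputeUa

end TokenSliding

namespace TokenSliding

@[simp] theorem Expr.eval_add (s : Store) (e f : Expr) : (e + f).eval s = e.eval s + f.eval s := rfl

@[simp] theorem Expr.eval_sub (s : Store) (e f : Expr) : (e - f).eval s = e.eval s - f.eval s := rfl

@[simp] theorem Expr.eval_two (s : Store) : (2 : Expr).eval s = 2 := rfl

/-! ### The two update commands. -/

section Updates

variable {n m : ℕ} {G : SimpleGraph (Fin n)} {C : Finset (Fin n)} {blk : Fin m → Finset (Fin n)}

/-- The store `s'` arises from `s` by raising the cell `(i, j)` of the array `a` to `z` if `p` holds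
and the cell was smaller. -/
structure Raised (a : Arr) (i j z : ℤ) (p : Prop) (s s' : Store) : Prop where
  reg : ∀ x, x = .n ∨ x = .m ∨ x = .b ∨ x = .u → s'.reg x = s.reg x
  arr : ∀ a', a' ≠ a → s'.arr a' = s.arr a'
  cell : (p ∧ s.arr a i j < z ∧ s'.reg .updated = 1 ∧
      ∀ i' j', s'.arr a i' j' = if i' = i ∧ j' = j then z else s.arr a i' j') ∨
    ((p → z ≤ s.arr a i j) ∧ s'.reg .updated = s.reg .updated ∧ s'.arr a = s.arr a)

open Classical in
theorem run_updateBV {s : Store} (h : Table G C blk n s) {b : Fin m} {u : Fin n}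
    (hb : s.reg .b = b) (hu : s.reg .u = u) :
    Run updateBV s (60 * (n + 1)) (Raised .yBV b u (s.arr .uaBV b u +
      ∑ v, if v ∈ blk b ∧ v ≠ u then (if v ∈ cutVerts G Finset.univ then s.arr .yVB v b else 0) -
        (if v ∈ C then 1 else 0) else 0) True s) := by
  set f : Fin n → ℤ := fun v => if v ∈ blk b ∧ v ≠ u then
    (if v ∈ cutVerts G Finset.univ then s.arr .yVB v b else 0) - (if v ∈ C then 1 else 0) else 0
    with hf
  unfold updateBV
  refine Run.seq 4 (60 * (n + 1) - 4) (by omega) (run_of_loopFree rfl (by decide) ?_)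
  set s₀ : Store := Cmd.result _ s with hs₀
  have hr₀ : ∀ x, x ≠ Reg.y' → s₀.reg x = s.reg x := fun x hx => by simp [hs₀, Cmd.result, hx]
  have ha₀ : s₀.arr = s.arr := rfl
  refine Run.seq ((n + 1) * 40) 16 (by omega) (run_for_acc (z := .y') 40 rfl (by decide)
      (by decide) (fun k => s.arr .uaBV b u + psum f k) ?_ ?_ ?_ ?_)
  · simp [hs₀, psum_zero, Cmd.result, Expr.eval, hb, hu]
  · intro k
    simp [Expr.eval, Store.set2_reg, hr₀, h.reg_n]
  · intro k hk
    set v : Fin n := ⟨k, hk⟩ with hv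
    have hkv : (k : ℤ) = (v : ℕ) := rfl
    have hs := psum_succ f v
    rw [show (v : ℕ) = k from rfl] at hs
    rw [hs, ← add_assoc]
    set a := s.arr .uaBV b u + psum f k with ha
    clear_value a
    rw [hkv]
    clear_value v
    have e1 : ∀ a, (Expr.and (.get .inB (.reg .b) (.reg .v)) (.not (.eq (.reg .v) (.reg .u)))).eval
        (s₀.set2 .y' a .v (v : ℕ)) = if v ∈ blk b ∧ v ≠ u then 1 else 0 := fun a => by
      simp [Expr.eval, Store.set2_reg, Store.set2_arr, hr₀, hb, hu, ha₀, h.inB, Fin.ext_iff]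
    have e2 : ∀ a, (Expr.get .cut (.reg .v) 0).eval (s₀.set2 .y' a .v (v : ℕ)) =
        if v ∈ cutVerts G Finset.univ then 1 else 0 := fun a => by
      simp [Expr.eval, Store.set2_reg, Store.set2_arr, ha₀, h.cut]
    have e3 : ∀ a, (Expr.get .tok (.reg .v) 0).eval (s₀.set2 .y' a .v (v : ℕ)) =
        if v ∈ C then 1 else 0 := fun a => by
      simp [Expr.eval, Store.set2_reg, Store.set2_arr, ha₀, h.tok]
    have e4 : ∀ a, (Expr.get .yVB (.reg .v) (.reg .b)).eval (s₀.set2 .y' a .v (v : ℕ)) =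
        s.arr .yVB v b := fun a => by
      simp [Expr.eval, Store.set2_reg, Store.set2_arr, ha₀, hr₀, hb]
    have e5 : ∀ a, (Expr.reg .y').eval (s₀.set2 .y' a .v (v : ℕ)) = a := fun a => by
      simp [Expr.eval, Store.set2_reg]
    have e6 : ∀ a c, (s₀.set2 .y' a .v (v : ℕ)).setReg .y' c = s₀.set2 .y' c .v (v : ℕ) :=
      fun a c => Store.set2_setReg (by decide) _ _ _
    simp only [Cmd.when, Cmd.list, Cmd.result, e1, e2, hf]
    by_cases h1 : v ∈ blk b ∧ v ≠ u
    · by_cases h2 : v ∈ cutVerts G Finset.univ <;> by_cases h3 : v ∈ C <;>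
        simp [h1, h2, h3, e3, e4, e5, e6, sub_eq_add_neg, add_assoc]
    · rw [if_neg h1, if_pos rfl, if_neg h1, add_zero]
  · rw [psum_self]
    set z := s.arr .uaBV b u + ∑ v, f v with hz
    set t := s₀.set2 .y' z .v n with ht
    have hr : ∀ x, x ≠ Reg.y' → x ≠ Reg.v → t.reg x = s.reg x := fun x h1 h2 => by
      simp [ht, Store.set2_reg, h1, h2, hr₀]
    have hta : t.arr = s.arr := rfl
    refine run_of_loopFree rfl (by decide) ?_
    have e1 : (Expr.lt (.get .yBV (.reg .b) (.reg .u)) (.reg .y')).eval t =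
        if s.arr .yBV b u < z then 1 else 0 := by
      have hty : t.reg .y' = z := by simp [ht, Store.set2_reg]
      simp [Expr.eval, hr, hta, hb, hu, hty]
    simp only [Cmd.list, Cmd.when, Cmd.result, e1]
    by_cases h1 : s.arr .yBV b u < z
    · rw [if_pos h1, if_neg one_ne_zero]
      have hty : t.reg .y' = z := by simp [ht, Store.set2_reg]
      refine ⟨?_, ?_, .inl ⟨trivial, h1, by simp, ?_⟩⟩
      · rintro x (rfl | rfl | rfl | rfl) <;> simp [hr]
      · intro a' ha'
        funext i j
        simp [ha', hta]
      · intro i' j'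
        simp [Expr.eval, hr, hb, hu, hty, hta]
    · rw [if_neg h1, if_pos rfl]
      refine ⟨?_, fun a' _ => rfl, .inr ⟨fun _ => not_lt.1 h1, ?_, rfl⟩⟩
      · rintro x (rfl | rfl | rfl | rfl) <;> simp [hr]
      · simp [hr]

open Classical in
theorem run_updateVB {s : Store} (h : Table G C blk n s) {b : Fin m} {u : Fin n}
    (hb : s.reg .b = b) (hu : s.reg .u = u) :
    Run updateVB s (80 * (m + 1)) (Raised .yVB u b (s.arr .uaVB u b +
      ∑ c, if u ∈ blk c ∧ c ≠ b then s.arr .yBV c u - s.arr .uaBV c u else 0)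
      ((Finset.univ.filter fun c => u ∈ blk c ∧ s.arr .yBV c u = 0 ∧ s.arr .uaBV c u ≠ 0).card < 2)
      s) := by
  set f : Fin m → ℤ := fun c =>
    if u ∈ blk c ∧ c ≠ b then s.arr .yBV c u - s.arr .uaBV c u else 0 with hf
  -- The count of zeros runs over all blocks at `u`, including `b` itself, whereas the sum `f`
  -- leaves `b` out.
  set g : Fin m → ℤ := fun c =>
    if u ∈ blk c ∧ s.arr .yBV c u = 0 ∧ s.arr .uaBV c u ≠ 0 then 1 else 0 with hg
  unfold updateVB
  refine Run.seq 4 (80 * (m + 1) - 4) (by omega) (run_of_loopFree rfl (by decide) ?_)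
  refine Run.seq 2 (80 * (m + 1) - 6) (by omega) (run_of_loopFree rfl (by decide) ?_)
  refine Run.seq 4 (80 * (m + 1) - 10) (by omega) (run_of_loopFree rfl (by decide) ?_)
  set s₀ : Store := Cmd.result _ _ with hs₀
  have hr₀ : ∀ x, x ≠ Reg.y' → x ≠ Reg.cnt → x ≠ Reg.sum → s₀.reg x = s.reg x :=
    fun x h1 h2 h3 => by simp [hs₀, Cmd.result, h1, h2, h3]
  have ha₀ : s₀.arr = s.arr := rfl
  let S : ℤ → ℤ → ℤ → Store := fun a a' k => ((s₀.setReg .cnt a).setReg .sum a').setReg .c k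
  have hS : ∀ a a' k x, (S a a' k).reg x = if x = .c then k else if x = .sum then a' else
      if x = .cnt then a else s₀.reg x := fun a a' k x => by simp [S]
  have hSa : ∀ a a' k, (S a a' k).arr = s.arr := fun _ _ _ => rfl
  have hScnt : ∀ a a' k d, (S a a' k).setReg .cnt d = S d a' k := fun a a' k d => by
    refine Store.ext_reg_arr (fun y => ?_) fun _ _ _ => rfl
    simp only [Store.setReg_reg, hS]
    split_ifs <;> simp_all
  have hSsum : ∀ a a' k d, (S a a' k).setReg .sum d = S a d k := fun a a' k d => by
    refine Store.ext_reg_arr (fun y => ?_) fun _ _ _ => rfl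
    simp only [Store.setReg_reg, hS]
    split_ifs <;> simp_all
  have hSc : ∀ a a' k d, (S a a' k).setReg .c d = S a a' d := fun a a' k d => by
    refine Store.ext_reg_arr (fun y => ?_) fun _ _ _ => rfl
    simp only [Store.setReg_reg, hS]
    split_ifs <;> simp_all
  refine Run.seq ((m + 1) * 45) 25 (by omega) (run_for_states 45 rfl (by decide)
      (fun k => S (psum g k) (s.arr .uaVB u b + psum f k) k) ?_ ?_ ?_ ?_ ?_)
  · refine Store.ext_reg_arr (fun y => ?_) fun _ _ _ => rfl
    simp only [Store.setReg_reg, hS, psum_zero]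
    split_ifs with h1 h2 h3
    · rfl
    · simp [hs₀, Cmd.result, Expr.eval, h2, hu, hb]
    · simp [hs₀, Cmd.result, h3]
    · rfl
  · intro k
    simp [hS]
  · intro k
    simp [Expr.eval, hS, hr₀, h.reg_m]
  · intro k hk
    set v : Fin m := ⟨k, hk⟩ with hv
    have hkv : (k : ℤ) = (v : ℕ) := rfl
    have hsf := psum_succ f v
    have hsg := psum_succ g v
    rw [show (v : ℕ) = k from rfl] at hsf hsg
    rw [hsf, hsg, ← add_assoc]
    set a' := s.arr .uaVB u b + psum f k with ha'
    clear_value a'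
    set a := psum g k with ha
    clear_value a
    push_cast
    rw [hkv]
    clear_value v
    have e1 : ∀ a a', (Expr.get .inB (.reg .c) (.reg .u)).eval (S a a' (v : ℕ)) =
        if u ∈ blk v then 1 else 0 := fun a a' => by
      simp [Expr.eval, hS, hSa, hr₀, hu, h.inB]
    have e2 : ∀ a a', (Expr.and (.eq (.get .yBV (.reg .c) (.reg .u)) 0)
        (.get .uaBV (.reg .c) (.reg .u))).eval (S a a' (v : ℕ)) =
        if s.arr .yBV v u = 0 ∧ s.arr .uaBV v u ≠ 0 then 1 else 0 := fun a a' => by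
      simp [Expr.eval, hS, hSa, hr₀, hu]
    have e3 : ∀ a a', (Expr.not (.eq (.reg .c) (.reg .b))).eval (S a a' (v : ℕ)) =
        if v ≠ b then 1 else 0 := fun a a' => by
      simp [Expr.eval, hS, hr₀, hb, Fin.ext_iff]
    have e4 : ∀ a a', (Expr.get .yBV (.reg .c) (.reg .u)).eval (S a a' (v : ℕ)) =
        s.arr .yBV v u := fun a a' => by
      simp [Expr.eval, hS, hSa, hr₀, hu]
    have e5 : ∀ a a', (Expr.get .uaBV (.reg .c) (.reg .u)).eval (S a a' (v : ℕ)) =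
        s.arr .uaBV v u := fun a a' => by
      simp [Expr.eval, hS, hSa, hr₀, hu]
    have e6 : ∀ a a', (Expr.reg .cnt).eval (S a a' (v : ℕ)) = a := fun a a' => by
      simp [Expr.eval, hS]
    have e7 : ∀ a a', (Expr.reg .sum).eval (S a a' (v : ℕ)) = a' := fun a a' => by
      simp [Expr.eval, hS]
    have e8 : ∀ a a', (S a a' (v : ℕ)).reg .c = (v : ℕ) := fun a a' => by simp [hS]
    simp only [Cmd.when, Cmd.list, Cmd.result, e1, hf, hg]
    by_cases h1 : u ∈ blk v
    · by_cases h2 : s.arr .yBV v u = 0 ∧ s.arr .uaBV v u ≠ 0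
      · rcases eq_or_ne v b with h3 | h3
        · subst h3
          simp [h1, h2, e2, e3, e4, e5, e6, e7, e8, hScnt, hSsum, hSc, sub_eq_add_neg, add_assoc]
        · simp [h1, h2, h3, e2, e3, e4, e5, e6, e7, e8, hScnt, hSsum, hSc, sub_eq_add_neg,
            add_assoc]
      · rcases eq_or_ne v b with h3 | h3
        · subst h3
          simp [h1, if_neg h2, e2, e3, e4, e5, e6, e7, e8, hScnt, hSsum, hSc, sub_eq_add_neg,
            add_assoc]
        · simp [h1, if_neg h2, h3, e2, e3, e4, e5, e6, e7, e8, hScnt, hSsum, hSc, sub_eq_add_neg,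
            add_assoc]
    · simp [h1, e8, hSc]
  · rw [psum_self, psum_self]
    set z := s.arr .uaVB u b + ∑ v, f v with hz
    have hcnt : ∑ c, g c = ((Finset.univ.filter fun c =>
        u ∈ blk c ∧ s.arr .yBV c u = 0 ∧ s.arr .uaBV c u ≠ 0).card : ℤ) := by
      simp [hg]
    set N := (Finset.univ.filter fun c =>
        u ∈ blk c ∧ s.arr .yBV c u = 0 ∧ s.arr .uaBV c u ≠ 0).card with hN
    rw [hcnt]
    set t := S N z m with ht
    have hr : ∀ x, x ≠ Reg.y' → x ≠ Reg.cnt → x ≠ Reg.sum → x ≠ Reg.c → t.reg x = s.reg x :=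
      fun x h1 h2 h3 h4 => by simp [ht, hS, h1, h2, h3, h4, hr₀]
    have hta : t.arr = s.arr := rfl
    have hty : t.reg .y' = s.arr .yVB u b := by
      simp [ht, hS, hs₀, Cmd.result, Expr.eval, hb, hu]
    refine Run.seq 8 17 (by omega) (run_of_loopFree rfl (by decide) ?_)
    have e1 : (Expr.lt (.reg .cnt) 2).eval t = if N < 2 then 1 else 0 := by
      simp [Expr.eval, ht, hS]
    have e2 : (Expr.reg .sum).eval t = z := by simp [Expr.eval, ht, hS]
    simp only [Cmd.when, Cmd.result, e1, e2]
    refine run_of_loopFree rfl (by decide) ?_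
    by_cases h1 : N < 2
    · rw [if_pos h1, if_neg one_ne_zero]
      have e3 : (Expr.lt (.get .yVB (.reg .u) (.reg .b)) (.reg .y')).eval (t.setReg .y' z) =
          if s.arr .yVB u b < z then 1 else 0 := by
        simp [Expr.eval, hr, hta, hb, hu]
      simp only [Cmd.list, Cmd.result, e3]
      by_cases h2 : s.arr .yVB u b < z
      · rw [if_pos h2, if_neg one_ne_zero]
        refine ⟨?_, ?_, .inl ⟨h1, h2, by simp, ?_⟩⟩
        · rintro x (rfl | rfl | rfl | rfl) <;> simp [hr]
        · intro a' ha'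
          funext i j
          simp [ha', hta]
        · intro i' j'
          simp [Expr.eval, hr, hb, hu, hta]
      · rw [if_neg h2, if_pos rfl]
        refine ⟨?_, fun a' _ => rfl, .inr ⟨fun _ => not_lt.1 h2, ?_, rfl⟩⟩
        · rintro x (rfl | rfl | rfl | rfl) <;> simp [hr]
        · simp [hr]
    -- With two harmful zeros, `y'` keeps the old cell value, so the final comparison fails and
    -- nothing is written.
    · rw [if_neg h1, if_pos rfl]
      have e3 : (Expr.lt (.get .yVB (.reg .u) (.reg .b)) (.reg .y')).eval t = 0 := by
        simp [Expr.eval, hr, hta, hb, hu, hty]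
      simp only [Cmd.list, Cmd.result, e3, if_true]
      refine ⟨?_, fun a' _ => rfl, .inr ⟨fun h2 => absurd h2 h1, ?_, rfl⟩⟩
      · rintro x (rfl | rfl | rfl | rfl) <;> simp [hr]
      · simp [hr]

end Updates

end TokenSliding

namespace TokenSliding

/-! ### Updates of the tables and the inequalities of `Closed`. -/

section Sweep

variable {n m : ℕ} {G : SimpleGraph (Fin n)} {C : Finset (Fin n)} {blk : Fin m → Finset (Fin n)}
  {F : Arc (Fin n) → ℤ}

open Classical in
/-- The values that the tables `yBV` and `yVB` assign to the directed edges of the block-tree. -/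
noncomputable def arcVal (blk : Fin m → Finset (Fin n)) (s : Store) : Arc (Fin n) → ℤ
  | .toCut B u => ∑ b, if blk b = B then s.arr .yBV b u else 0
  | .toBlock u B => ∑ b, if blk b = B then s.arr .yVB u b else 0

theorem arcVal_toCut (hblk : Numbering G blk) (s : Store) (b : Fin m) (u : Fin n) :
    arcVal blk s (.toCut (blk b) u) = s.arr .yBV b u := by
  simp [arcVal, hblk.inj.eq_iff]

theorem arcVal_toBlock (hblk : Numbering G blk) (s : Store) (b : Fin m) (u : Fin n) :
    arcVal blk s (.toBlock u (blk b)) = s.arr .yVB u b := by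
  simp [arcVal, hblk.inj.eq_iff]

open Classical in
/-- The value that `updateBV` computes. -/
noncomputable def newBV (G : SimpleGraph (Fin n)) (C : Finset (Fin n))
    (blk : Fin m → Finset (Fin n)) (s : Store) (b : Fin m) (u : Fin n) : ℤ :=
  s.arr .uaBV b u +
    ∑ v, if v ∈ blk b ∧ v ≠ u then (if v ∈ cutVerts G Finset.univ then s.arr .yVB v b else 0) -
      (if v ∈ C then 1 else 0) else 0

open Classical in
/-- The value that `updateVB` computes. -/
noncomputable def newVB (blk : Fin m → Finset (Fin n)) (s : Store) (b : Fin m) (u : Fin n) : ℤ :=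
  s.arr .uaVB u b +
    ∑ c, if u ∈ blk c ∧ c ≠ b then s.arr .yBV c u - s.arr .uaBV c u else 0

/-- The condition under which `updateVB` considers its new value. -/
def FewZeros (blk : Fin m → Finset (Fin n)) (s : Store) (u : Fin n) : Prop :=
  (Finset.univ.filter fun c => u ∈ blk c ∧ s.arr .yBV c u = 0 ∧ s.arr .uaBV c u ≠ 0).card < 2

/-- The store holds the block-tree, the values of `ua`, and lower bounds for the numbers `F p`. -/
structure Ready (G : SimpleGraph (Fin n)) (C : Finset (Fin n)) (blk : Fin m → Finset (Fin n))
    (F : Arc (Fin n) → ℤ) (s : Store) : Prop where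
  table : Table G C blk n s
  ua : UaTable G blk (fun _ _ => 2 * n + 2) s
  bound : ∀ p ∈ treeArcs G, 0 ≤ arcVal blk s p ∧ arcVal blk s p ≤ F p

/-- The tables cannot be improved at the pair of `b` and `u`. -/
def Settled (G : SimpleGraph (Fin n)) (C : Finset (Fin n)) (blk : Fin m → Finset (Fin n))
    (s : Store) (b : Fin m) (u : Fin n) : Prop :=
  newBV G C blk s b u ≤ s.arr .yBV b u ∧ (FewZeros blk s u → newVB blk s b u ≤ s.arr .yVB u b)

variable (hc : G.Connected) (hbg : IsBlockGraph G) (hblk : Numbering G blk)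
include hc hbg hblk

theorem newBV_eq {s : Store} (hua : UaTable G blk (fun _ _ => 2 * n + 2) s) {b : Fin m} {u : Fin n}
    (hub : u ∈ blk b) (hcut : u ∈ cutVerts G Finset.univ) :
    newBV G C blk s b u = (∑ v ∈ kappa G (blk b) u, arcVal blk s (.toBlock v (blk b))) +
      uaNum G (.toCut (blk b) u) - ((((blk b).erase u) ∩ C).card : ℤ) := by
  classical
  have hp := toCut_mem_treeArcs hblk hub hcut
  rw [newBV, (hua.eq hub hcut).1]
  have h1 : ∀ v, (if v ∈ blk b ∧ v ≠ u then
      (if v ∈ cutVerts G Finset.univ then s.arr .yVB v b else 0) - (if v ∈ C then 1 else 0) else 0) =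
      (if v ∈ kappa G (blk b) u then arcVal blk s (.toBlock v (blk b)) else 0) -
        (if v ∈ (blk b).erase u ∩ C then (1 : ℤ) else 0) := by
    intro v
    simp only [mem_kappa hc hbg hp, arcVal_toBlock hblk, Finset.mem_inter, Finset.mem_erase]
    by_cases h1 : v ∈ blk b <;> by_cases h2 : v = u <;>
      by_cases h3 : v ∈ cutVerts G Finset.univ <;> by_cases h4 : v ∈ C <;> simp [h1, h2, h3, h4]
  simp only [h1, Finset.sum_sub_distrib, Finset.sum_ite_mem, Finset.univ_inter]
  simp
  ring

theorem newVB_eq {s : Store} (hua : UaTable G blk (fun _ _ => 2 * n + 2) s) {b : Fin m} {u : Fin n}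
    (hub : u ∈ blk b) (hcut : u ∈ cutVerts G Finset.univ) :
    newVB blk s b u = (∑ B' ∈ beta G u (blk b),
      (arcVal blk s (.toCut B' u) - uaNum G (.toCut B' u))) + uaNum G (.toBlock u (blk b)) := by
  classical
  have hp := toBlock_mem_treeArcs hblk hub hcut
  have h1 : beta G u (blk b) = (Finset.univ.filter fun c => u ∈ blk c ∧ c ≠ b).image blk := by
    ext B'
    simp only [mem_beta hc hbg hp, Finset.mem_image, Finset.mem_filter, Finset.mem_univ, true_and]
    constructor
    · rintro ⟨h2, h3, h4⟩
      obtain ⟨c, rfl⟩ := (hblk.mem _).1 h2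
      exact ⟨c, ⟨h3, fun h => h4 (h ▸ rfl)⟩, rfl⟩
    · rintro ⟨c, ⟨h2, h3⟩, rfl⟩
      exact ⟨(hblk.mem _).2 ⟨c, rfl⟩, h2, fun h => h3 (hblk.inj h)⟩
  rw [newVB, (hua.eq hub hcut).2, h1, Finset.sum_image fun _ _ _ _ h => hblk.inj h,
    Finset.sum_filter, add_comm]
  congr 1
  refine Finset.sum_congr rfl fun c _ => ?_
  by_cases h2 : u ∈ blk c ∧ c ≠ b
  · rw [if_pos h2, if_pos h2, arcVal_toCut hblk, (hua.eq h2.1 hcut).1]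
  · rw [if_neg h2, if_neg h2]

theorem fewZeros_iff {s : Store} (hua : UaTable G blk (fun _ _ => 2 * n + 2) s) {u : Fin n}
    (hcut : u ∈ cutVerts G Finset.univ) :
    FewZeros blk s u ↔ ∀ B₁ B₂, .toCut B₁ u ∈ treeArcs G → .toCut B₂ u ∈ treeArcs G →
      arcVal blk s (.toCut B₁ u) = 0 → ua G (.toCut B₁ u) →
      arcVal blk s (.toCut B₂ u) = 0 → ua G (.toCut B₂ u) → B₁ = B₂ := by
  rw [FewZeros, Nat.lt_succ_iff, Finset.card_le_one]
  simp only [Finset.mem_filter, Finset.mem_univ, true_and]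
  have key : ∀ c, u ∈ blk c → (s.arr .uaBV c u ≠ 0 ↔ ua G (.toCut (blk c) u)) := fun c hu => by
    rw [(hua.eq hu hcut).1, uaNum_ne_zero_iff]
  constructor
  · intro h B₁ B₂ h₁ h₂ hz₁ hu₁ hz₂ hu₂
    obtain ⟨c₁, rfl⟩ := (hblk.mem _).1 h₁.2.1
    obtain ⟨c₂, rfl⟩ := (hblk.mem _).1 h₂.2.1
    rw [arcVal_toCut hblk] at hz₁ hz₂
    rw [h c₁ ⟨h₁.2.2, hz₁, (key c₁ h₁.2.2).2 hu₁⟩ c₂ ⟨h₂.2.2, hz₂, (key c₂ h₂.2.2).2 hu₂⟩]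
  · rintro h c₁ ⟨h₁, hz₁, hu₁⟩ c₂ ⟨h₂, hz₂, hu₂⟩
    refine hblk.inj (h _ _ (toCut_mem_treeArcs hblk h₁ hcut) (toCut_mem_treeArcs hblk h₂ hcut)
      ?_ ((key c₁ h₁).1 hu₁) ?_ ((key c₂ h₂).1 hu₂))
    · rwa [arcVal_toCut hblk]
    · rwa [arcVal_toCut hblk]

/-- The update is monotone in the stored values. These are below `F`, and `F` satisfies the
corresponding inequality. -/
theorem Ready.newBV_le (hF : Closed G C F) {s : Store} (h : Ready G C blk F s) {b : Fin m}
    {u : Fin n} (hub : u ∈ blk b) (hcut : u ∈ cutVerts G Finset.univ) :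
    newBV G C blk s b u ≤ F (.toCut (blk b) u) := by
  have hp := toCut_mem_treeArcs hblk hub hcut
  rw [newBV_eq hc hbg hblk h.ua hub hcut]
  have h1 := hF.toCut _ _ hp
  have h2 : ∑ v ∈ kappa G (blk b) u, arcVal blk s (.toBlock v (blk b)) ≤
      ∑ v ∈ kappa G (blk b) u, F (.toBlock v (blk b)) :=
    Finset.sum_le_sum fun v hv => (h.bound _ (toBlock_mem_of_kappa hc hbg hp hv)).2
  linarith

/-- Besides monotonicity, the side condition has to carry over. As the stored values lie between 0
and `F`, every zero of `F` is a zero of the table. If the table has few harmful zeros, so has `F`.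
-/
theorem Ready.newVB_le (hF : Closed G C F) {s : Store} (h : Ready G C blk F s) {b : Fin m}
    {u : Fin n} (hub : u ∈ blk b) (hcut : u ∈ cutVerts G Finset.univ) (hz : FewZeros blk s u) :
    newVB blk s b u ≤ F (.toBlock u (blk b)) := by
  have hp := toBlock_mem_treeArcs hblk hub hcut
  rw [newVB_eq hc hbg hblk h.ua hub hcut]
  have h0 : ∀ B, .toCut B u ∈ treeArcs G → F (.toCut B u) = 0 → arcVal blk s (.toCut B u) = 0 :=
    fun B hB h1 => by
      have := h.bound _ hB
      omega
  have h1 := hF.toBlock _ _ hp fun B₁ B₂ h₁ h₂ hz₁ hu₁ hz₂ hu₂ =>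
    (fewZeros_iff hc hbg hblk h.ua hcut).1 hz B₁ B₂ h₁ h₂ (h0 _ h₁ hz₁) hu₁ (h0 _ h₂ hz₂) hu₂
  have h2 : ∑ B' ∈ beta G u (blk b), (arcVal blk s (.toCut B' u) - uaNum G (.toCut B' u)) ≤
      ∑ B' ∈ beta G u (blk b), (F (.toCut B' u) - uaNum G (.toCut B' u)) :=
    Finset.sum_le_sum fun B' hB' => by
      have := (h.bound _ (toCut_mem_of_beta hc hbg hp hB')).2
      linarith
  linarith

theorem closed_of_settled {s : Store} (hua : UaTable G blk (fun _ _ => 2 * n + 2) s)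
    (h : ∀ b u, u ∈ blk b → u ∈ cutVerts G Finset.univ → Settled G C blk s b u) :
    Closed G C (arcVal blk s) where
  toCut B u hp := by
    obtain ⟨b, rfl⟩ := (hblk.mem _).1 hp.2.1
    have hu : u ∈ blk b := hp.2.2
    have hcut : u ∈ cutVerts G Finset.univ := hp.1
    rw [← newBV_eq hc hbg hblk hua hu hcut, arcVal_toCut hblk]
    exact (h b u hu hcut).1
  toBlock u B hp hz := by
    obtain ⟨b, rfl⟩ := (hblk.mem _).1 hp.2.1
    have hu : u ∈ blk b := hp.2.2
    have hcut : u ∈ cutVerts G Finset.univ := hp.1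
    rw [← newVB_eq hc hbg hblk hua hu hcut, arcVal_toBlock hblk]
    exact (h b u hu hcut).2 ((fewZeros_iff hc hbg hblk hua hcut).2 hz)

end Sweep

end TokenSliding

namespace TokenSliding

/-! ### Progress of single updates, measured by the sum of all values. -/

section Iterate

variable {n m : ℕ} {G : SimpleGraph (Fin n)} {C : Finset (Fin n)} {blk : Fin m → Finset (Fin n)}
  {F : Arc (Fin n) → ℤ}

open Classical in
/-- The sum of the values of all directed edges of the block-tree. -/
noncomputable def total (G : SimpleGraph (Fin n)) (blk : Fin m → Finset (Fin n)) (s : Store) : ℤ :=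
  ∑ b, ∑ u, if u ∈ blk b ∧ u ∈ cutVerts G Finset.univ then s.arr .yBV b u + s.arr .yVB u b else 0

theorem arcVal_congr {s s' : Store} (h : s'.arr = s.arr) : arcVal blk s' = arcVal blk s := by
  funext p
  cases p <;> simp [arcVal, h]

theorem UaTable.congr {K : Fin m → Fin n → ℕ} {s s' : Store} (h : UaTable G blk K s)
    (h1 : s'.arr .uaBV = s.arr .uaBV) (h2 : s'.arr .uaVB = s.arr .uaVB) : UaTable G blk K s' := by
  intro b u hu hc
  rw [h1, h2]
  exact h b u hu hc

theorem Ready.congr {s s' : Store} (h : Ready G C blk F s) (hn : s'.reg .n = s.reg .n)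
    (hm : s'.reg .m = s.reg .m) (harr : s'.arr = s.arr) : Ready G C blk F s' where
  table := h.table.congr hn hm (by rw [harr]) (by rw [harr]) (by rw [harr])
  ua := h.ua.congr (by rw [harr]) (by rw [harr])
  bound := by rw [arcVal_congr harr]; exact h.bound

theorem total_congr {s s' : Store} (h : s'.arr = s.arr) : total G blk s' = total G blk s := by
  simp [total, h]

theorem total_lt {s s' : Store}
    (h : ∀ (c : Fin m) (v : Fin n), s.arr .yBV c v ≤ s'.arr .yBV c v ∧
      s.arr .yVB v c ≤ s'.arr .yVB v c)
    {b : Fin m} {u : Fin n} (hub : u ∈ blk b) (hcut : u ∈ cutVerts G Finset.univ)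
    (hlt : s.arr .yBV b u + s.arr .yVB u b < s'.arr .yBV b u + s'.arr .yVB u b) :
    total G blk s + 1 ≤ total G blk s' := by
  classical
  have hle : ∀ (c : Fin m) (v : Fin n), (if v ∈ blk c ∧ v ∈ cutVerts G Finset.univ then
      s.arr .yBV c v + s.arr .yVB v c else 0) ≤ if v ∈ blk c ∧ v ∈ cutVerts G Finset.univ then
      s'.arr .yBV c v + s'.arr .yVB v c else 0 := by
    intro c v
    have := h c v
    split_ifs <;> omega
  refine Int.add_one_le_iff.2 ?_
  refine Finset.sum_lt_sum (fun c _ => Finset.sum_le_sum fun v _ => hle c v)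
    ⟨b, Finset.mem_univ _, Finset.sum_lt_sum (fun v _ => hle b v) ⟨u, Finset.mem_univ _, ?_⟩⟩
  rwa [if_pos ⟨hub, hcut⟩, if_pos ⟨hub, hcut⟩]

/-- Each incident pair of a block and a cut-vertex contributes two values, each bounded by `F` and
hence by `n`. This caps the number of raises over the whole run. -/
theorem Ready.total_le (hblk : Numbering G blk) (hF : ∀ p ∈ treeArcs G, F p ≤ n) {s : Store}
    (h : Ready G C blk F s) : total G blk s ≤ (2 * n * ∑ b, (blk b).card : ℕ) := by
  classical
  have : total G blk s ≤ ∑ b, ∑ u, if u ∈ blk b then ((2 * n : ℕ) : ℤ) else 0 := by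
    refine Finset.sum_le_sum fun b _ => Finset.sum_le_sum fun u _ => ?_
    by_cases h1 : u ∈ blk b
    · by_cases h2 : u ∈ cutVerts G Finset.univ
      · rw [if_pos ⟨h1, h2⟩, if_pos h1, ← arcVal_toCut hblk, ← arcVal_toBlock hblk]
        have hp := toCut_mem_treeArcs hblk h1 h2
        have hq := toBlock_mem_treeArcs hblk h1 h2
        have h3 := h.bound _ hp
        have h4 := h.bound _ hq
        have h5 := hF _ hp
        have h6 := hF _ hq
        push_cast
        linarith
      · rw [if_neg (fun h => h2 h.2), if_pos h1]
        positivity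
    · rw [if_neg (fun h => h1 h.1), if_neg h1]
  refine this.trans (le_of_eq ?_)
  simp only [Finset.sum_ite_mem, Finset.univ_inter, Finset.sum_const]
  push_cast
  rw [Finset.mul_sum]
  refine Finset.sum_congr rfl fun b _ => ?_
  simp
  ring

/-- What an update may do: it raises a value and reports this, or it changes nothing. -/
def Progress (G : SimpleGraph (Fin n)) (blk : Fin m → Finset (Fin n)) (P : Prop)
    (s s' : Store) : Prop :=
  (s'.reg .updated = 1 ∧ total G blk s + 1 ≤ total G blk s') ∨
    (s'.reg .updated = 0 ∧ s'.arr = s.arr ∧ P)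

theorem Raised.arr_eq {a : Arr} {i j z : ℤ} {p : Prop} {s s' : Store} (h : Raised a i j z p s s')
    (ha : s'.arr a = s.arr a) : s'.arr = s.arr := by
  funext a'
  by_cases h1 : a' = a
  · rw [h1, ha]
  · exact h.arr a' h1

theorem Ready.raisedBV (hblk : Numbering G blk) {s s' : Store} (h : Ready G C blk F s) {b : Fin m}
    {u : Fin n} {z : ℤ} {p : Prop} (hr : Raised .yBV b u z p s s') (h0 : s.reg .updated = 0)
    (hub : u ∈ blk b) (hcut : u ∈ cutVerts G Finset.univ) (hz : p → z ≤ F (.toCut (blk b) u)) :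
    Ready G C blk F s' ∧ Progress G blk (p → z ≤ s.arr .yBV b u) s s' := by
  rcases hr.cell with ⟨hp, hlt, hup, hcell⟩ | ⟨hle, hup, hsame⟩
  · have hcell' : ∀ (c : Fin m) (v : Fin n), s'.arr .yBV c v =
        if c = b ∧ v = u then z else s.arr .yBV c v := fun c v => by
      rw [hcell]
      simp [Fin.val_inj]
    have hVB : s'.arr .yVB = s.arr .yVB := hr.arr _ (by decide)
    refine ⟨⟨h.table.congr (hr.reg _ (by simp)) (hr.reg _ (by simp)) (hr.arr _ (by decide))
      (hr.arr _ (by decide)) (hr.arr _ (by decide)), h.ua.congr (hr.arr _ (by decide))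
      (hr.arr _ (by decide)), fun q hq => ?_⟩, .inl ⟨hup, total_lt (fun c v => ?_) hub hcut ?_⟩⟩
    · cases q with
      | toCut B v =>
        obtain ⟨c, rfl⟩ := (hblk.mem B).1 hq.2.1
        have h1 := h.bound _ hq
        rw [arcVal_toCut hblk] at h1 ⊢
        rw [hcell']
        split_ifs with h2
        · obtain ⟨rfl, rfl⟩ := h2
          exact ⟨h1.1.trans hlt.le, hz hp⟩
        · exact h1
      | toBlock v B =>
        obtain ⟨c, rfl⟩ := (hblk.mem B).1 hq.2.1
        have h1 := h.bound _ hq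
        rw [arcVal_toBlock hblk] at h1 ⊢
        rwa [hVB]
    · rw [hVB, hcell']
      split_ifs with h2
      · obtain ⟨rfl, rfl⟩ := h2
        exact ⟨hlt.le, le_rfl⟩
      · exact ⟨le_rfl, le_rfl⟩
    · rw [hVB, hcell', if_pos ⟨rfl, rfl⟩]
      linarith
  · have harr := hr.arr_eq hsame
    exact ⟨h.congr (hr.reg _ (by simp)) (hr.reg _ (by simp)) harr,
      .inr ⟨hup.trans h0, harr, hle⟩⟩

theorem Ready.raisedVB (hblk : Numbering G blk) {s s' : Store} (h : Ready G C blk F s) {b : Fin m}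
    {u : Fin n} {z : ℤ} {p : Prop} (hr : Raised .yVB u b z p s s') (h0 : s.reg .updated = 0)
    (hub : u ∈ blk b) (hcut : u ∈ cutVerts G Finset.univ) (hz : p → z ≤ F (.toBlock u (blk b))) :
    Ready G C blk F s' ∧ Progress G blk (p → z ≤ s.arr .yVB u b) s s' := by
  rcases hr.cell with ⟨hp, hlt, hup, hcell⟩ | ⟨hle, hup, hsame⟩
  · have hcell' : ∀ (c : Fin m) (v : Fin n), s'.arr .yVB v c =
        if v = u ∧ c = b then z else s.arr .yVB v c := fun c v => by
      rw [hcell]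
      simp [Fin.val_inj]
    have hBV : s'.arr .yBV = s.arr .yBV := hr.arr _ (by decide)
    refine ⟨⟨h.table.congr (hr.reg _ (by simp)) (hr.reg _ (by simp)) (hr.arr _ (by decide))
      (hr.arr _ (by decide)) (hr.arr _ (by decide)), h.ua.congr (hr.arr _ (by decide))
      (hr.arr _ (by decide)), fun q hq => ?_⟩, .inl ⟨hup, total_lt (fun c v => ?_) hub hcut ?_⟩⟩
    · cases q with
      | toBlock v B =>
        obtain ⟨c, rfl⟩ := (hblk.mem B).1 hq.2.1
        have h1 := h.bound _ hq
        rw [arcVal_toBlock hblk] at h1 ⊢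
        rw [hcell']
        split_ifs with h2
        · obtain ⟨rfl, rfl⟩ := h2
          exact ⟨h1.1.trans hlt.le, hz hp⟩
        · exact h1
      | toCut B v =>
        obtain ⟨c, rfl⟩ := (hblk.mem B).1 hq.2.1
        have h1 := h.bound _ hq
        rw [arcVal_toCut hblk] at h1 ⊢
        rwa [hBV]
    · rw [hBV, hcell']
      split_ifs with h2
      · obtain ⟨rfl, rfl⟩ := h2
        exact ⟨le_rfl, hlt.le⟩
      · exact ⟨le_rfl, le_rfl⟩
    · rw [hBV, hcell', if_pos ⟨rfl, rfl⟩]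
      linarith
  · have harr := hr.arr_eq hsame
    exact ⟨h.congr (hr.reg _ (by simp)) (hr.reg _ (by simp)) harr,
      .inr ⟨hup.trans h0, harr, hle⟩⟩

theorem eval_not_updated (s : Store) :
    (Expr.not (.reg .updated)).eval s = if s.reg .updated = 0 then 1 else 0 := rfl

theorem run_sweepBody (hc : G.Connected) (hbg : IsBlockGraph G) (hblk : Numbering G blk)
    (hF : Closed G C F) {s : Store} (h : Ready G C blk F s) {b : Fin m} {u : Fin n}
    (hub : u ∈ blk b) (hcut : u ∈ cutVerts G Finset.univ) (hb : s.reg .b = b) (hu : s.reg .u = u)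
    (h0 : s.reg .updated = 0) :
    Run (.list [.when (.not (.reg .updated)) updateBV, .when (.not (.reg .updated)) updateVB]) s
      (60 * (n + 1) + 80 * (m + 1) + 8) fun s' => (Ready G C blk F s' ∧
        Progress G blk (Settled G C blk s b u) s s') ∧ s'.reg .b = b ∧ s'.reg .u = u := by
  refine Run.seq (60 * (n + 1) + 4) (80 * (m + 1) + 4) (by omega)
    (Run.when_le (60 * (n + 1)) le_rfl (fun _ => ?_) fun he => ?_)
  · refine (run_updateBV h.table hb hu).mono le_rfl fun t ht => ?_
    obtain ⟨h1, h2⟩ := h.raisedBV hblk ht h0 hub hcut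
      fun _ => h.newBV_le hc hbg hblk hF hub hcut
    have htb : t.reg .b = b := (ht.reg _ (by simp)).trans hb
    have htu : t.reg .u = u := (ht.reg _ (by simp)).trans hu
    refine Run.when_le (80 * (m + 1)) le_rfl (fun he => ?_) fun he => ?_
    · rw [eval_not_updated] at he
      rcases h2 with ⟨h3, -⟩ | ⟨h3, h4, h5⟩
      · rw [h3] at he
        exact absurd rfl he
      · refine (run_updateVB h1.table htb htu).mono le_rfl fun t' ht' => ?_
        obtain ⟨h6, h7⟩ := h1.raisedVB hblk ht' h3 hub hcut
          fun hz => h1.newVB_le hc hbg hblk hF hub hcut hz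
        refine ⟨⟨h6, ?_⟩, (ht'.reg _ (by simp)).trans htb, (ht'.reg _ (by simp)).trans htu⟩
        rcases h7 with ⟨h8, h9⟩ | ⟨h8, h9, h10⟩
        · exact .inl ⟨h8, total_congr (G := G) (blk := blk) h4 ▸ h9⟩
        -- The first update has changed no array, so the bound found by the second one also refers
        -- to the original store.
        · rw [h4] at h10
          exact .inr ⟨h8, h9.trans h4, h5 trivial, h10⟩
    · rw [eval_not_updated] at he
      rcases h2 with h3 | ⟨h3, -⟩
      · exact ⟨⟨h1, .inl h3⟩, htb, htu⟩
      · rw [h3] at he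
        exact absurd he one_ne_zero
  · rw [eval_not_updated, if_pos h0] at he
    exact absurd he one_ne_zero

end Iterate

end TokenSliding

namespace TokenSliding

/-! ### Sweeps and the fixed-point loop. -/

section Loop

variable {n m : ℕ} {G : SimpleGraph (Fin n)} {C : Finset (Fin n)} {blk : Fin m → Finset (Fin n)}
  {F : Arc (Fin n) → ℤ}

theorem settled_congr {s s' : Store} (h : s'.arr = s.arr) (b : Fin m) (u : Fin n) :
    Settled G C blk s' b u ↔ Settled G C blk s b u := by
  simp only [Settled, newBV, newVB, FewZeros, h]

theorem Progress.congr {P P' : Prop} {s t t' : Store} (h : Progress G blk P s t)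
    (hreg : t'.reg .updated = t.reg .updated) (harr : t'.arr = t.arr) (hP : P → P') :
    Progress G blk P' s t' := by
  rcases h with ⟨h1, h2⟩ | ⟨h1, h2, h3⟩
  · exact .inl ⟨hreg.trans h1, by rwa [total_congr harr]⟩
  · exact .inr ⟨hreg.trans h1, harr.trans h2, hP h3⟩

/-- The body of the loop in a sweep. -/
def sweepBody : Cmd :=
  .list [.when (.not (.reg .updated)) updateBV, .when (.not (.reg .updated)) updateVB]

/-- A bound for the number of steps of a sweep; `P` is the number of pairs of a block and a vertex in
it. -/
def sweepCost (n m P : ℕ) : ℕ :=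
  20 * ((m + 1) * (n + 1)) + P * (60 * (n + 1) + 80 * (m + 1) + 8)

/-- A sweep that has raised a value skips all later updates. In a sweep without a raise the arrays
stay those of `s`, so the pairs found settled are all settled in the same store, and together they
make the table closed. -/
theorem run_sweep (hc : G.Connected) (hbg : IsBlockGraph G) (hblk : Numbering G blk)
    (hF : Closed G C F) {s : Store} (h : Ready G C blk F s) (h0 : s.reg .updated = 0) :
    Run (forTreeEdges sweepBody) s (sweepCost n m (∑ b, (blk b).card)) fun s' =>
      Ready G C blk F s' ∧ Progress G blk (Closed G C (arcVal blk s)) s s' := by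
  refine (run_forTreeEdges (G := G) (C := C) (blk := blk) (60 * (n + 1) + 80 * (m + 1) + 8)
    (fun b u t => Ready G C blk F t ∧ Progress G blk (∀ c v, v ∈ blk c →
      v ∈ cutVerts G Finset.univ → ((c : ℕ) < b ∨ (c : ℕ) = b ∧ (v : ℕ) < u) →
      Settled G C blk s c v) s t) (fun b u t ht => ht.1.table) ?_ ?_ ?_ ?_ ?_).mono le_rfl ?_
  · rintro b u t x k hx ⟨h1, h2⟩
    refine ⟨h1.congr ?_ ?_ rfl, h2.congr ?_ rfl id⟩ <;> rcases hx with rfl | rfl <;> simp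
  · rintro b u t hub hcut ⟨h1, h2⟩ hb hu
    rcases h2 with ⟨h2, h3⟩ | ⟨h2, h3, h4⟩
    · have he : (Expr.not (.reg .updated)).eval t = 0 := by
        rw [eval_not_updated, h2]
        rfl
      refine Run.seq 4 4 (by omega) (Run.when_le 0 le_rfl (fun h => absurd he h) fun _ => ?_)
      exact Run.when_le 0 le_rfl (fun h => absurd he h) fun _ =>
        ⟨⟨h1, .inl ⟨h2, h3⟩⟩, hb, hu⟩
    · refine (run_sweepBody hc hbg hblk hF h1 hub hcut hb hu h2).mono le_rfl ?_
      rintro t' ⟨⟨h5, h6⟩, hb', hu'⟩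
      refine ⟨⟨h5, ?_⟩, hb', hu'⟩
      rcases h6 with ⟨h6, h7⟩ | ⟨h6, h7, h8⟩
      · exact .inl ⟨h6, total_congr (G := G) (blk := blk) h3 ▸ h7⟩
      · refine .inr ⟨h6, h7.trans h3, fun c v hv hvc hcv => ?_⟩
        by_cases h9 : (c : ℕ) < b ∨ (c : ℕ) = b ∧ (v : ℕ) < u
        · exact h4 c v hv hvc h9
        · obtain rfl : c = b := Fin.ext (by omega)
          obtain rfl : v = u := Fin.ext (by omega)
          exact (settled_congr h3 _ _).1 h8
  · rintro b u t hbu ⟨h1, h2⟩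
    refine ⟨h1, h2.congr rfl rfl fun h3 c v hv hvc hcv => h3 c v hv hvc ?_⟩
    have h4 : ¬ (c = b ∧ v = u) := by
      rintro ⟨rfl, rfl⟩
      exact hbu ⟨hv, hvc⟩
    simp only [Fin.ext_iff] at h4
    omega
  · rintro b t ⟨h1, h2⟩
    refine ⟨h1, h2.congr rfl rfl fun h3 c v hv hvc hcv => h3 c v hv hvc ?_⟩
    have := v.2
    omega
  · exact ⟨h, .inr ⟨h0, rfl, fun c v _ _ h => by omega⟩⟩
  · rintro t ⟨h1, h2⟩
    refine ⟨h1, h2.congr rfl rfl fun h3 => ?_⟩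
    exact closed_of_settled hc hbg hblk h.ua fun b u hub hcut => h3 b u hub hcut (.inl b.2)

/-- The number `d` bounds how far the total is below its maximum. Every sweep except the last raises
the total by at least one, so at most `d + 1` sweeps take place. -/
theorem run_sweeps (hc : G.Connected) (hbg : IsBlockGraph G) (hblk : Numbering G blk)
    (hF : Closed G C F) (hFn : ∀ p ∈ treeArcs G, F p ≤ n) (d : ℕ) {s : Store}
    (h : Ready G C blk F s) (h0 : s.reg .updated = 1)
    (hd : (2 * n * ∑ b, (blk b).card : ℕ) ≤ total G blk s + d) :
    Run (.loop (.reg .updated) (.list [.set .updated 0, forTreeEdges sweepBody])) s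
      ((d + 1) * (sweepCost n m (∑ b, (blk b).card) + 4) + 2) fun s' =>
      Ready G C blk F s' ∧ Closed G C (arcVal blk s') := by
  induction d generalizing s with
  | zero =>
    have h1 : Ready G C blk F (s.setReg .updated 0) := h.congr (by simp) (by simp) rfl
    obtain ⟨t, s', h2, h3, h4, h5⟩ := run_sweep hc hbg hblk hF h1 (by simp)
    have h6 := Exec.seq (Exec.set .updated 0 s) h2
    rcases h5 with ⟨h7, h8⟩ | ⟨h7, h8, h9⟩
    · have h10 := h4.total_le hblk hFn
      rw [total_congr (Store.setReg_arr _ _ _)] at h8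
      simp only [Nat.cast_zero, add_zero] at hd
      omega
    · refine ⟨_, s', .loopTrue (e := .reg .updated) (by simp [Expr.eval, h0]) h6
        (.loopFalse (by simpa [Expr.eval] using h7)), ?_, h4, arcVal_congr h8 ▸ h9⟩
      have : (0 : Expr).cost = 1 := rfl
      simp only [Expr.cost]
      omega
  | succ d ih =>
    have h1 : Ready G C blk F (s.setReg .updated 0) := h.congr (by simp) (by simp) rfl
    obtain ⟨t, s', h2, h3, h4, h5⟩ := run_sweep hc hbg hblk hF h1 (by simp)
    have h6 := Exec.seq (Exec.set .updated 0 s) h2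
    have hcost : (0 : Expr).cost = 1 := rfl
    rcases h5 with ⟨h7, h8⟩ | ⟨h7, h8, h9⟩
    · rw [total_congr (Store.setReg_arr _ _ _)] at h8
      obtain ⟨t', s'', h10, h11, h12⟩ := ih h4 h7 (by push_cast at hd ⊢; linarith)
      refine ⟨_, s'', .loopTrue (e := .reg .updated) (by simp [Expr.eval, h0]) h6 h10, ?_, h12⟩
      simp only [Expr.cost]
      rw [add_mul (d + 1)]
      omega
    · refine ⟨_, s', .loopTrue (e := .reg .updated) (by simp [Expr.eval, h0]) h6
        (.loopFalse (by simpa [Expr.eval] using h7)), ?_, h4, arcVal_congr h8 ▸ h9⟩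
      simp only [Expr.cost]
      rw [add_mul (d + 1), add_mul d]
      omega

theorem run_clearPotentials {s : Store} (ht : Table G C blk n s)
    (hua : UaTable G blk (fun _ _ => 2 * n + 2) s) :
    Run (.for .b (.reg .m) (.for .u (.reg .n) (.list [.put .yBV (.reg .b) (.reg .u) 0,
      .put .yVB (.reg .u) (.reg .b) 0]))) s (40 * ((m + 1) * (n + 1))) fun s' =>
      Table G C blk n s' ∧ UaTable G blk (fun _ _ => 2 * n + 2) s' ∧
      ∀ (b : Fin m) (u : Fin n), s'.arr .yBV b u = 0 ∧ s'.arr .yVB u b = 0 := by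
  refine run_for_const m ((n + 1) * 20) (fun k t => (Table G C blk n t ∧
    UaTable G blk (fun _ _ => 2 * n + 2) t ∧
    ∀ (b : Fin m) (u : Fin n), (b : ℕ) < k → t.arr .yBV b u = 0 ∧ t.arr .yVB u b = 0) ∧
    t.reg .b = k) ?_ ?_ ?_ ?_ ?_
  · have : (Expr.reg .m).cost = 1 := rfl
    rw [this]
    nlinarith
  · exact ⟨⟨ht.congr (by simp) (by simp) rfl rfl rfl, hua.congr rfl rfl, by simp⟩, by simp⟩
  · rintro k t - ⟨⟨h1, -⟩, h2⟩
    exact ⟨h2, h1.reg_m⟩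
  · rintro k t hk ⟨⟨h1, h2, h3⟩, hb⟩
    refine run_for_const n 10 (fun l t => (Table G C blk n t ∧
      UaTable G blk (fun _ _ => 2 * n + 2) t ∧
      ∀ (b : Fin m) (u : Fin n), ((b : ℕ) < k ∨ (b : ℕ) = k ∧ (u : ℕ) < l) →
        t.arr .yBV b u = 0 ∧ t.arr .yVB u b = 0) ∧ t.reg .b = k ∧ t.reg .u = l) ?_ ?_ ?_ ?_ ?_
    · have : (Expr.reg .n).cost = 1 := rfl
      rw [this]
      omega
    · exact ⟨⟨h1.congr (by simp) (by simp) rfl rfl rfl, h2.congr rfl rfl, fun b u hbu =>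
        h3 b u (by omega)⟩, by simpa using hb, by simp⟩
    · rintro l t - ⟨⟨h1, -⟩, -, h2⟩
      exact ⟨h2, h1.reg_n⟩
    · rintro l t hl ⟨⟨h1, h2, h3⟩, hb, hu⟩
      refine run_of_loopFree rfl (by decide) ?_
      simp only [Cmd.list, Cmd.result]
      refine ⟨⟨h1.congr (by simp) (by simp) ?_ ?_ ?_, h2.congr ?_ ?_, fun b u hbu => ?_⟩,
        by simp [hb], by simp [hu]⟩
      any_goals (funext i j; simp)
      have h4 := h3 b u
      simp only [Expr.eval_zero, Expr.eval, hb, hu, Store.setReg_arr, Store.setArr_arr,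
        Store.setArr_reg, reduceCtorEq, false_and, if_false, true_and]
      by_cases h5 : (b : ℕ) < k ∨ (b : ℕ) = k ∧ (u : ℕ) < l
      · simp [h4 h5]
      · have h6 : (b : ℕ) = k ∧ (u : ℕ) = l := by omega
        simp [h6.1, h6.2]
    · rintro t ⟨⟨h1, h2, h3⟩, hb, hu⟩
      exact ⟨⟨h1.congr (by simp) (by simp) rfl rfl rfl, h2.congr rfl rfl, fun b u hbu =>
        h3 b u (by have := u.2; omega)⟩, by simp [hb]⟩
  · rintro t ⟨⟨h1, h2, h3⟩, -⟩
    exact ⟨h1, h2, fun b u => h3 b u b.2⟩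

/-- The potentials are taken as `F`. They are closed and nonnegative, so the table stays below them
from the zero start onward. At the exit the table is closed and nonnegative, so it is also above
them. -/
theorem run_iteratePotentials (hc : G.Connected) (hbg : IsBlockGraph G) (hblk : Numbering G blk)
    (hC : G.IsIndepSet (C : Set (Fin n))) {s : Store} (ht : Table G C blk n s)
    (hua : UaTable G blk (fun _ _ => 2 * n + 2) s) :
    Run iteratePotentials s (40 * ((m + 1) * (n + 1)) + 4 + (2 * n * (∑ b, (blk b).card) + 1) *
      (sweepCost n m (∑ b, (blk b).card) + 4)) fun s' =>
      Table G C blk n s' ∧ ∀ p ∈ treeArcs G, IsPot G C p (arcVal blk s' p) := by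
  choose F hF using fun p => exists_isPot (G := G) p C
  have hF' : ∀ p ∈ treeArcs G, IsPot G C p (F p) := fun p _ => hF p
  have hcl : Closed G C F := closed_of_isPot hc hbg hC hF'
  have hFn : ∀ p ∈ treeArcs G, F p ≤ n := fun p hp => by
    simpa using pot_le_card hc hbg hC hp (hF p)
  refine Run.seq (40 * ((m + 1) * (n + 1))) (4 + (2 * n * (∑ b, (blk b).card) + 1) *
      (sweepCost n m (∑ b, (blk b).card) + 4)) (by omega)
    ((run_clearPotentials ht hua).mono le_rfl ?_)
  rintro s₁ ⟨h1, h2, h3⟩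
  refine Run.seq 2 (2 + (2 * n * (∑ b, (blk b).card) + 1) *
      (sweepCost n m (∑ b, (blk b).card) + 4)) (by omega) (run_of_loopFree rfl (by decide) ?_)
  set s₂ : Store := Cmd.result _ s₁ with hs₂
  have harr : s₂.arr = s₁.arr := rfl
  have hzero : ∀ p ∈ treeArcs G, arcVal blk s₂ p = 0 := by
    intro p hp
    obtain ⟨b, hb⟩ := (hblk.mem _).1 hp.2.1
    cases p with
    | toCut B u =>
      obtain rfl : blk b = B := hb
      rw [arcVal_toCut hblk, harr, (h3 b u).1]
    | toBlock u B =>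
      obtain rfl : blk b = B := hb
      rw [arcVal_toBlock hblk, harr, (h3 b u).2]
  have hready : Ready G C blk F s₂ := by
    refine ⟨h1.congr (by simp [hs₂, Cmd.result]) (by simp [hs₂, Cmd.result]) rfl rfl rfl,
      h2.congr rfl rfl, fun p hp => ?_⟩
    rw [hzero p hp]
    exact ⟨le_rfl, pot_nonneg hc hbg hC hp (hF p)⟩
  have htotal : total G blk s₂ = 0 := by
    simp [total, harr, h3]
  refine (run_sweeps hc hbg hblk hcl hFn (2 * n * ∑ b, (blk b).card) hready
    (by simp [hs₂, Cmd.result]) (by rw [htotal, zero_add])).mono (by omega) ?_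
  rintro s' ⟨h4, h5⟩
  refine ⟨h4.table, fun p hp => ?_⟩
  have h6 := h4.bound p hp
  have h7 := h5.pot_le hc hbg hC (fun q hq => (h4.bound q hq).1) hp (hF p)
  rw [le_antisymm h6.2 h7]
  exact hF p

end Loop

end TokenSliding

namespace TokenSliding

/-! ### The total running time in terms of the number of edges. -/

section Bounds

variable {n m : ℕ} {G : SimpleGraph (Fin n)} {C : Finset (Fin n)} {blk : Fin m → Finset (Fin n)}

/-- Incident pairs are counted by vertices. Choosing a further vertex in each block through `u`
gives distinct neighbours of `u`, since distinct blocks share only `u`. Hence `u` lies in at most as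
many blocks as its degree, and the degrees sum to twice the number of edges. The graph with one
vertex has one block of size one and no edges, which the maximum with 1 covers. -/
theorem sum_card_blocks_le (hc : G.Connected) (hbg : IsBlockGraph G) (hblk : Numbering G blk) :
    ∑ b, (blk b).card ≤ 2 * max 1 G.edgeSet.ncard := by
  classical
  by_cases hn : n = 1
  · subst hn
    have h1 : ∀ b b', blk b = blk b' := fun b b' => by
      have h2 : ∀ b, blk b = Finset.univ := fun b => by
        rcases (mem_blocks_iff_leads hc hbg).1 ((hblk.mem (blk b)).2 ⟨b, rfl⟩) with
          ⟨-, h⟩ | ⟨i, j, h, -⟩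
        · exact h
        · exact absurd h.1 (by rw [Subsingleton.elim i j]; exact lt_irrefl _)
      rw [h2, h2]
    have h2 : Fintype.card (Fin m) ≤ 1 := Fintype.card_le_one_iff.2 fun b b' => hblk.inj (h1 b b')
    have h3 : ∑ b, (blk b).card ≤ ∑ _b : Fin m, 1 := Finset.sum_le_sum fun b _ => by
      simpa using Finset.card_le_univ (blk b)
    simp only [Finset.sum_const, Finset.card_univ, smul_eq_mul, mul_one] at h3
    omega
  · have h1 : ∑ b, (blk b).card = ∑ u, (Finset.univ.filter fun b => u ∈ blk b).card := by
      have h2 : ∀ b, (blk b).card = ∑ u, if u ∈ blk b then 1 else 0 := fun b => by simp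
      simp only [h2, Finset.card_filter]
      exact Finset.sum_comm
    have h2 : ∀ u, (Finset.univ.filter fun b => u ∈ blk b).card ≤ G.degree u := by
      intro u
      have h3 : ∀ b, ∃ w, u ∈ blk b → w ∈ blk b ∧ w ≠ u := fun b => by
        obtain ⟨x, hx, y, hy, hxy⟩ := exists_ne_of_mem_blocks hc hn ((hblk.mem _).2 ⟨b, rfl⟩)
        by_cases h : x = u
        · exact ⟨y, fun _ => ⟨hy, fun h' => hxy (h.trans h'.symm)⟩⟩
        · exact ⟨x, fun _ => ⟨hx, h⟩⟩
      choose f hf using h3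
      rw [← SimpleGraph.card_neighborFinset_eq_degree]
      refine Finset.card_le_card_of_injOn f (fun b hb => ?_) fun b hb b' hb' he => ?_
      · have hub : u ∈ blk b := by simpa using hb
        obtain ⟨h4, h5⟩ := hf b hub
        simpa using adj_of_mem_block hbg ((hblk.mem _).2 ⟨b, rfl⟩) hub h4 h5.symm
      · have hub : u ∈ blk b := by simpa using hb
        have hub' : u ∈ blk b' := by simpa using hb'
        obtain ⟨h4, h5⟩ := hf b hub
        obtain ⟨h4', -⟩ := hf b' hub'
        exact hblk.inj (block_eq_of_two_mem hbg ((hblk.mem _).2 ⟨b, rfl⟩)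
          ((hblk.mem _).2 ⟨b', rfl⟩) hub hub' h4 (he ▸ h4') h5.symm)
    have h3 : G.edgeSet.ncard = G.edgeFinset.card := by
      rw [Set.ncard_eq_toFinset_card', SimpleGraph.edgeFinset]
    have h4 := G.sum_degrees_eq_twice_card_edges
    have h5 := Finset.sum_le_sum fun u (_ : u ∈ Finset.univ) => h2 u
    have h6 := le_max_right 1 G.edgeSet.ncard
    omega

theorem numBlocks_le (hblk : Numbering G blk) : m ≤ ∑ b, (blk b).card := by
  have : ∑ _b : Fin m, 1 ≤ ∑ b, (blk b).card := Finset.sum_le_sum fun b _ =>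
    Finset.card_pos.2 (block_nonempty ((hblk.mem _).2 ⟨b, rfl⟩))
  simpa using this

theorem card_le_max_edges (hc : G.Connected) : n ≤ max 1 G.edgeSet.ncard + 1 := by
  have h1 := hc.card_vert_le_card_edgeSet_add_one
  rw [Nat.card_eq_fintype_card, Fintype.card_fin, Nat.card_coe_set_eq] at h1
  have := le_max_right 1 G.edgeSet.ncard
  omega

/-- Only the fixed-point loop has order `M ^ 4`: its `2 * n * P + 1` sweeps are at most `9 * M ^ 2`
in number and cost at most `1040 * M ^ 2` each, including the overhead of a round. All other phases
are at most cubic, and the coefficients add up to less than 20000. -/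
theorem totalCost_le {n m P M : ℕ} (hM : 1 ≤ M) (hn : n ≤ M + 1) (hm : m ≤ P) (hP : P ≤ 2 * M) :
    100 * (n + 1) ^ 3 + (60 * ((n + 1) * (m + 1)) + ((2 * n + 3) * (20 * ((m + 1) * (n + 1)) +
      P * (50 * (n + 1) + 50 * (m + 1)) + 12) + (40 * ((m + 1) * (n + 1)) + 4 +
      (2 * n * P + 1) * (sweepCost n m P + 4)))) ≤ 20000 * M ^ 4 := by
  have h1 : n + 1 ≤ 3 * M := by omega
  have h2 : m + 1 ≤ 3 * M := by omega
  have h3 : (m + 1) * (n + 1) ≤ (3 * M) * (3 * M) := Nat.mul_le_mul h2 h1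
  have h3' : (n + 1) * (m + 1) ≤ (3 * M) * (3 * M) := Nat.mul_le_mul h1 h2
  have h4 : (n + 1) ^ 3 ≤ (3 * M) ^ 3 := Nat.pow_le_pow_left h1 3
  have h5 : P * (50 * (n + 1) + 50 * (m + 1)) ≤ (2 * M) * (300 * M) :=
    Nat.mul_le_mul hP (by omega)
  have h6 : P * (60 * (n + 1) + 80 * (m + 1) + 8) ≤ (2 * M) * (428 * M) :=
    Nat.mul_le_mul hP (by omega)
  have h7 : 2 * n * P ≤ (2 * (2 * M)) * (2 * M) := Nat.mul_le_mul (by omega) hP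
  have q1 : 1 ≤ M ^ 2 := Nat.one_le_pow _ _ hM
  have q3 : M ^ 2 ≤ M ^ 4 := Nat.pow_le_pow_right hM (by norm_num)
  have q4 : M ^ 3 ≤ M ^ 4 := Nat.pow_le_pow_right hM (by norm_num)
  have h8 : (2 * n + 3) * (20 * ((m + 1) * (n + 1)) + P * (50 * (n + 1) + 50 * (m + 1)) + 12) ≤
      (7 * M) * (792 * M ^ 2) := Nat.mul_le_mul (by omega) (by
        have : (3 * M) * (3 * M) = 9 * M ^ 2 := by ring
        have : (2 * M) * (300 * M) = 600 * M ^ 2 := by ring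
        omega)
  have h9 : (2 * n * P + 1) * (sweepCost n m P + 4) ≤ (9 * M ^ 2) * (1040 * M ^ 2) := by
    have e1 : (3 * M) * (3 * M) = 9 * M ^ 2 := by ring
    have e2 : (2 * M) * (428 * M) = 856 * M ^ 2 := by ring
    have e3 : (2 * (2 * M)) * (2 * M) = 8 * M ^ 2 := by ring
    unfold sweepCost
    exact Nat.mul_le_mul (by omega) (by omega)
  have e1 : (3 * M) * (3 * M) = 9 * M ^ 2 := by ring
  have e4 : (3 * M) ^ 3 = 27 * M ^ 3 := by ring
  have e5 : (7 * M) * (792 * M ^ 2) = 5544 * M ^ 3 := by ring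
  have e6 : (9 * M ^ 2) * (1040 * M ^ 2) = 9360 * M ^ 4 := by ring
  omega

theorem run_computePotentials (hc : G.Connected) (hbg : IsBlockGraph G)
    (hC : G.IsIndepSet (C : Set (Fin n))) :
    Run computePotentials (inputStore G C) (20000 * (max 1 G.edgeSet.ncard) ^ 4)
      (HoldsPotentials G C) := by
  obtain ⟨t₁, s₁, e₁, c₁, m, blk₀, h₁⟩ := run_findBlocks (C := C) hc
  obtain ⟨blk, hblk, h₁⟩ := h₁.exists_table hc hbg
  obtain ⟨t₂, s₂, e₂, c₂, h₂⟩ := run_findCutVerts hc hbg hblk h₁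
  obtain ⟨t₃, s₃, e₃, c₃, h₃, hua⟩ := run_computeUa hc hbg hblk h₂
  obtain ⟨t₄, s₄, e₄, c₄, h₄, hpot⟩ := run_iteratePotentials hc hbg hblk hC h₃ hua
  refine ⟨_, s₄, .seq e₁ (.seq e₂ (.seq e₃ e₄)), ?_, m, blk, h₄.reg_m, hblk.inj, hblk.mem,
    h₄.inB, fun b u => ⟨fun hp => ?_, fun hp => ?_⟩⟩
  · have := totalCost_le (le_max_left 1 G.edgeSet.ncard) (card_le_max_edges hc)
      (numBlocks_le hblk) (sum_card_blocks_le hc hbg hblk)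
    omega
  · exact arcVal_toCut hblk s₄ b u ▸ hpot _ hp
  · exact arcVal_toBlock hblk s₄ b u ▸ hpot _ hp

end Bounds

end TokenSliding

theorem mainTheorem3 :
    ∃ K : ℕ, ∀ (n : ℕ) (G : SimpleGraph (Fin n)) (C : Finset (Fin n)),
      G.Connected → TokenSliding.IsBlockGraph G → G.IsIndepSet (C : Set (Fin n)) →
      ∃ (t : ℕ) (s : TokenSliding.Store),
        TokenSliding.Exec TokenSliding.computePotentials (TokenSliding.inputStore G C) t s ∧
        t ≤ K * (max 1 G.edgeSet.ncard) ^ 4 ∧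
        TokenSliding.HoldsPotentials G C s :=
  ⟨20000, fun _ _ _ hc hbg hC => TokenSliding.run_computePotentials hc hbg hC⟩
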